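/- **Setting.** Let $E$ be a finite-dimensional real normed space with norm $\|\cdot\|_w$ and dual norm $\|\cdot\|_{w,*}$, and let $\mathcal W\subseteq E$ be nonempty, closed and convex. Let $\nu_w$ be a distance-generating function on $\mathcal W$: it is continuous and $1$-strongly convex w.r.t. $\|\cdot\|_w$ on $\mathcal W$, and differentiable (relative to $\mathcal W$) at every point of $\mathcal W$ where it has a subgradient. Put $B_w(u,v)=\nu_w(u)-\nu_w(v)-\langle\nabla\nu_w(v),u-v\rangle$ and $o_w=\arg\min_{\mathcal W}\nu_w$. Let $m\ge 2$, $\Delta_m=\{q\in\mathbb R^m: q\ge 0,\ \sum_i q_i=1\}$, $\nu_q(q)=\sum_i q_i\ln q_i$, and let $B_q$ be the Bregman distance of $\nu_q$ on $\Delta_m$ (the Kullback–Leibler divergence). Let $\mathcal P_1,\dots,\mathcal P_m$ be probability distributions on a measurable space $\mathcal Z$ and let $\ell(w;z)$ be a loss that is differentiable in $w\in\mathcal W$, with $\ell$ and $\nabla\ell$ jointly measurable. Put $R_i(w)=\mathrm E_{z\sim\mathcal P_i}[\ell(w;z)]$, $R_i^*=\min_{w\in\mathcal W}R_i(w)$,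 $\phi(w,q)=\sum_{i=1}^m q_i[R_i(w)-R_i^*]$ and $$\epsilon_\phi(\bar w,\bar q)=\max_{q\in\Delta_m}\phi(\bar w,q)-\min_{w\in\mathcal W}\phi(w,\bar q).$$ **Assumptions.** All $R_i$ are convex on $\mathcal W$. There are constants $D,G>0$ with $\max_{w\in\mathcal W}B_w(w,o_w)\le D^2$ and, for every $i$ and $\mathcal P_i$-almost every $z$, $\|\nabla\ell(w;z)\|_{w,*}\le G$ and $0\le\ell(w;z)\le 1$ for all $w\in\mathcal W$. **Algorithm.** For $t=1,2,\dots$ let $z_t=(z_t^{(1)},\dots,z_t^{(m)})$ with $z_t^{(i)}\sim\mathcal P_i$, where $z_1,z_2,\dots$ are independent. Use the step sizes $$\eta_t^{(i)}=\frac{D}{G\sqrt t},\qquad \eta_t^w=\frac{2D^2}{\sqrt{(2D^2G^2+2\ln m)t}},\qquad \eta_t^q=\frac{2\ln m}{\sqrt{(2D^2G^2+2\ln m)t}} .$$ Start from $w_1=w_1^{(1)}=\dots=w_1^{(m)}=o_w$ and $q_1=(1/m,\dots,1/m)$, and for $t\ge 1$ let $$w^{(i)}_{t+1}=\arg\min_{w\in\mathcal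 W}\{\eta_t^{(i)}\langle\nabla\ell(w_t^{(i)};z_t^{(i)}),w-w_t^{(i)}\rangle+B_w(w,w_t^{(i)})\},\qquad \bar w_t^{(i)}=\frac{\sum_{j=1}^t\eta_j^{(i)}w_j^{(i)}}{\sum_{k=1}^t\eta_k^{(i)}},$$ $$w_{t+1}=\arg\min_{w\in\mathcal W}\Big\{\eta_t^w\Big\langle\sum_{i=1}^m q_{t,i}\nabla\ell(w_t;z_t^{(i)}),w-w_t\Big\rangle+B_w(w,w_t)\Big\},$$ $$q_{t+1}=\arg\min_{q\in\Delta_m}\{\eta_t^q\langle -g_t,q-q_t\rangle+B_q(q,q_t)\},\qquad g_{t,i}=\ell(w_t;z_t^{(i)})-\ell(\bar w_t^{(i)};z_t^{(i)}),$$ $$\bar w_t=\frac{\sum_{j=1}^t\eta_j^w w_j}{\sum_{k=1}^t\eta_k^w},\qquad \bar q_t=\frac{\sum_{j=1}^t\eta_j^q q_j}{\sum_{k=1}^t\eta_k^q}.$$ **Conclusion.** For every $t\ge 1$, $$\mathrm E[\epsilon_\phi(\bar w_t,\bar q_t)]\le\frac{(5+3\ln t)\sqrt{2D^2G^2+2\ln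 m}+2DG\left[3+\ln t+16(1+\sqrt{\ln m})\sqrt{2(1+\ln t)}\right](1+\ln t)}{2(\sqrt{t+1}-1)} .$$ Furthermore, for every $\delta\in(0,1)$, with probability at least $1-2\delta$, simultaneously for all $t\ge 1$, $$\epsilon_\phi(\bar w_t,\bar q_t)\le\frac{1}{2(\sqrt{t+1}-1)}\Big[\sqrt{2D^2G^2+2\ln m}\Big(5+3\ln t+8\sqrt{(1+\ln t)\ln\tfrac{2t^2}{\delta}}\Big)+2DG\Big(3+\ln t+16\sqrt{(1+\ln t)\ln\tfrac{2mt^2}{\delta}}\Big)(1+\ln t)\Big].$$ Both right-hand sides are $O\big((\log^2 t+\log^{1/2}m\,\log^{3/2}t)/\sqrt t\big)$: for all $m\ge 2$ and $t\ge 2$ they are at most $C$ times this rate, where $C$ depends only on $D$ and $G$ (and on $\delta$ for the second one). -/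

import Mathlib

open MeasureTheory ProbabilityTheory

noncomputable section

/-- `x` is a minimizer of `f` over `S`. -/
def IsArgmin {E : Type*} (f : E → ℝ) (S : Set E) (x : E) : Prop :=
  x ∈ S ∧ ∀ y ∈ S, f x ≤ f y

/-- `ν` has a subgradient at `v` relative to the set `W`. -/
def HasSubgradientOn {E : Type*} [NormedAddCommGroup E] [NormedSpace ℝ E]
    (ν : E → ℝ) (W : Set E) (v : E) : Prop :=
  ∃ g : E →L[ℝ] ℝ, ∀ u ∈ W, ν v + g (u - v) ≤ ν u

/-- `ν` is a distance-generating function on `W`: continuous on `W`, `1`-strongly convex on `W`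
with respect to the norm of the ambient space, and differentiable at every point of `W` at which
it has a subgradient. (So `∇ν` may fail to exist at some boundary points, as for the entropy on
the simplex. All these notions are relative to `W`; `W` may have empty interior.) -/
structure IsDistanceGenerating {E : Type*} [NormedAddCommGroup E] [NormedSpace ℝ E]
    (ν : E → ℝ) (W : Set E) : Prop where
  continuousOn : ContinuousOn ν W
  strongConvexOn : StrongConvexOn W 1 ν
  differentiableWithinAt : ∀ v ∈ W, HasSubgradientOn ν W v → DifferentiableWithinAt ℝ ν W v

/-- Bregman distance `B(u, v) = ν(u) - [ν(v) + ⟨∇ν(v), u - v⟩]` of `ν` on the convex set `W`.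
For `u, v ∈ W` with `ν` differentiable at `v` relative to `W`, the number `⟨∇ν(v), u - v⟩` does
not depend on the choice of the derivative, even if `W` has empty interior. -/
def bregman {E : Type*} [NormedAddCommGroup E] [NormedSpace ℝ E]
    (ν : E → ℝ) (W : Set E) (u v : E) : ℝ :=
  ν u - (ν v + fderivWithin ℝ ν W v (u - v))

/-- The (negative) entropy `∑ i, q i * log (q i)`, the distance-generating function of the
simplex. -/
def entropy {m : ℕ} (q : Fin m → ℝ) : ℝ := ∑ i, q i * Real.log (q i)

/-- The mirror descent update: `x'` minimizes `η ⟨g, x - x₀⟩ + B(x, x₀)` over `x ∈ W`. -/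
def IsMirrorStep {E : Type*} [NormedAddCommGroup E] [NormedSpace ℝ E]
    (ν : E → ℝ) (W : Set E) (η : ℝ) (g : E → ℝ) (x₀ x' : E) : Prop :=
  IsArgmin (fun x => η * g (x - x₀) + bregman ν W x x₀) W x'

/-- The weighted average `∑_{j=1}^t η j x j / ∑_{k=1}^t η k`. -/
def weightedAvg {E : Type*} [AddCommGroup E] [Module ℝ E] (η : ℕ → ℝ) (x : ℕ → E) (t : ℕ) : E :=
  ∑ j ∈ Finset.Icc 1 t, (η j / ∑ k ∈ Finset.Icc 1 t, η k) • x j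

/-- The run of the anytime algorithm on one realization `z` of the samples. Rounds are numbered
`t = 1, 2, …` (index `0` is not used). Here `z t i` is the sample from the `i`-th distribution in
round `t`, `u t i` is the `t`-th iterate of the `i`-th auxiliary mirror descent, and `w t`, `q t`
are the iterates for the saddle-point problem; `ℓ` is the loss and `dℓ` its gradient; `ηi`, `ηw`
and `ηq` are the step sizes. -/
structure IsAnytimeRun {E Z : Type*} [NormedAddCommGroup E] [NormedSpace ℝ E] {m : ℕ}
    (W : Set E) (ν : E → ℝ) (ℓ : E → Z → ℝ) (dℓ : E → Z → (E →L[ℝ] ℝ))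
    (ηi : Fin m → ℕ → ℝ) (ηw ηq : ℕ → ℝ)
    (z : ℕ → Fin m → Z) (u : ℕ → Fin m → E) (w : ℕ → E) (q : ℕ → Fin m → ℝ) : Prop where
  init_u : ∀ i, IsArgmin ν W (u 1 i)
  init_w : IsArgmin ν W (w 1)
  init_q : ∀ i, q 1 i = 1 / (m : ℝ)
  step_u : ∀ t, 1 ≤ t → ∀ i,
    IsMirrorStep ν W (ηi i t) (fun v => dℓ (u t i) (z t i) v) (u t i) (u (t + 1) i)
  step_w : ∀ t, 1 ≤ t →
    IsMirrorStep ν W (ηw t) (fun v => ∑ i, q t i * dℓ (w t) (z t i) v) (w t) (w (t + 1))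
  step_q : ∀ t, 1 ≤ t →
    IsMirrorStep entropy (stdSimplex ℝ (Fin m)) (ηq t)
      (fun v => ∑ i, -(ℓ (w t) (z t i)
        - ℓ (weightedAvg (ηi i) (fun j => u j i) t) (z t i)) * v i)
      (q t) (q (t + 1))

/-- The risk `R(w) = E_{z ∼ P} [ℓ(w; z)]`. -/
def risk {E Z : Type*} [MeasurableSpace Z] (P : Measure Z) (ℓ : E → Z → ℝ) (w : E) : ℝ :=
  ∫ z, ℓ w z ∂P

/-- The minimal risk `R^* = min_{w ∈ W} R(w)`. -/
def minRisk {E Z : Type*} [MeasurableSpace Z] (P : Measure Z) (ℓ : E → Z → ℝ) (W : Set E) : ℝ :=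
  sInf (risk P ℓ '' W)

/-- The saddle function `φ(w, q) = ∑ i, q i [R_i(w) - R_i^*]`. -/
def saddle {E Z : Type*} [MeasurableSpace Z] {m : ℕ} (P : Fin m → Measure Z) (ℓ : E → Z → ℝ)
    (W : Set E) (w : E) (q : Fin m → ℝ) : ℝ :=
  ∑ i, q i * (risk (P i) ℓ w - minRisk (P i) ℓ W)

/-- The optimization error (duality gap)
`max_{q' ∈ Δ_m} φ(w, q') - min_{w' ∈ W} φ(w', q)`. -/
def optError {E Z : Type*} [MeasurableSpace Z] {m : ℕ} (P : Fin m → Measure Z) (ℓ : E → Z → ℝ)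
    (W : Set E) (w : E) (q : Fin m → ℝ) : ℝ :=
  sSup ((fun q' => saddle P ℓ W w q') '' stdSimplex ℝ (Fin m))
    - sInf ((fun w' => saddle P ℓ W w' q) '' W)

/-- The step size `D / (G √t)` of the auxiliary mirror descents. -/
def stepI (D G : ℝ) (t : ℕ) : ℝ := D / (G * √(t : ℝ))

/-- The step size for `w`. -/
def stepW (D G : ℝ) (m t : ℕ) : ℝ :=
  2 * D ^ 2 / √((2 * D ^ 2 * G ^ 2 + 2 * Real.log m) * t)

/-- The step size for `q`. -/
def stepQ (D G : ℝ) (m t : ℕ) : ℝ :=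
  2 * Real.log m / √((2 * D ^ 2 * G ^ 2 + 2 * Real.log m) * t)

/-- The explicit bound on the expected optimization error after `t` rounds. -/
def expBound (D G : ℝ) (m t : ℕ) : ℝ :=
  ((5 + 3 * Real.log t) * √(2 * D ^ 2 * G ^ 2 + 2 * Real.log m)
    + 2 * D * G * (3 + Real.log t + 16 * (1 + √(Real.log m)) * √(2 * (1 + Real.log t)))
      * (1 + Real.log t))
  / (2 * (√((t : ℝ) + 1) - 1))

/-- The explicit high-probability bound on the optimization error after `t` rounds. -/
def highProbBound (D G δ : ℝ) (m t : ℕ) : ℝ :=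
  1 / (2 * (√((t : ℝ) + 1) - 1)) *
    (√(2 * D ^ 2 * G ^ 2 + 2 * Real.log m)
        * (5 + 3 * Real.log t + 8 * √((1 + Real.log t) * Real.log (2 * (t : ℝ) ^ 2 / δ)))
      + 2 * D * G
        * (3 + Real.log t + 16 * √((1 + Real.log t) * Real.log (2 * m * (t : ℝ) ^ 2 / δ)))
        * (1 + Real.log t))

/-- The rate `(log² t + log^{1/2} m · log^{3/2} t) / √t`. -/
def anytimeRate (m t : ℕ) : ℝ :=
  (Real.log t ^ 2 + Real.log m ^ (1 / 2 : ℝ) * Real.log t ^ (3 / 2 : ℝ)) / √(t : ℝ)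

end

/-! The proof is a pathwise regret analysis of a stochastic saddle-point method, followed by
martingale estimates. By Jensen in `w` and linearity in `q`, the duality gap of the averages is at
most the supremum over comparators `w'`, `q'` of the weighted mean of `φ(w_j, q') - φ(w', q_j)`
(`optError_weightedAvg_le`). This needs the same weights for `w` and `q`; they agree because every
step size is a multiple of `1/√j`.

Each round splits (`saddle_sub_le`) into the linear regret of the actual stochastic gradients, the
noise of these gradients tested against the comparator, and a bias, since the algorithm compares
with the loss at an auxiliary average instead of the unknown minimal risk. Only the risks are
convex, not the individual losses, so linearization uses the expected gradient (`risk_subgradient`).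

The regrets are bounded for every typical sample path: mirror descent for `w`
(`mirrorDescent_regret`) and exponential weights for `q` (`softmax_regret`). The noise is the
delicate term: the worst comparator depends on all samples, so noise tested against it is not a
martingale. Ghost iterates, which run dual averaging and exponential weights on the noise itself,
separate the two. Noise against `iterate - ghost` is a martingale difference, because both points
are known from the past; noise against `ghost - comparator` is again a regret and is bounded
deterministically. This gives `sum_saddle_sub_le`.

The bias is the excess risk of the auxiliary averages (`excessRisk_avgU_le`). Here the comparator is
a fixed minimizer of one risk, so no ghost is needed. The bias in round `j` is `1/√j` up to
logarithms and a martingale term, and weighting it with `1/√j` costs one more logarithm.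

All martingales have increments of order `1/√j`, hence variance proxy of order `1 + log t`.
Azuma-Hoeffding and a union bound over rounds and distributions give the high-probability bound. In
expectation the gap martingale vanishes, and the largest of the `m` auxiliary martingales is
controlled by exponential moments (`exists_integrable_dominating`).

The iterates are given only as minimizers, so adaptedness has to be proved: strong convexity gives
quadratic growth, which makes a minimizer a measurable limit of approximate ones. -/

/-! ### Measurability of minimizers. -/

section MeasurableArgmin

variable {E : Type*} [NormedAddCommGroup E] {W : Set E}
  {Ω : Type*} {mΩ : MeasurableSpace Ω} [MeasurableSpace E] [BorelSpace E]

theorem ContinuousOn.measurable_comp_of_mem {F : Type*} [TopologicalSpace F] [MeasurableSpace F]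
    [BorelSpace F] {f : E → F} (hf : ContinuousOn f W) {X : Ω → E} (hX : Measurable X)
    (hmem : ∀ ω, X ω ∈ W) : Measurable (fun ω => f (X ω)) :=
  (continuousOn_iff_continuous_domRestrict.1 hf).measurable.comp (hX.subtype_mk (h := hmem))

/-- Quadratic growth forces any approximate minimizer to be close to the true one, so it suffices to
choose approximate minimizers measurably from a countable dense subset of `W`. -/
theorem measurable_of_isArgmin [SecondCountableTopology E] {F : Ω → E → ℝ} {x : Ω → E}
    (hx : ∀ ω, IsArgmin (F ω) W (x ω))
    (hgrowth : ∀ ω, ∀ u ∈ W, F ω (x ω) + ‖u - x ω‖ ^ 2 / 2 ≤ F ω u)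
    (hcont : ∀ ω, ContinuousOn (F ω) W) (hmeas : ∀ u ∈ W, Measurable fun ω => F ω u) :
    Measurable x := by
  classical
  rcases isEmpty_or_nonempty Ω with hΩ | ⟨⟨ω₀⟩⟩
  · exact measurable_of_empty x
  have : Nonempty W := ⟨⟨x ω₀, (hx ω₀).1⟩⟩
  set d : ℕ → W := TopologicalSpace.denseSeq W
  have hd : DenseRange d := TopologicalSpace.denseRange_denseSeq W
  have happrox : ∀ ω, ∀ ε > 0, ∃ k, F ω (d k) < F ω (x ω) + ε := by
    intro ω ε hε
    have hc : Continuous (fun v : W => F ω v) := continuousOn_iff_continuous_domRestrict.1 (hcont ω)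
    have hop : IsOpen {v : W | F ω v < F ω (x ω) + ε} := isOpen_lt hc continuous_const
    obtain ⟨k, hk⟩ := hd.exists_mem_open hop ⟨⟨x ω, (hx ω).1⟩, by
      change F ω (x ω) < F ω (x ω) + ε; linarith⟩
    exact ⟨k, hk⟩
  -- Near-minimality is tested only against the dense sequence, which makes the condition a
  -- countable intersection; the first index satisfying it is a measurable choice.
  let p : ℕ → Ω → ℕ → Prop := fun n ω k => ∀ j, F ω (d k) ≤ F ω (d j) + 1 / ((n : ℝ) + 1)
  have hp : ∀ n ω, ∃ k, p n ω k := by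
    intro n ω
    obtain ⟨k, hk⟩ := happrox ω (1 / ((n : ℝ) + 1)) (by positivity)
    exact ⟨k, fun j => hk.le.trans (by linarith [(hx ω).2 _ (d j).2])⟩
  have hpm : ∀ n k, MeasurableSet {ω | p n ω k} := by
    intro n k
    have : {ω | p n ω k} = ⋂ j, {ω | F ω (d k) ≤ F ω (d j) + 1 / ((n : ℝ) + 1)} := by
      ext ω; simp [p]
    rw [this]
    exact MeasurableSet.iInter fun j =>
      measurableSet_le (hmeas _ (d k).2) ((hmeas _ (d j).2).add_const _)
  have hfind : ∀ n, Measurable fun ω => (d (Nat.find (hp n ω)) : E) := fun n =>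
    (measurable_from_nat (f := fun k => (d k : E))).comp (measurable_find (hp n) (hpm n))
  refine measurable_of_tendsto_metrizable hfind (tendsto_pi_nhds.2 fun ω => ?_)
  have hclose : ∀ n : ℕ, ‖(d (Nat.find (hp n ω)) : E) - x ω‖ ^ 2 ≤ 2 * (1 / ((n : ℝ) + 1)) := by
    intro n
    have h1 := Nat.find_spec (hp n ω)
    have h2 := hgrowth ω _ (d (Nat.find (hp n ω))).2
    have h3 : F ω (d (Nat.find (hp n ω))) ≤ F ω (x ω) + 1 / ((n : ℝ) + 1) := by
      refine le_of_forall_pos_le_add fun ε hε => ?_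
      obtain ⟨k, hk⟩ := happrox ω ε hε
      linarith [h1 k]
    linarith
  rw [tendsto_iff_norm_sub_tendsto_zero]
  have hlim : Filter.Tendsto (fun n : ℕ => √(2 * (1 / ((n : ℝ) + 1)))) Filter.atTop (nhds 0) := by
    have := ((tendsto_one_div_add_atTop_nhds_zero_nat (𝕜 := ℝ)).const_mul 2).sqrt
    simpa using this
  exact squeeze_zero (fun _ => norm_nonneg _) (fun n => Real.le_sqrt_of_sq_le (hclose n)) hlim

end MeasurableArgmin

/-! ### Mirror descent and dual averaging. -/

section MirrorDescent

variable {E : Type*} [NormedAddCommGroup E] [NormedSpace ℝ E]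

/-- Difference quotients along a segment of a convex set converge to the derivative. -/
theorem HasFDerivWithinAt.tendsto_diffQuot {f : E → ℝ} {f' : E →L[ℝ] ℝ} {W : Set E} {v u : E}
    (hf : HasFDerivWithinAt f f' W v) (hW : Convex ℝ W) (hv : v ∈ W) (hu : u ∈ W) :
    Filter.Tendsto (fun n : ℕ => ((n : ℝ) + 1) *
      (f (v + (1 / ((n : ℝ) + 1)) • (u - v)) - f v)) Filter.atTop (nhds (f' (u - v))) := by
  have h := hf.lim (l := Filter.atTop) (c := fun n : ℕ => (n : ℝ) + 1)
    (d := fun n : ℕ => (1 / ((n : ℝ) + 1)) • (u - v)) (v := u - v) ?_ ?_ ?_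
  · simpa [smul_eq_mul] using h
  · have := (tendsto_one_div_add_atTop_nhds_zero_nat (𝕜 := ℝ)).smul_const (u - v)
    simpa using this
  · refine Filter.Eventually.of_forall fun n => ?_
    refine hW.add_smul_sub_mem hv hu ⟨by positivity, ?_⟩
    rw [div_le_one (by positivity)]
    linarith [(Nat.cast_nonneg n : (0 : ℝ) ≤ n)]
  · refine tendsto_const_nhds.congr fun n => ?_
    rw [smul_smul, mul_one_div_cancel (by positivity), one_smul]

/-- At a relative boundary point a subgradient need not agree with the derivative; only the
inequality in feasible directions survives, and it is all that the optimality condition of a mirror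
step requires. -/
theorem le_fderiv_of_subgradient {f : E → ℝ} {f' g : E →L[ℝ] ℝ} {W : Set E} {v u : E}
    (hf : HasFDerivWithinAt f f' W v) (hW : Convex ℝ W) (hv : v ∈ W)
    (hg : ∀ x ∈ W, f v + g (x - v) ≤ f x) (hu : u ∈ W) : g (u - v) ≤ f' (u - v) := by
  refine ge_of_tendsto' (hf.tendsto_diffQuot hW hv hu) fun n => ?_
  have hmem : v + (1 / ((n : ℝ) + 1)) • (u - v) ∈ W := by
    refine hW.add_smul_sub_mem hv hu ⟨by positivity, ?_⟩
    rw [div_le_one (by positivity)]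
    linarith [(Nat.cast_nonneg n : (0 : ℝ) ≤ n)]
  have h := hg _ hmem
  rw [add_sub_cancel_left, map_smul, smul_eq_mul] at h
  have hn : (0 : ℝ) < (n : ℝ) + 1 := by positivity
  have : g (u - v) = ((n : ℝ) + 1) * (1 / ((n : ℝ) + 1) * g (u - v)) := by field_simp
  rw [this]
  exact mul_le_mul_of_nonneg_left (by linarith) hn.le

/-- First-order lower bound for a strongly convex function. -/
theorem StrongConvexOn.add_half_sq_le {f : E → ℝ} {f' : E →L[ℝ] ℝ} {W : Set E} {v u : E}
    (hs : StrongConvexOn W 1 f) (hf : HasFDerivWithinAt f f' W v) (hv : v ∈ W) (hu : u ∈ W) :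
    f v + f' (u - v) + ‖u - v‖ ^ 2 / 2 ≤ f u := by
  have h1 := hf.tendsto_diffQuot hs.1 hv hu
  have h2 : Filter.Tendsto (fun n : ℕ => f u - f v - (1 - 1 / ((n : ℝ) + 1)) * (‖u - v‖ ^ 2 / 2))
      Filter.atTop (nhds (f u - f v - (1 - 0) * (‖u - v‖ ^ 2 / 2))) :=
    ((tendsto_one_div_add_atTop_nhds_zero_nat.const_sub 1).mul_const _).const_sub _
  have := le_of_tendsto_of_tendsto' h1 h2 fun n => ?_
  · linarith
  have hn : (0 : ℝ) < (n : ℝ) + 1 := by positivity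
  have hle : 1 / ((n : ℝ) + 1) ≤ 1 := by
    rw [div_le_one hn]; linarith [(Nat.cast_nonneg n : (0 : ℝ) ≤ n)]
  have h := hs.2 hu hv (show 0 ≤ 1 / ((n : ℝ) + 1) by positivity)
    (show 0 ≤ 1 - 1 / ((n : ℝ) + 1) by linarith) (by ring)
  have e : (1 / ((n : ℝ) + 1)) • u + (1 - 1 / ((n : ℝ) + 1)) • v
      = v + (1 / ((n : ℝ) + 1)) • (u - v) := by module
  rw [e] at h
  simp only [smul_eq_mul] at h
  have h3 : f (v + (1 / ((n : ℝ) + 1)) • (u - v)) - f v ≤ 1 / ((n : ℝ) + 1) *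
      (f u - f v - (1 - 1 / ((n : ℝ) + 1)) * (‖u - v‖ ^ 2 / 2)) := by
    linear_combination h
  calc ((n : ℝ) + 1) * (f (v + (1 / ((n : ℝ) + 1)) • (u - v)) - f v)
      ≤ ((n : ℝ) + 1) * (1 / ((n : ℝ) + 1) *
      (f u - f v - (1 - 1 / ((n : ℝ) + 1)) * (‖u - v‖ ^ 2 / 2))) :=
        mul_le_mul_of_nonneg_left h3 hn.le
    _ = _ := by rw [← mul_assoc, mul_one_div_cancel hn.ne', one_mul]

/-- Quadratic growth of a strongly convex function around its minimizer. -/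
theorem StrongConvexOn.add_half_sq_le_of_isArgmin {f : E → ℝ} {W : Set E} {x u : E}
    (hs : StrongConvexOn W 1 f) (hx : IsArgmin f W x) (hu : u ∈ W) :
    f x + ‖u - x‖ ^ 2 / 2 ≤ f u := by
  have h2 : Filter.Tendsto (fun n : ℕ => f u - f x - (1 - 1 / ((n : ℝ) + 1)) * (‖u - x‖ ^ 2 / 2))
      Filter.atTop (nhds (f u - f x - (1 - 0) * (‖u - x‖ ^ 2 / 2))) :=
    ((tendsto_one_div_add_atTop_nhds_zero_nat.const_sub 1).mul_const _).const_sub _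
  have := ge_of_tendsto' (b := 0) h2 fun n => ?_
  · linarith
  have hn : (0 : ℝ) < (n : ℝ) + 1 := by positivity
  have hle : 1 / ((n : ℝ) + 1) ≤ 1 := by
    rw [div_le_one hn]; linarith [(Nat.cast_nonneg n : (0 : ℝ) ≤ n)]
  have h := hs.2 hu hx.1 (show 0 ≤ 1 / ((n : ℝ) + 1) by positivity)
    (show 0 ≤ 1 - 1 / ((n : ℝ) + 1) by linarith) (by ring)
  have hm := hx.2 _ (hs.1 hu hx.1 (show 0 ≤ 1 / ((n : ℝ) + 1) by positivity)
    (show 0 ≤ 1 - 1 / ((n : ℝ) + 1) by linarith) (by ring))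
  simp only [smul_eq_mul] at h
  have h3 : 0 ≤ 1 / ((n : ℝ) + 1) *
      (f u - f x - (1 - 1 / ((n : ℝ) + 1)) * (‖u - x‖ ^ 2 / 2)) := by
    linear_combination h + hm
  exact nonneg_of_mul_nonneg_right h3 (by positivity)

theorem StrongConvexOn.affine_add {f h : E → ℝ} {W : Set E} (hs : StrongConvexOn W 1 f)
    (g : E →L[ℝ] ℝ) (c : ℝ) (he : ∀ x, h x = g x + c + f x) : StrongConvexOn W 1 h := by
  refine ⟨hs.1, fun x hx y hy a b ha hb hab => ?_⟩
  have := hs.2 hx hy ha hb hab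
  simp only [smul_eq_mul, he, map_add, map_smul] at this ⊢
  have hb' : b = 1 - a := by linarith
  subst hb'
  linear_combination this

variable {ν : E → ℝ} {W : Set E}

theorem IsDistanceGenerating.half_sq_le_bregman (hν : IsDistanceGenerating ν W) {u v : E}
    (hv : v ∈ W) (hd : DifferentiableWithinAt ℝ ν W v) (hu : u ∈ W) :
    ‖u - v‖ ^ 2 / 2 ≤ bregman ν W u v := by
  have := hν.strongConvexOn.add_half_sq_le hd.hasFDerivWithinAt hv hu
  unfold bregman
  linarith

theorem IsDistanceGenerating.bregman_nonneg (hν : IsDistanceGenerating ν W) {u v : E}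
    (hv : v ∈ W) (hd : DifferentiableWithinAt ℝ ν W v) (hu : u ∈ W) : 0 ≤ bregman ν W u v :=
  le_trans (by positivity) (hν.half_sq_le_bregman hv hd hu)

theorem IsDistanceGenerating.strongConvexOn_bregman (hν : IsDistanceGenerating ν W) (v : E) :
    StrongConvexOn W 1 (fun x => bregman ν W x v) :=
  hν.strongConvexOn.affine_add (-fderivWithin ℝ ν W v) (fderivWithin ℝ ν W v v - ν v) fun x => by
    simp only [bregman, map_sub, neg_apply]; ring

theorem IsDistanceGenerating.continuousOn_bregman (hν : IsDistanceGenerating ν W) (v : E) :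
    ContinuousOn (fun x => bregman ν W x v) W :=
  hν.continuousOn.sub (by fun_prop)

theorem IsDistanceGenerating.differentiableWithinAt_of_isArgmin (hν : IsDistanceGenerating ν W)
    {o : E} (ho : IsArgmin ν W o) : DifferentiableWithinAt ℝ ν W o :=
  hν.differentiableWithinAt o ho.1 ⟨0, fun u hu => by simpa using ho.2 u hu⟩

/-- Minimality of the mirror step exhibits a subgradient of `ν` at the new point. By the definition
of a distance-generating function, `ν` is then differentiable there, so the next Bregman distance
makes sense. -/
theorem IsMirrorStep.subgradient {η : ℝ} {g : E →L[ℝ] ℝ} {x₀ x' : E}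
    (h : IsMirrorStep ν W η (fun v => g v) x₀ x') :
    ∀ u ∈ W, ν x' + (fderivWithin ℝ ν W x₀ - η • g) (u - x') ≤ ν u := by
  intro u hu
  have := h.2 u hu
  simp only [bregman, map_sub, sub_apply, smul_apply,
    smul_eq_mul] at this ⊢
  linarith

theorem IsDistanceGenerating.differentiableWithinAt_of_isMirrorStep
    (hν : IsDistanceGenerating ν W) {η : ℝ} {g : E →L[ℝ] ℝ} {x₀ x' : E}
    (h : IsMirrorStep ν W η (fun v => g v) x₀ x') : DifferentiableWithinAt ℝ ν W x' :=
  hν.differentiableWithinAt x' h.1 ⟨_, h.subgradient⟩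

/-- One step of mirror descent. -/
theorem IsDistanceGenerating.mirrorStep_le (hν : IsDistanceGenerating ν W) {η : ℝ}
    {g : E →L[ℝ] ℝ} {x₀ x' x : E} (hx₀ : x₀ ∈ W) (hd : DifferentiableWithinAt ℝ ν W x₀)
    (h : IsMirrorStep ν W η (fun v => g v) x₀ x') (hx : x ∈ W) :
    η * g (x₀ - x) ≤ bregman ν W x x₀ - bregman ν W x x' + η ^ 2 * ‖g‖ ^ 2 / 2 := by
  have hd' := hν.differentiableWithinAt_of_isMirrorStep h
  have hopt := le_fderiv_of_subgradient hd'.hasFDerivWithinAt hν.strongConvexOn.1 h.1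
    h.subgradient hx
  have hB := hν.half_sq_le_bregman hx₀ hd h.1
  have hdual : η * g (x₀ - x') ≤ |η| * ‖g‖ * ‖x' - x₀‖ := by
    calc η * g (x₀ - x') ≤ |η * g (x₀ - x')| := le_abs_self _
      _ = |η| * ‖g (x₀ - x')‖ := by rw [abs_mul, Real.norm_eq_abs]
      _ ≤ |η| * (‖g‖ * ‖x₀ - x'‖) := by gcongr; exact g.le_opNorm _
      _ = _ := by rw [norm_sub_rev, mul_assoc]
  have hsq : η ^ 2 * ‖g‖ ^ 2 = (|η| * ‖g‖) ^ 2 := by rw [mul_pow, sq_abs]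
  simp only [bregman, map_sub, sub_apply, smul_apply,
    smul_eq_mul] at hopt hB hdual ⊢
  -- Young's inequality: the movement term from `hdual` is absorbed by the strong-convexity term in
  -- `hB`.
  nlinarith [sq_nonneg (|η| * ‖g‖ - ‖x' - x₀‖)]

/-- The regret of mirror descent with variable step sizes. -/
theorem IsDistanceGenerating.mirrorDescent_regret (hν : IsDistanceGenerating ν W) {η : ℕ → ℝ}
    {g : ℕ → E →L[ℝ] ℝ} {x : ℕ → E} (h1 : IsArgmin ν W (x 1))
    (hstep : ∀ t, 1 ≤ t → IsMirrorStep ν W (η t) (fun v => g t v) (x t) (x (t + 1)))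
    {v : E} (hv : v ∈ W) (t : ℕ) :
    ∑ j ∈ Finset.Icc 1 t, η j * g j (x j - v)
      ≤ bregman ν W v (x 1) + ∑ j ∈ Finset.Icc 1 t, η j ^ 2 * ‖g j‖ ^ 2 / 2 := by
  have hx : ∀ t, 1 ≤ t → x t ∈ W ∧ DifferentiableWithinAt ℝ ν W (x t) := by
    intro t ht
    induction t, ht using Nat.le_induction with
    | base => exact ⟨h1.1, hν.differentiableWithinAt_of_isArgmin h1⟩
    | succ n hn ih =>
      exact ⟨(hstep n hn).1, hν.differentiableWithinAt_of_isMirrorStep (hstep n hn)⟩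
  -- The Bregman distances telescope; the last one is kept for the induction and dropped at the end
  -- by nonnegativity.
  have key : ∀ t, ∑ j ∈ Finset.Icc 1 t, η j * g j (x j - v)
      ≤ bregman ν W v (x 1) - bregman ν W v (x (t + 1))
        + ∑ j ∈ Finset.Icc 1 t, η j ^ 2 * ‖g j‖ ^ 2 / 2 := by
    intro t
    induction t with
    | zero => simp
    | succ n ih =>
      rw [Finset.sum_Icc_succ_top (by omega), Finset.sum_Icc_succ_top (by omega)]
      have := hν.mirrorStep_le (hx (n + 1) (by omega)).1 (hx (n + 1) (by omega)).2
        (hstep (n + 1) (by omega)) hv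
      linarith
  have := key t
  have := hν.bregman_nonneg (hx (t + 1) (by omega)).1 (hx (t + 1) (by omega)).2 hv
  linarith

theorem isMirrorDescent_mem {η : ℕ → ℝ} {g : ℕ → E → ℝ} {x : ℕ → E} (h1 : IsArgmin ν W (x 1))
    (hstep : ∀ t, 1 ≤ t → IsMirrorStep ν W (η t) (g t) (x t) (x (t + 1))) {t : ℕ} (ht : 1 ≤ t) :
    x t ∈ W := by
  obtain rfl | ⟨s, hs, rfl⟩ : t = 1 ∨ ∃ s, 1 ≤ s ∧ t = s + 1 := by
    rcases Nat.lt_or_ge 1 t with h | h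
    · exact Or.inr ⟨t - 1, by omega, by omega⟩
    · exact Or.inl (by omega)
  · exact h1.1
  · exact (hstep s hs).1

/-! ### Dual averaging -/

open Classical in
/-- A minimizer over `W` of `A + f`, if there is one. -/
noncomputable def dualArgmin (f : E → ℝ) (W : Set E) (A : E →L[ℝ] ℝ) : E :=
  if h : ∃ x, IsArgmin (fun x => A x + f x) W x then h.choose else 0

theorem isArgmin_dualArgmin {f : E → ℝ} (hW : IsCompact W) (hne : W.Nonempty)
    (hf : ContinuousOn f W) (A : E →L[ℝ] ℝ) :
    IsArgmin (fun x => A x + f x) W (dualArgmin f W A) := by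
  have hc : ContinuousOn (fun x => A x + f x) W := A.continuous.continuousOn.add hf
  obtain ⟨x, hx, hmin⟩ := hW.exists_isMinOn hne hc
  have h : ∃ x, IsArgmin (fun x => A x + f x) W x := ⟨x, hx, fun y hy => hmin hy⟩
  rw [dualArgmin, dif_pos h]
  exact h.choose_spec

theorem dualArgmin_growth {f : E → ℝ} (hs : StrongConvexOn W 1 f) (hW : IsCompact W)
    (hne : W.Nonempty) (hf : ContinuousOn f W) (A : E →L[ℝ] ℝ) {u : E} (hu : u ∈ W) :
    A (dualArgmin f W A) + f (dualArgmin f W A) + ‖u - dualArgmin f W A‖ ^ 2 / 2 ≤ A u + f u :=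
  (hs.affine_add A 0 fun x => by rw [add_zero]).add_half_sq_le_of_isArgmin
    (isArgmin_dualArgmin hW hne hf A) hu

/-- Adding the growth inequalities at the two minimizers bounds their squared distance by `(A - B)(y
- x)`, hence the map is 1-Lipschitz in the dual norm. This makes the ghost iterates measurable
functions of the accumulated noise. -/
theorem continuous_dualArgmin {f : E → ℝ} (hs : StrongConvexOn W 1 f) (hW : IsCompact W)
    (hne : W.Nonempty) (hf : ContinuousOn f W) : Continuous (dualArgmin f W) := by
  refine LipschitzWith.continuous (K := 1) (LipschitzWith.of_dist_le_mul fun A B => ?_)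
  have hA := isArgmin_dualArgmin hW hne hf A
  have hB := isArgmin_dualArgmin hW hne hf B
  have h1 := dualArgmin_growth hs hW hne hf A hB.1
  have h2 := dualArgmin_growth hs hW hne hf B hA.1
  set x := dualArgmin f W A
  set y := dualArgmin f W B
  have h3 : (A - B) (y - x) ≤ ‖A - B‖ * ‖y - x‖ :=
    (le_abs_self _).trans ((A - B).le_opNorm _)
  rw [NNReal.coe_one, one_mul, dist_eq_norm, dist_eq_norm]
  simp only [map_sub, sub_apply] at h3
  rw [norm_sub_rev x y] at h2 ⊢
  rcases (norm_nonneg (y - x)).eq_or_lt with h0 | h0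
  · rw [← h0]; exact norm_nonneg _
  · nlinarith

/-- The regret of dual averaging. -/
theorem dualAveraging_regret {f : E → ℝ} (hs : StrongConvexOn W 1 f) (hW : IsCompact W)
    (hne : W.Nonempty) (hf : ContinuousOn f W) (hf0 : ∀ x ∈ W, 0 ≤ f x)
    (a : ℕ → E →L[ℝ] ℝ) {v : E} (hv : v ∈ W) (t : ℕ) :
    ∑ j ∈ Finset.Icc 1 t, a j (dualArgmin f W (∑ s ∈ Finset.Ico 1 j, a s) - v)
      ≤ f v + ∑ j ∈ Finset.Icc 1 t, ‖a j‖ ^ 2 / 2 := by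
  set y : ℕ → E := fun j => dualArgmin f W (∑ s ∈ Finset.Ico 1 j, a s) with hy
  have hmem : ∀ j, y j ∈ W := fun j => (isArgmin_dualArgmin hW hne hf _).1
  -- The regularized minimum serves as potential. Nonnegativity of `f` starts the induction, and
  -- growth around the old minimizer pays, via Young, for moving to the new one.
  have key : ∀ t, ∑ j ∈ Finset.Icc 1 t, a j (y j) ≤
      (∑ s ∈ Finset.Ico 1 (t + 1), a s) (y (t + 1)) + f (y (t + 1))
        + ∑ j ∈ Finset.Icc 1 t, ‖a j‖ ^ 2 / 2 := by
    intro t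
    induction t with
    | zero => simpa using hf0 _ (hmem 1)
    | succ n ih =>
      rw [Finset.sum_Icc_succ_top (by omega), Finset.sum_Icc_succ_top (by omega),
        Finset.sum_Ico_succ_top (by omega)]
      have h := dualArgmin_growth hs hW hne hf (∑ s ∈ Finset.Ico 1 (n + 1), a s)
        (hmem (n + 1 + 1))
      change (∑ s ∈ Finset.Ico 1 (n + 1), a s) (y (n + 1)) + f (y (n + 1))
        + ‖y (n + 1 + 1) - y (n + 1)‖ ^ 2 / 2 ≤ _ at h
      have h3 : (a (n + 1)) (y (n + 1) - y (n + 1 + 1))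
          ≤ ‖a (n + 1)‖ * ‖y (n + 1 + 1) - y (n + 1)‖ := by
        rw [norm_sub_rev]
        exact (le_abs_self _).trans ((a (n + 1)).le_opNorm _)
      simp only [map_sub, add_apply] at h3 ⊢
      nlinarith [sq_nonneg (‖a (n + 1)‖ - ‖y (n + 1 + 1) - y (n + 1)‖)]
  have h1 := key t
  have h2 := (isArgmin_dualArgmin hW hne hf (∑ s ∈ Finset.Ico 1 (t + 1), a s)).2 v hv
  change (∑ s ∈ Finset.Ico 1 (t + 1), a s) (y (t + 1)) + f (y (t + 1)) ≤
    (∑ s ∈ Finset.Ico 1 (t + 1), a s) v + f v at h2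
  have h3 : (∑ s ∈ Finset.Ico 1 (t + 1), a s) v = ∑ j ∈ Finset.Icc 1 t, a j v := by
    rw [sum_apply]; rfl
  simp only [map_sub, Finset.sum_sub_distrib]
  linarith

variable {Ω : Type*} {mΩ : MeasurableSpace Ω} [MeasurableSpace E] [BorelSpace E]

/-- The mirror step depends measurably on the data. -/
theorem IsDistanceGenerating.measurable_mirrorStep [SecondCountableTopology E]
    (hν : IsDistanceGenerating ν W) {η : ℝ} {g : Ω → E →L[ℝ] ℝ} {x₀ x' : Ω → E}
    (hg : Measurable g) (hx₀ : Measurable x₀) (hmem : ∀ ω, x₀ ω ∈ W)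
    (hd : ∀ ω, DifferentiableWithinAt ℝ ν W (x₀ ω))
    (hstep : ∀ ω, IsMirrorStep ν W η (fun v => g ω v) (x₀ ω) (x' ω)) : Measurable x' := by
  have hW := hν.strongConvexOn.1
  refine measurable_of_isArgmin hstep (fun ω u hu => ?_) (fun ω => ?_) fun u hu => ?_
  · refine StrongConvexOn.add_half_sq_le_of_isArgmin
      (f := fun x => η * g ω (x - x₀ ω) + bregman ν W x (x₀ ω)) ?_ (hstep ω) hu
    refine (hν.strongConvexOn_bregman (x₀ ω)).affine_add (η • g ω) (-(η * g ω (x₀ ω))) fun x => ?_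
    simp only [map_sub, smul_apply, smul_eq_mul]; ring
  · exact ContinuousOn.add (by fun_prop) (hν.continuousOn_bregman _)
  · have hsub : Measurable fun ω => u - x₀ ω := measurable_const.sub hx₀
    -- No measurability of `fderivWithin` is available: its value in a feasible direction is a
    -- pointwise limit of difference quotients, whose points stay in `W`, where `ν` is continuous.
    have hdν : Measurable fun ω => fderivWithin ℝ ν W (x₀ ω) (u - x₀ ω) := by
      refine measurable_of_tendsto_metrizable
        (f := fun (n : ℕ) ω => ((n : ℝ) + 1) *
          (ν (x₀ ω + (1 / ((n : ℝ) + 1)) • (u - x₀ ω)) - ν (x₀ ω))) (fun n => ?_)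
        (tendsto_pi_nhds.2 fun ω => (hd ω).hasFDerivWithinAt.tendsto_diffQuot hW (hmem ω) hu)
      refine ((hν.continuousOn.measurable_comp_of_mem (hx₀.add (hsub.const_smul _))
        fun ω => hW.add_smul_sub_mem (hmem ω) hu ⟨by positivity, ?_⟩).sub
        (hν.continuousOn.measurable_comp_of_mem hx₀ hmem)).const_mul _
      rw [div_le_one (by positivity)]
      linarith [(Nat.cast_nonneg n : (0 : ℝ) ≤ n)]
    have hgm : Measurable fun ω => g ω (u - x₀ ω) :=
      isBoundedBilinearMap_apply.continuous.measurable2 hg hsub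
    exact (hgm.const_mul η).add (measurable_const.sub
      ((hν.continuousOn.measurable_comp_of_mem hx₀ hmem).add hdν))

end MirrorDescent

/-! ### Entropy and exponential weights on the simplex. -/

section Softmax

variable {m : ℕ}

/-- The probability vector proportional to `exp (A i)`. -/
noncomputable def softmax (A : Fin m → ℝ) : Fin m → ℝ :=
  fun i => Real.exp (A i) / ∑ k, Real.exp (A k)

theorem sum_exp_pos [NeZero m] (A : Fin m → ℝ) : 0 < ∑ k, Real.exp (A k) :=
  Finset.sum_pos (fun _ _ => Real.exp_pos _) Finset.univ_nonempty

theorem softmax_pos [NeZero m] (A : Fin m → ℝ) (i : Fin m) : 0 < softmax A i :=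
  div_pos (Real.exp_pos _) (sum_exp_pos A)

theorem sum_softmax [NeZero m] (A : Fin m → ℝ) : ∑ i, softmax A i = 1 := by
  simp only [softmax]
  rw [← Finset.sum_div, div_self (sum_exp_pos A).ne']

theorem softmax_mem [NeZero m] (A : Fin m → ℝ) : softmax A ∈ stdSimplex ℝ (Fin m) :=
  ⟨fun i => (softmax_pos A i).le, sum_softmax A⟩

theorem continuous_softmax [NeZero m] : Continuous (softmax : (Fin m → ℝ) → Fin m → ℝ) := by
  refine continuous_pi fun i => Continuous.div (by fun_prop) (by fun_prop) fun A => ?_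
  exact (sum_exp_pos A).ne'

theorem log_softmax [NeZero m] (A : Fin m → ℝ) (i : Fin m) :
    Real.log (softmax A i) = A i - Real.log (∑ k, Real.exp (A k)) := by
  rw [softmax, Real.log_div (Real.exp_pos _).ne' (sum_exp_pos A).ne', Real.log_exp]

theorem hasFDerivAt_entropy {q : Fin m → ℝ} (hq : ∀ i, 0 < q i) :
    HasFDerivAt entropy
      (∑ i, (Real.log (q i) + 1) • (ContinuousLinearMap.proj (R := ℝ) (φ := fun _ => ℝ) i)) q := by
  unfold entropy
  refine HasFDerivAt.fun_sum fun i _ => ?_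
  exact (Real.hasDerivAt_mul_log (hq i).ne').comp_hasFDerivAt q
    (ContinuousLinearMap.proj (R := ℝ) (φ := fun _ => ℝ) i).hasFDerivAt

/-- The simplex has empty interior, so the derivative within it is not unique as a linear map. Its
values on differences of points of the simplex are pinned down by difference quotients, and these
are computed with the full derivative at a positive `q`. -/
theorem fderivWithin_entropy {q p : Fin m → ℝ} (hq : ∀ i, 0 < q i)
    (hqm : q ∈ stdSimplex ℝ (Fin m)) (hp : p ∈ stdSimplex ℝ (Fin m)) :
    fderivWithin ℝ entropy (stdSimplex ℝ (Fin m)) q (p - q)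
      = ∑ i, (Real.log (q i) + 1) * (p i - q i) := by
  have h := (hasFDerivAt_entropy hq).hasFDerivWithinAt (s := stdSimplex ℝ (Fin m))
  have h1 := h.tendsto_diffQuot (convex_stdSimplex ℝ _) hqm hp
  have h2 := h.differentiableWithinAt.hasFDerivWithinAt.tendsto_diffQuot
    (convex_stdSimplex ℝ _) hqm hp
  rw [tendsto_nhds_unique h2 h1]
  simp [sum_apply]

/-- The scalar form of Gibbs' inequality with its equality case; `q = 0` is allowed because the
convention `log 0 = 0` makes the right side vanish. -/
theorem mul_log_sub_log_ge {q p : ℝ} (hq : 0 ≤ q) (hp : 0 < p) :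
    q - p ≤ q * (Real.log q - Real.log p) ∧
      (q ≠ p → q - p < q * (Real.log q - Real.log p)) := by
  rcases hq.eq_or_lt with rfl | hq
  · constructor
    · simpa using hp.le
    · intro _; simpa using hp
  · have e : Real.log q - Real.log p = -Real.log (p / q) := by
      rw [Real.log_div hp.ne' hq.ne']; ring
    have e2 : q - p = q * (-(p / q - 1)) := by field_simp; ring
    rw [e, e2]
    refine ⟨?_, fun hne => ?_⟩
    · exact mul_le_mul_of_nonneg_left
        (neg_le_neg (Real.log_le_sub_one_of_pos (by positivity))) hq.le
    · refine mul_lt_mul_of_pos_left (neg_lt_neg (Real.log_lt_sub_one_of_pos (by positivity) ?_)) hq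
      rw [Ne, div_eq_one_iff_eq hq.ne']
      exact hne.symm

/-- The mirror step with the entropy is a multiplicative update. -/
theorem eq_softmax_of_isMirrorStep [NeZero m] {η : ℝ} {g A q' : Fin m → ℝ}
    (h : IsMirrorStep entropy (stdSimplex ℝ (Fin m)) η (fun v => ∑ i, -g i * v i)
      (softmax A) q') : q' = softmax (fun i => A i + η * g i) := by
  set p := softmax (fun i => A i + η * g i) with hp
  set q := softmax A with hq
  have hpm : p ∈ stdSimplex ℝ (Fin m) := softmax_mem _
  have hqm : q ∈ stdSimplex ℝ (Fin m) := softmax_mem _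
  obtain ⟨c, hc⟩ : ∃ c : ℝ, ∀ i, η * g i + Real.log (q i) = Real.log (p i) + c :=
    ⟨Real.log (∑ k, Real.exp (A k + η * g k)) - Real.log (∑ k, Real.exp (A k)), fun i => by
      rw [hq, hp, log_softmax, log_softmax]; ring⟩
  -- With `c` the logarithm of the ratio of the two normalizers, the objective is the relative
  -- entropy of `x` with respect to the multiplicative update `p`, plus a constant independent of
  -- `x`.
  have hJ : ∀ x ∈ stdSimplex ℝ (Fin m),
      η * (∑ i, -g i * (x - q) i) + bregman entropy (stdSimplex ℝ (Fin m)) x q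
        = ∑ i, x i * (Real.log (x i) - Real.log (p i))
          + (∑ i, (η * g i * q i + Real.log (q i) * q i) - entropy q - c) := by
    intro x hx
    rw [bregman, fderivWithin_entropy (fun i => softmax_pos A i) hqm hx]
    have e1 : ∑ i, (x i - q i) = 0 := by
      rw [Finset.sum_sub_distrib, hx.2, hqm.2, sub_self]
    have e2 : (∑ i, x i * c) = c := by rw [← Finset.sum_mul, hx.2, one_mul]
    have e3 : ∑ i, (Real.log (q i) + 1) * (x i - q i)
        = ∑ i, Real.log (q i) * (x i - q i) := by
      simp only [add_mul, one_mul, Finset.sum_add_distrib, e1, add_zero]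
    rw [e3]
    have e4 : ∑ i, x i * (Real.log (x i) - Real.log (p i)) - c
        = ∑ i, (x i * Real.log (x i) - x i * (η * g i + Real.log (q i))) := by
      rw [← e2, ← Finset.sum_sub_distrib]
      refine Finset.sum_congr rfl fun i _ => ?_
      rw [hc i]; ring
    have e5 : entropy x = ∑ i, x i * Real.log (x i) := rfl
    have : η * (∑ i, -g i * (x - q) i) + (entropy x - ∑ i, Real.log (q i) * (x i - q i))
        = ∑ i, (x i * Real.log (x i) - x i * (η * g i + Real.log (q i)))
          + ∑ i, (η * g i * q i + Real.log (q i) * q i) := by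
      rw [e5, Finset.mul_sum, ← Finset.sum_sub_distrib, ← Finset.sum_add_distrib,
        ← Finset.sum_add_distrib]
      refine Finset.sum_congr rfl fun i _ => ?_
      rw [Pi.sub_apply]; ring
    linarith
  by_contra hne
  have hmin := h.2 p hpm
  simp only [hJ _ h.1, hJ _ hpm] at hmin
  simp only [sub_self, mul_zero, Finset.sum_const_zero] at hmin
  -- Strict Gibbs in one coordinate makes the relative entropy of `q'` positive, contradicting
  -- minimality against `p`.
  have hlt : ∑ i, (q' i - p i) < ∑ i, q' i * (Real.log (q' i) - Real.log (p i)) := by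
    obtain ⟨i, hi⟩ := Function.ne_iff.1 hne
    exact Finset.sum_lt_sum (fun i _ => (mul_log_sub_log_ge (h.1.1 i) (softmax_pos _ i)).1)
      ⟨i, Finset.mem_univ _, (mul_log_sub_log_ge (h.1.1 i) (softmax_pos _ i)).2 hi⟩
  rw [Finset.sum_sub_distrib, h.1.2, hpm.2] at hlt
  linarith

/-- Hoeffding's lemma for a probability vector. -/
theorem sum_mul_exp_le {p a : Fin m → ℝ} (hp : p ∈ stdSimplex ℝ (Fin m)) {c : ℝ} (hc : 0 ≤ c)
    (ha : ∀ i, |a i| ≤ c) :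
    ∑ i, p i * Real.exp (a i) ≤ Real.exp (∑ i, p i * a i + c ^ 2 / 2) := by
  let P : PMF (Fin m) := PMF.ofFintype (fun i => ENNReal.ofReal (p i)) (by
    rw [← ENNReal.ofReal_sum_of_nonneg fun i _ => hp.1 i, hp.2, ENNReal.ofReal_one])
  have hint : ∀ f : Fin m → ℝ, ∫ i, f i ∂P.toMeasure = ∑ i, p i * f i := by
    intro f
    rw [PMF.integral_eq_sum]
    refine Finset.sum_congr rfl fun i _ => ?_
    simp [P, ENNReal.toReal_ofReal (hp.1 i)]
  have h := hasSubgaussianMGF_of_mem_Icc (μ := P.toMeasure) (X := a) (a := -c) (b := c)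
    (measurable_of_countable _).aemeasurable
    (Filter.Eventually.of_forall fun i => abs_le.1 (ha i))
  -- An interval of length `2 * c` has variance proxy `c ^ 2`; the generating function of the
  -- centered variable is needed only at `1`.
  have h1 := h.mgf_le 1
  rw [mgf, hint, hint] at h1
  simp only [one_mul, one_pow, mul_one] at h1
  have e : ((((‖c - -c‖₊ / 2) ^ 2 : NNReal) : ℝ)) = c ^ 2 := by
    push_cast
    rw [Real.norm_eq_abs, sub_neg_eq_add, abs_of_nonneg (by linarith)]
    ring
  rw [e] at h1
  have e2 : ∑ i, p i * Real.exp (a i)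
      = Real.exp (∑ i, p i * a i) * ∑ i, p i * Real.exp (a i - ∑ i, p i * a i) := by
    rw [Finset.mul_sum]
    refine Finset.sum_congr rfl fun i _ => ?_
    rw [Real.exp_sub]
    field_simp
  rw [e2, Real.exp_add]
  exact mul_le_mul_of_nonneg_left h1 (Real.exp_pos _).le

/-- The regret of multiplicative weights. -/
theorem softmax_regret [NeZero m] {a : ℕ → Fin m → ℝ} {c : ℕ → ℝ} {t : ℕ}
    (hc : ∀ j, 1 ≤ j → j ≤ t → 0 ≤ c j)
    (ha : ∀ j, 1 ≤ j → j ≤ t → ∀ i, |a j i| ≤ c j) {q : Fin m → ℝ}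
    (hq : q ∈ stdSimplex ℝ (Fin m)) :
    ∑ j ∈ Finset.Icc 1 t, ∑ i, (q i - softmax (∑ s ∈ Finset.Ico 1 j, a s) i) * a j i
      ≤ Real.log m + ∑ j ∈ Finset.Icc 1 t, c j ^ 2 / 2 := by
  set y : ℕ → Fin m → ℝ := fun j => softmax (∑ s ∈ Finset.Ico 1 j, a s) with hy
  -- The potential is the log-partition function: it starts at `log m`, grows in each round by at
  -- most the mean gain plus Hoeffding's `c ^ 2 / 2`, and dominates the total gain of every fixed
  -- `q`.
  set Φ : ℕ → ℝ := fun j => Real.log (∑ k, Real.exp ((∑ s ∈ Finset.Ico 1 j, a s) k)) with hΦ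
  have key : ∀ n ≤ t, Φ (n + 1) ≤ Real.log m + ∑ j ∈ Finset.Icc 1 n, ∑ i, y j i * a j i
      + ∑ j ∈ Finset.Icc 1 n, c j ^ 2 / 2 := by
    intro n
    induction n with
    | zero => intro _; simp [hΦ]
    | succ n ih =>
      intro hn
      have ih := ih (by omega)
      rw [Finset.sum_Icc_succ_top (by omega), Finset.sum_Icc_succ_top (by omega)]
      have h := sum_mul_exp_le (softmax_mem (∑ s ∈ Finset.Ico 1 (n + 1), a s))
        (hc (n + 1) (by omega) hn) (ha (n + 1) (by omega) hn)
      have e : Φ (n + 1 + 1) - Φ (n + 1) = Real.log (∑ i, y (n + 1) i * Real.exp (a (n + 1) i)) := by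
        simp only [hΦ, hy, softmax]
        rw [← Real.log_div (sum_exp_pos _).ne' (sum_exp_pos _).ne', Finset.sum_div]
        congr 1
        refine Finset.sum_congr rfl fun i _ => ?_
        rw [Finset.sum_Ico_succ_top (by omega), Pi.add_apply, Real.exp_add]
        ring
      have h2 : Φ (n + 1 + 1) - Φ (n + 1) ≤ ∑ i, y (n + 1) i * a (n + 1) i + c (n + 1) ^ 2 / 2 := by
        rw [e, ← Real.log_exp (∑ i, y (n + 1) i * a (n + 1) i + c (n + 1) ^ 2 / 2)]
        exact Real.log_le_log (Finset.sum_pos (fun i _ =>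
          mul_pos (softmax_pos _ i) (Real.exp_pos _)) Finset.univ_nonempty) h
      linarith
  have hlow : ∑ i, q i * (∑ s ∈ Finset.Ico 1 (t + 1), a s) i ≤ Φ (t + 1) := by
    have : ∀ i, (∑ s ∈ Finset.Ico 1 (t + 1), a s) i ≤ Φ (t + 1) := fun i => by
      rw [hΦ, ← Real.log_exp ((∑ s ∈ Finset.Ico 1 (t + 1), a s) i)]
      exact Real.log_le_log (Real.exp_pos _) (Finset.single_le_sum
        (f := fun k => Real.exp ((∑ s ∈ Finset.Ico 1 (t + 1), a s) k))
        (fun _ _ => (Real.exp_pos _).le) (Finset.mem_univ i))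
    calc _ ≤ ∑ i, q i * Φ (t + 1) :=
          Finset.sum_le_sum fun i _ => mul_le_mul_of_nonneg_left (this i) (hq.1 i)
      _ = _ := by rw [← Finset.sum_mul, hq.2, one_mul]
  have e : ∑ i, q i * (∑ s ∈ Finset.Ico 1 (t + 1), a s) i
      = ∑ j ∈ Finset.Icc 1 t, ∑ i, q i * a j i := by
    rw [Finset.sum_comm]
    refine Finset.sum_congr rfl fun i _ => ?_
    rw [Finset.sum_apply, Finset.mul_sum]
    rfl
  simp only [sub_mul, Finset.sum_sub_distrib]
  linarith [key t le_rfl]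

theorem softmax_zero [NeZero m] (i : Fin m) : softmax (0 : Fin m → ℝ) i = 1 / m := by
  simp [softmax]

end Softmax

/-! ### Bounded martingale differences and the Azuma-Hoeffding inequality. -/

section MartingaleDifferences

variable {Ω : Type*} {mΩ : MeasurableSpace Ω} {μ : Measure Ω}

theorem integrable_of_abs_le [IsFiniteMeasure μ] {f : Ω → ℝ} (hf : Measurable f) {C : ℝ}
    (hC : ∀ᵐ ω ∂μ, |f ω| ≤ C) : Integrable f μ :=
  Integrable.of_bound hf.aestronglyMeasurable C hC

/-- Freezing lemma: for `Y` independent of `ζ`, the expectation of `h (Y, ζ)` may be computed by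
first integrating over the law of `ζ`. -/
theorem integral_freeze [IsProbabilityMeasure μ] {A B : Type*} [MeasurableSpace A] [MeasurableSpace B] {Y : Ω → A}
    {ζ : Ω → B} (hY : Measurable Y) (hζ : Measurable ζ) (hind : IndepFun Y ζ μ) {P : Measure B}
    (hP : μ.map ζ = P) {h : A → B → ℝ} (hh : Measurable (Function.uncurry h)) {C : ℝ}
    (hC : ∀ᵐ ω ∂μ, |h (Y ω) (ζ ω)| ≤ C) :
    Integrable (fun ω => ∫ b, h (Y ω) b ∂P) μ ∧
      ∫ ω, h (Y ω) (ζ ω) ∂μ = ∫ ω, ∫ b, h (Y ω) b ∂P ∂μ := by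
  subst hP
  have hYp : IsProbabilityMeasure (μ.map Y) := Measure.isProbabilityMeasure_map hY.aemeasurable
  have hζp : IsProbabilityMeasure (μ.map ζ) := Measure.isProbabilityMeasure_map hζ.aemeasurable
  have hpair : Measurable fun ω => (Y ω, ζ ω) := hY.prodMk hζ
  have hlaw := (indepFun_iff_map_prod_eq_prod_map_map hY.aemeasurable hζ.aemeasurable).1 hind
  -- The bound on `h` is only known almost surely along `(Y, ζ)`; independence identifies that law
  -- with the product law, which is where Fubini is applied.
  have hint : Integrable (Function.uncurry h) ((μ.map Y).prod (μ.map ζ)) := by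
    rw [← hlaw, integrable_map_measure hh.aestronglyMeasurable hpair.aemeasurable]
    exact integrable_of_abs_le (hh.comp hpair) hC
  have hi1 : Integrable (fun a => ∫ b, h a b ∂(μ.map ζ)) (μ.map Y) := hint.integral_prod_left
  refine ⟨(integrable_map_measure hi1.aestronglyMeasurable hY.aemeasurable).1 hi1, ?_⟩
  calc ∫ ω, h (Y ω) (ζ ω) ∂μ
      = ∫ p, Function.uncurry h p ∂(μ.map fun ω => (Y ω, ζ ω)) :=
        (integral_map hpair.aemeasurable hh.aestronglyMeasurable).symm
    _ = ∫ a, ∫ b, h a b ∂(μ.map ζ) ∂(μ.map Y) := by rw [hlaw, integral_prod _ hint]; rfl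
    _ = _ := integral_map hY.aemeasurable hi1.aestronglyMeasurable

/-- The centered variable `h (Y, ζ) - E [h (Y, ζ) | Y]` is orthogonal to the bounded functions of
the past. -/
theorem integral_mul_centered_eq_zero {Ω A B : Type*} [MeasurableSpace A] [MeasurableSpace B]
    {𝓖 mΩ : MeasurableSpace Ω} {μ : Measure Ω} [IsProbabilityMeasure μ] (h𝓖 : 𝓖 ≤ mΩ) {Y : Ω → A} {ζ : Ω → B} (hY : Measurable[𝓖] Y)
    (hζ : Measurable ζ) (hind : Indep 𝓖 (MeasurableSpace.comap ζ inferInstance) μ)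
    {P : Measure B} (hP : μ.map ζ = P) {h : A → B → ℝ} (hh : Measurable (Function.uncurry h))
    {C : ℝ} (hC : ∀ᵐ ω ∂μ, |h (Y ω) (ζ ω)| ≤ C) {Z : Ω → ℝ} (hZ : Measurable[𝓖] Z) {K : ℝ}
    (hK : ∀ᵐ ω ∂μ, |Z ω| ≤ K) :
    ∫ ω, Z ω * (h (Y ω) (ζ ω) - ∫ b, h (Y ω) b ∂P) ∂μ = 0 := by
  -- The test function is frozen together with `Y`, so that it becomes a constant factor of the
  -- inner integral.
  have hYZ : Measurable[𝓖] fun ω => (Y ω, Z ω) := hY.prodMk hZ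
  have hind' : IndepFun (fun ω => (Y ω, Z ω)) ζ μ :=
    (IndepFun_iff_Indep _ _ _).2 (indep_of_indep_of_le_left hind hYZ.comap_le)
  have hb : ∀ᵐ ω ∂μ, |Z ω * h (Y ω) (ζ ω)| ≤ K * C := by
    filter_upwards [hC, hK] with ω h1 h2
    rw [abs_mul]
    exact mul_le_mul h2 h1 (abs_nonneg _) ((abs_nonneg _).trans h2)
  have hmeas : Measurable (Function.uncurry fun (a : A × ℝ) (b : B) => a.2 * h a.1 b) :=
    (measurable_snd.comp measurable_fst).mul
      (hh.comp ((measurable_fst.comp measurable_fst).prodMk measurable_snd))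
  obtain ⟨h1, h2⟩ := integral_freeze (hYZ.mono h𝓖 le_rfl) hζ hind' hP hmeas hb
  simp only [integral_const_mul] at h1 h2
  have hi : Integrable (fun ω => Z ω * h (Y ω) (ζ ω)) μ :=
    integrable_of_abs_le ((hZ.mono h𝓖 le_rfl).mul
      (hh.comp ((hY.mono h𝓖 le_rfl).prodMk hζ))) hb
  simp only [mul_sub]
  rw [integral_sub hi h1, h2, sub_self]

/-- A sequence of bounded martingale differences `X 1, X 2, …`: `X j` is known at time `j + 1`,
orthogonal to the bounded functions of the past, and bounded by `c j`. -/
structure IsBoundedMartingaleDiff (μ : Measure Ω) (𝓕 : ℕ → MeasurableSpace Ω) (X : ℕ → Ω → ℝ)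
    (c : ℕ → ℝ) : Prop where
  mono : Monotone 𝓕
  le : ∀ j, 𝓕 j ≤ mΩ
  meas : ∀ j, 1 ≤ j → Measurable[𝓕 (j + 1)] (X j)
  pos : ∀ j, 1 ≤ j → 0 < c j
  bound : ∀ j, 1 ≤ j → ∀ᵐ ω ∂μ, |X j ω| ≤ c j
  orth : ∀ j, 1 ≤ j → ∀ Z : Ω → ℝ, Measurable[𝓕 j] Z → ∀ K : ℝ, (∀ᵐ ω ∂μ, |Z ω| ≤ K) →
    ∫ ω, Z ω * X j ω ∂μ = 0

namespace IsBoundedMartingaleDiff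

variable {𝓕 : ℕ → MeasurableSpace Ω} {X : ℕ → Ω → ℝ} {c : ℕ → ℝ}

theorem measurable_sum (h : IsBoundedMartingaleDiff μ 𝓕 X c) (t : ℕ) :
    Measurable[𝓕 (t + 1)] fun ω => ∑ j ∈ Finset.Icc 1 t, X j ω :=
  Finset.measurable_fun_sum _ fun j hj => by
    have hj := Finset.mem_Icc.1 hj
    exact (h.meas j hj.1).mono (h.mono (by omega)) le_rfl

theorem measurable_sum' (h : IsBoundedMartingaleDiff μ 𝓕 X c) (t : ℕ) :
    Measurable fun ω => ∑ j ∈ Finset.Icc 1 t, X j ω :=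
  (h.measurable_sum t).mono (h.le _) le_rfl

theorem abs_sum_le (h : IsBoundedMartingaleDiff μ 𝓕 X c) (t : ℕ) :
    ∀ᵐ ω ∂μ, |∑ j ∈ Finset.Icc 1 t, X j ω| ≤ ∑ j ∈ Finset.Icc 1 t, c j := by
  have : ∀ᵐ ω ∂μ, ∀ j, 1 ≤ j → |X j ω| ≤ c j := by
    rw [ae_all_iff]; intro j
    by_cases hj : 1 ≤ j
    · filter_upwards [h.bound j hj] with ω hω _ using hω
    · exact Filter.Eventually.of_forall fun _ h => absurd h hj
  filter_upwards [this] with ω hω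
  exact (Finset.abs_sum_le_sum_abs _ _).trans
    (Finset.sum_le_sum fun j hj => hω j (Finset.mem_Icc.1 hj).1)

theorem exp_le (h : IsBoundedMartingaleDiff μ 𝓕 X c) (r : ℝ) (t : ℕ) :
    ∀ᵐ ω ∂μ, |Real.exp (r * ∑ j ∈ Finset.Icc 1 t, X j ω)|
      ≤ Real.exp (|r| * ∑ j ∈ Finset.Icc 1 t, c j) := by
  filter_upwards [h.abs_sum_le t] with ω hω
  rw [Real.abs_exp]
  refine Real.exp_le_exp.2 ((le_abs_self _).trans ?_)
  rw [abs_mul]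
  exact mul_le_mul_of_nonneg_left hω (abs_nonneg _)

variable [IsProbabilityMeasure μ]

theorem integrable_exp (h : IsBoundedMartingaleDiff μ 𝓕 X c) (r : ℝ) (t : ℕ) :
    Integrable (fun ω => Real.exp (r * ∑ j ∈ Finset.Icc 1 t, X j ω)) μ :=
  integrable_of_abs_le ((h.measurable_sum' t).const_mul r).exp (h.exp_le r t)

theorem integrable_sum (h : IsBoundedMartingaleDiff μ 𝓕 X c) (t : ℕ) :
    Integrable (fun ω => ∑ j ∈ Finset.Icc 1 t, X j ω) μ :=
  integrable_of_abs_le (h.measurable_sum' t) (h.abs_sum_le t)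

theorem integral_sum_eq_zero (h : IsBoundedMartingaleDiff μ 𝓕 X c) (t : ℕ) :
    ∫ ω, ∑ j ∈ Finset.Icc 1 t, X j ω ∂μ = 0 := by
  rw [integral_finsetSum _ fun j hj => integrable_of_abs_le
    ((h.meas j (Finset.mem_Icc.1 hj).1).mono (h.le _) le_rfl) (h.bound j (Finset.mem_Icc.1 hj).1)]
  refine Finset.sum_eq_zero fun j hj => ?_
  have := h.orth j (Finset.mem_Icc.1 hj).1 (fun _ => 1) measurable_const 1 (by simp)
  simpa using this

theorem integral_exp_le (h : IsBoundedMartingaleDiff μ 𝓕 X c) (r : ℝ) (t : ℕ) :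
    ∫ ω, Real.exp (r * ∑ j ∈ Finset.Icc 1 t, X j ω) ∂μ
      ≤ Real.exp (r ^ 2 * (∑ j ∈ Finset.Icc 1 t, c j ^ 2) / 2) := by
  induction t with
  | zero => simp
  | succ n ih =>
    set S : Ω → ℝ := fun ω => ∑ j ∈ Finset.Icc 1 n, X j ω with hS
    have hc := h.pos (n + 1) (by omega)
    have hXm : Measurable (X (n + 1)) := (h.meas (n + 1) (by omega)).mono (h.le _) le_rfl
    have hSm : Measurable[𝓕 (n + 1)] fun ω => Real.exp (r * S ω) :=
      Real.measurable_exp.comp ((h.measurable_sum n).const_mul r)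
    have hSX : Integrable (fun ω => Real.exp (r * S ω) * X (n + 1) ω) μ := by
      refine integrable_of_abs_le ((hSm.mono (h.le _) le_rfl).mul hXm)
        (C := Real.exp (|r| * ∑ j ∈ Finset.Icc 1 n, c j) * c (n + 1)) ?_
      filter_upwards [h.exp_le r n, h.bound (n + 1) (by omega)] with ω h1 h2
      rw [abs_mul]
      exact mul_le_mul h1 h2 (abs_nonneg _) (Real.exp_pos _).le
    -- Convexity puts the exponential below its chord over `[-c, c]`; the part linear in the
    -- increment is then annihilated by orthogonality to the past, leaving a factor `cosh`.
    have hstep : ∀ᵐ ω ∂μ, Real.exp (r * ∑ j ∈ Finset.Icc 1 (n + 1), X j ω)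
        ≤ Real.cosh (r * c (n + 1)) * Real.exp (r * S ω)
          + Real.sinh (r * c (n + 1)) / c (n + 1) * (Real.exp (r * S ω) * X (n + 1) ω) := by
      filter_upwards [h.bound (n + 1) (by omega)] with ω hω
      have hle : |X (n + 1) ω / c (n + 1)| ≤ 1 := by
        rw [abs_div, abs_of_pos hc, div_le_one hc]; exact hω
      have := Real.exp_mul_le_cosh_add_mul_sinh hle (r * c (n + 1))
      rw [Finset.sum_Icc_succ_top (by omega), mul_add, Real.exp_add]
      have e : X (n + 1) ω / c (n + 1) * (r * c (n + 1)) = r * X (n + 1) ω := by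
        field_simp
      rw [e] at this
      calc Real.exp (r * S ω) * Real.exp (r * X (n + 1) ω)
          ≤ Real.exp (r * S ω) * (Real.cosh (r * c (n + 1))
            + X (n + 1) ω / c (n + 1) * Real.sinh (r * c (n + 1))) :=
            mul_le_mul_of_nonneg_left this (Real.exp_pos _).le
        _ = _ := by ring
    have horth := h.orth (n + 1) (by omega) _ hSm _ (h.exp_le r n)
    calc _ ≤ ∫ ω, (Real.cosh (r * c (n + 1)) * Real.exp (r * S ω)
          + Real.sinh (r * c (n + 1)) / c (n + 1) * (Real.exp (r * S ω) * X (n + 1) ω)) ∂μ :=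
          integral_mono_ae (h.integrable_exp r (n + 1))
            (((h.integrable_exp r n).const_mul _).add (hSX.const_mul _)) hstep
      _ = Real.cosh (r * c (n + 1)) * ∫ ω, Real.exp (r * S ω) ∂μ := by
          rw [integral_add ((h.integrable_exp r n).const_mul _) (hSX.const_mul _),
            integral_const_mul, integral_const_mul, horth, mul_zero, add_zero]
      _ ≤ Real.exp ((r * c (n + 1)) ^ 2 / 2)
          * Real.exp (r ^ 2 * (∑ j ∈ Finset.Icc 1 n, c j ^ 2) / 2) :=
          mul_le_mul (Real.cosh_le_exp_half_sq _) ih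
            (integral_nonneg fun _ => (Real.exp_pos _).le) (Real.exp_pos _).le
      _ = _ := by
          rw [← Real.exp_add, Finset.sum_Icc_succ_top (by omega)]
          congr 1; ring

theorem integral_exp_le' (h : IsBoundedMartingaleDiff μ 𝓕 X c) {t : ℕ} {V : ℝ}
    (hV : ∑ j ∈ Finset.Icc 1 t, c j ^ 2 ≤ V) (r : ℝ) :
    ∫ ω, Real.exp (r * ∑ j ∈ Finset.Icc 1 t, X j ω) ∂μ ≤ Real.exp (r ^ 2 * V / 2) :=
  (h.integral_exp_le r t).trans (Real.exp_le_exp.2 (by gcongr))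

/-- The Azuma-Hoeffding inequality. -/
theorem measure_sum_ge_le (h : IsBoundedMartingaleDiff μ 𝓕 X c) {t : ℕ} {V : ℝ}
    (hV : ∑ j ∈ Finset.Icc 1 t, c j ^ 2 ≤ V) {ε : ℝ} (hε : 0 ≤ ε) :
    μ.real {ω | ε ≤ ∑ j ∈ Finset.Icc 1 t, X j ω} ≤ Real.exp (-ε ^ 2 / (2 * V)) := by
  have hV0 : 0 ≤ V := (Finset.sum_nonneg fun j _ => sq_nonneg (c j)).trans hV
  have hs : HasSubgaussianMGF (fun ω => ∑ j ∈ Finset.Icc 1 t, X j ω) ⟨V, hV0⟩ μ :=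
    { integrable_exp_mul := fun r => h.integrable_exp r t
      mgf_le := fun r => by
        refine (h.integral_exp_le' hV r).trans (le_of_eq ?_)
        congr 1
        change r ^ 2 * V / 2 = V * r ^ 2 / 2
        ring }
  exact hs.measure_ge_le hε

end IsBoundedMartingaleDiff

end MartingaleDifferences

/-! ### Regularity and subgradients of the risks. -/

section Risk

theorem minRisk_eq_of_isArgmin {E Z : Type*} [MeasurableSpace Z] {P : Measure Z} {ℓ : E → Z → ℝ}
    {W : Set E} {v : E} (hv : IsArgmin (risk P ℓ) W v) : minRisk P ℓ W = risk P ℓ v :=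
  IsLeast.csInf_eq ⟨⟨v, hv.1, rfl⟩, by rintro _ ⟨u, hu, rfl⟩; exact hv.2 u hu⟩

/-- A uniform bound over pairs of comparators suffices: the supremum and the infimum separate, and
only nonemptiness of the two sets is needed. -/
theorem optError_le {E Z : Type*} [MeasurableSpace Z] {m : ℕ} {P : Fin m → Measure Z}
    {ℓ : E → Z → ℝ} {W : Set E} [NeZero m] (hne : W.Nonempty) {w : E} {q : Fin m → ℝ} {c : ℝ}
    (h : ∀ w' ∈ W, ∀ q' ∈ stdSimplex ℝ (Fin m), saddle P ℓ W w q' - saddle P ℓ W w' q ≤ c) :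
    optError P ℓ W w q ≤ c := by
  unfold optError
  rw [sub_le_iff_le_add]
  refine csSup_le ⟨_, softmax 0, softmax_mem 0, rfl⟩ ?_
  rintro _ ⟨q', hq', rfl⟩
  have : saddle P ℓ W w q' - c ≤ sInf ((fun w' => saddle P ℓ W w' q) '' W) := by
    refine le_csInf (hne.image _) ?_
    rintro _ ⟨w', hw', rfl⟩
    have := h w' hw' q' hq'
    change _ ≤ saddle P ℓ W w' q
    linarith
  change saddle P ℓ W w q' ≤ _
  linarith

variable {E : Type*} [NormedAddCommGroup E] [NormedSpace ℝ E] [MeasurableSpace E] {Z : Type*}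
  [MeasurableSpace Z]

/-- A differentiable loss with values in `[0, 1]` and gradients bounded by `G`, whose risk is
convex. -/
structure IsConvexRiskLoss (W : Set E) (ℓ : E → Z → ℝ) (dℓ : E → Z → (E →L[ℝ] ℝ)) (G : ℝ)
    (P : Measure Z) : Prop where
  hasFDerivWithinAt : ∀ z, ∀ w ∈ W, HasFDerivWithinAt (fun w' => ℓ w' z) (dℓ w z) W w
  measurable : Measurable (fun p : W × Z => ℓ p.1 p.2)
  measurable_grad : Measurable (fun p : W × Z => dℓ p.1 p.2)
  convexOn : ConvexOn ℝ W (risk P ℓ)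
  norm_grad_le : ∀ᵐ z ∂P, ∀ w ∈ W, ‖dℓ w z‖ ≤ G
  mem_Icc : ∀ᵐ z ∂P, ∀ w ∈ W, 0 ≤ ℓ w z ∧ ℓ w z ≤ 1

/-- The expected gradient of the loss. -/
noncomputable def gradRisk (P : Measure Z) (dℓ : E → Z → (E →L[ℝ] ℝ)) (w : E) : E →L[ℝ] ℝ :=
  ∫ z, dℓ w z ∂P

namespace IsConvexRiskLoss

variable {W : Set E} {ℓ : E → Z → ℝ} {dℓ : E → Z → (E →L[ℝ] ℝ)} {G : ℝ} {P : Measure Z}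

theorem measurable_loss (h : IsConvexRiskLoss W ℓ dℓ G P) {w : E} (hw : w ∈ W) :
    Measurable (ℓ w) :=
  h.measurable.comp
    (measurable_const.prodMk measurable_id : Measurable fun z : Z => ((⟨w, hw⟩ : W), z))

theorem measurable_grad_right (h : IsConvexRiskLoss W ℓ dℓ G P) {w : E} (hw : w ∈ W) :
    Measurable (dℓ w) :=
  h.measurable_grad.comp
    (measurable_const.prodMk measurable_id : Measurable fun z : Z => ((⟨w, hw⟩ : W), z))

theorem risk_nonneg (h : IsConvexRiskLoss W ℓ dℓ G P) {w : E} (hw : w ∈ W) : 0 ≤ risk P ℓ w :=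
  integral_nonneg_of_ae (by filter_upwards [h.mem_Icc] with z hz using (hz w hw).1)

/-- The mean value inequality on the convex set `W`, with one null set serving all pairs of points.
It makes the risk Lipschitz and dominates the difference quotients of the loss. -/
theorem abs_loss_sub_le (h : IsConvexRiskLoss W ℓ dℓ G P) :
    ∀ᵐ z ∂P, ∀ w ∈ W, ∀ u ∈ W, |ℓ u z - ℓ w z| ≤ G * ‖u - w‖ := by
  filter_upwards [h.norm_grad_le] with z hz w hw u hu
  exact h.convexOn.1.norm_image_sub_le_of_norm_hasFDerivWithin_le
    (fun x hx => h.hasFDerivWithinAt z x hx) hz hw hu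

theorem minRisk_le (h : IsConvexRiskLoss W ℓ dℓ G P) {w : E} (hw : w ∈ W) :
    minRisk P ℓ W ≤ risk P ℓ w :=
  csInf_le ⟨0, by rintro _ ⟨u, hu, rfl⟩; exact h.risk_nonneg hu⟩ ⟨w, hw, rfl⟩

theorem minRisk_nonneg (h : IsConvexRiskLoss W ℓ dℓ G P) : 0 ≤ minRisk P ℓ W :=
  Real.sInf_nonneg (by rintro _ ⟨u, hu, rfl⟩; exact h.risk_nonneg hu)

variable [IsProbabilityMeasure P]

theorem integrable_loss (h : IsConvexRiskLoss W ℓ dℓ G P) {w : E} (hw : w ∈ W) :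
    Integrable (ℓ w) P := by
  refine integrable_of_abs_le (h.measurable_loss hw) (C := 1) ?_
  filter_upwards [h.mem_Icc] with z hz
  rw [abs_of_nonneg (hz w hw).1]
  exact (hz w hw).2

theorem risk_le_one (h : IsConvexRiskLoss W ℓ dℓ G P) {w : E} (hw : w ∈ W) : risk P ℓ w ≤ 1 := by
  have := integral_mono_ae (h.integrable_loss hw) (integrable_const (1 : ℝ))
    (by filter_upwards [h.mem_Icc] with z hz using (hz w hw).2)
  simpa [risk] using this

theorem abs_risk_sub_le (h : IsConvexRiskLoss W ℓ dℓ G P) {w u : E} (hw : w ∈ W) (hu : u ∈ W) :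
    |risk P ℓ u - risk P ℓ w| ≤ G * ‖u - w‖ := by
  unfold risk
  rw [← integral_sub (h.integrable_loss hu) (h.integrable_loss hw)]
  have := norm_integral_le_of_norm_le_const (μ := P) (f := fun z => ℓ u z - ℓ w z)
    (C := G * ‖u - w‖) (by filter_upwards [h.abs_loss_sub_le] with z hz using hz w hw u hu)
  simpa using this

theorem continuousOn_risk (h : IsConvexRiskLoss W ℓ dℓ G P) : ContinuousOn (risk P ℓ) W := by
  refine LipschitzOnWith.continuousOn (K := G.toNNReal) (LipschitzOnWith.of_dist_le_mul ?_)
  intro u hu w hw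
  rw [Real.dist_eq, dist_eq_norm]
  exact (h.abs_risk_sub_le hw hu).trans
    (mul_le_mul_of_nonneg_right (Real.le_coe_toNNReal G) (norm_nonneg _))

theorem exists_isArgmin (h : IsConvexRiskLoss W ℓ dℓ G P) (hW : IsCompact W) (hne : W.Nonempty) :
    ∃ v, IsArgmin (risk P ℓ) W v := by
  obtain ⟨x, hx, hmin⟩ := hW.exists_isMinOn hne h.continuousOn_risk
  exact ⟨x, hx, fun y hy => hmin hy⟩

theorem norm_gradRisk_le (h : IsConvexRiskLoss W ℓ dℓ G P) {w : E} (hw : w ∈ W) :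
    ‖gradRisk P dℓ w‖ ≤ G := by
  have := norm_integral_le_of_norm_le_const (μ := P) (f := dℓ w)
    (C := G) (by filter_upwards [h.norm_grad_le] with z hz using hz w hw)
  simpa [gradRisk] using this

variable [FiniteDimensional ℝ E]

theorem integrable_grad (h : IsConvexRiskLoss W ℓ dℓ G P) {w : E} (hw : w ∈ W) :
    Integrable (dℓ w) P :=
  Integrable.of_bound (h.measurable_grad_right hw).aestronglyMeasurable G
    (by filter_upwards [h.norm_grad_le] with z hz using hz w hw)

theorem gradRisk_apply (h : IsConvexRiskLoss W ℓ dℓ G P) {w : E} (hw : w ∈ W) (v : E) :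
    gradRisk P dℓ w v = ∫ z, dℓ w z v ∂P :=
  ContinuousLinearMap.integral_apply (h.integrable_grad hw) v

/-- The expected gradient is a subgradient of the risk. -/
theorem risk_subgradient (h : IsConvexRiskLoss W ℓ dℓ G P) {w u : E} (hw : w ∈ W) (hu : u ∈ W) :
    gradRisk P dℓ w (u - w) ≤ risk P ℓ u - risk P ℓ w := by
  set x : ℕ → E := fun n => w + (1 / ((n : ℝ) + 1)) • (u - w) with hx
  have hmem : ∀ n, x n ∈ W := fun n => by
    refine h.convexOn.1.add_smul_sub_mem hw hu ⟨by positivity, ?_⟩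
    rw [div_le_one (by positivity)]
    linarith [(Nat.cast_nonneg n : (0 : ℝ) ≤ n)]
  -- The loss itself need not be convex, so convexity enters after integration: dominated
  -- convergence moves the derivative inside, and the quotients of the convex risk bound the limit.
  have hlim : Filter.Tendsto (fun n : ℕ => ∫ z, ((n : ℝ) + 1) * (ℓ (x n) z - ℓ w z) ∂P)
      Filter.atTop (nhds (∫ z, dℓ w z (u - w) ∂P)) := by
    refine tendsto_integral_of_dominated_convergence (fun _ => G * ‖u - w‖) (fun n => ?_)
      (integrable_const _) (fun n => ?_) (Filter.Eventually.of_forall fun z => ?_)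
    · exact (((h.measurable_loss (hmem n)).sub (h.measurable_loss hw)).const_mul
        _).aestronglyMeasurable
    · filter_upwards [h.abs_loss_sub_le] with z hz
      have hn : (0 : ℝ) < (n : ℝ) + 1 := by positivity
      have h1 := hz w hw _ (hmem n)
      rw [hx, add_sub_cancel_left, norm_smul, Real.norm_of_nonneg (by positivity)] at h1
      rw [norm_mul, Real.norm_of_nonneg hn.le, Real.norm_eq_abs]
      calc _ ≤ ((n : ℝ) + 1) * (G * (1 / ((n : ℝ) + 1) * ‖u - w‖)) :=
            mul_le_mul_of_nonneg_left h1 hn.le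
        _ = _ := by field_simp
    · exact (h.hasFDerivWithinAt z w hw).tendsto_diffQuot h.convexOn.1 hw hu
  rw [h.gradRisk_apply hw]
  refine le_of_tendsto' hlim fun n => ?_
  have hn : (0 : ℝ) < (n : ℝ) + 1 := by positivity
  have hle : 1 / ((n : ℝ) + 1) ≤ 1 := by
    rw [div_le_one hn]; linarith [(Nat.cast_nonneg n : (0 : ℝ) ≤ n)]
  rw [integral_const_mul, integral_sub (h.integrable_loss (hmem n)) (h.integrable_loss hw)]
  have hc := h.convexOn.2 hu hw (show 0 ≤ 1 / ((n : ℝ) + 1) by positivity)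
    (show 0 ≤ 1 - 1 / ((n : ℝ) + 1) by linarith) (by ring)
  have e : (1 / ((n : ℝ) + 1)) • u + (1 - 1 / ((n : ℝ) + 1)) • w = x n := by
    rw [hx]; module
  rw [e] at hc
  simp only [smul_eq_mul] at hc
  change ((n : ℝ) + 1) * (risk P ℓ (x n) - risk P ℓ w) ≤ _
  have h3 : risk P ℓ (x n) - risk P ℓ w ≤ 1 / ((n : ℝ) + 1) * (risk P ℓ u - risk P ℓ w) := by
    linarith
  calc _ ≤ ((n : ℝ) + 1) * (1 / ((n : ℝ) + 1) * (risk P ℓ u - risk P ℓ w)) :=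
        mul_le_mul_of_nonneg_left h3 hn.le
    _ = _ := by rw [← mul_assoc, mul_one_div_cancel hn.ne', one_mul]

theorem measurable_gradRisk (h : IsConvexRiskLoss W ℓ dℓ G P) :
    Measurable fun w : W => gradRisk P dℓ w :=
  (StronglyMeasurable.integral_prod_right (f := fun (w : W) z => dℓ w z)
    h.measurable_grad.stronglyMeasurable).measurable

end IsConvexRiskLoss

end Risk

/-! ### The duality gap. -/

section OptError

variable {E : Type*} [NormedAddCommGroup E] [NormedSpace ℝ E] [MeasurableSpace E] {Z : Type*}
  [MeasurableSpace Z] {m : ℕ} {W : Set E} {ℓ : E → Z → ℝ} {dℓ : E → Z → (E →L[ℝ] ℝ)} {G : ℝ}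
  {P : Fin m → Measure Z}

/-- The duality gap of the averages is bounded through the values along the iterates. -/
theorem optError_weightedAvg_le [NeZero m] (hP : ∀ i, IsConvexRiskLoss W ℓ dℓ G (P i))
    (hne : W.Nonempty) {η : ℕ → ℝ} {t : ℕ} (hη : ∀ j ∈ Finset.Icc 1 t, 0 ≤ η j)
    (hS : 0 < ∑ k ∈ Finset.Icc 1 t, η k) {w : ℕ → E} {q : ℕ → Fin m → ℝ}
    (hw : ∀ j ∈ Finset.Icc 1 t, w j ∈ W) {c : ℝ}
    (h : ∀ w' ∈ W, ∀ q' ∈ stdSimplex ℝ (Fin m), ∑ j ∈ Finset.Icc 1 t,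
      η j * (saddle P ℓ W (w j) q' - saddle P ℓ W w' (q j)) ≤ c) :
    optError P ℓ W (weightedAvg η w t) (weightedAvg η q t)
      ≤ c / ∑ k ∈ Finset.Icc 1 t, η k := by
  refine optError_le hne fun w' hw' q' hq' => ?_
  set S := ∑ k ∈ Finset.Icc 1 t, η k with hSdef
  have hwt : ∑ j ∈ Finset.Icc 1 t, η j / S = 1 := by
    rw [← Finset.sum_div, div_self hS.ne']
  have h0 : ∀ j ∈ Finset.Icc 1 t, 0 ≤ η j / S := fun j hj => div_nonneg (hη j hj) hS.le
  -- Jensen in `w`, legitimate because the weights `q'` are nonnegative. In `q` the function is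
  -- linear, so `h2` is an equality.
  have h1 : saddle P ℓ W (weightedAvg η w t) q'
      ≤ ∑ j ∈ Finset.Icc 1 t, η j / S * saddle P ℓ W (w j) q' := by
    have hconv : ∀ i, risk (P i) ℓ (weightedAvg η w t)
        ≤ ∑ j ∈ Finset.Icc 1 t, η j / S * risk (P i) ℓ (w j) := fun i =>
      (hP i).convexOn.map_sum_le h0 hwt hw
    calc saddle P ℓ W (weightedAvg η w t) q'
        ≤ ∑ i, q' i * (∑ j ∈ Finset.Icc 1 t, η j / S * risk (P i) ℓ (w j)
          - minRisk (P i) ℓ W) := Finset.sum_le_sum fun i _ =>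
            mul_le_mul_of_nonneg_left (sub_le_sub_right (hconv i) _) (hq'.1 i)
      _ = ∑ i, q' i * ∑ j ∈ Finset.Icc 1 t,
            η j / S * (risk (P i) ℓ (w j) - minRisk (P i) ℓ W) := by
          refine Finset.sum_congr rfl fun i _ => ?_
          simp only [mul_sub, Finset.sum_sub_distrib, ← Finset.sum_mul, hwt, one_mul]
      _ = _ := by
          simp only [saddle, Finset.mul_sum]
          rw [Finset.sum_comm]
          refine Finset.sum_congr rfl fun j _ => Finset.sum_congr rfl fun i _ => ?_
          ring
  have h2 : saddle P ℓ W w' (weightedAvg η q t)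
      = ∑ j ∈ Finset.Icc 1 t, η j / S * saddle P ℓ W w' (q j) := by
    simp only [saddle, weightedAvg, Finset.mul_sum, Finset.sum_apply, Pi.smul_apply, smul_eq_mul,
      Finset.sum_mul]
    rw [Finset.sum_comm]
    refine Finset.sum_congr rfl fun j _ => Finset.sum_congr rfl fun i _ => ?_
    ring
  rw [le_div_iff₀ hS]
  refine le_trans ?_ (h w' hw' q' hq')
  rw [h2]
  calc _ ≤ (∑ j ∈ Finset.Icc 1 t, η j / S * saddle P ℓ W (w j) q'
        - ∑ j ∈ Finset.Icc 1 t, η j / S * saddle P ℓ W w' (q j)) * S :=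
        mul_le_mul_of_nonneg_right (sub_le_sub_right h1 _) hS.le
    _ = _ := by
        rw [← Finset.sum_sub_distrib, Finset.sum_mul]
        refine Finset.sum_congr rfl fun j _ => ?_
        field_simp

variable [∀ i, IsProbabilityMeasure (P i)]

theorem saddle_mem_Icc (hP : ∀ i, IsConvexRiskLoss W ℓ dℓ G (P i)) {w : E} {q : Fin m → ℝ}
    (hw : w ∈ W) (hq : q ∈ stdSimplex ℝ (Fin m)) :
    0 ≤ saddle P ℓ W w q ∧ saddle P ℓ W w q ≤ 1 := by
  refine ⟨Finset.sum_nonneg fun i _ => mul_nonneg (hq.1 i)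
    (sub_nonneg.2 ((hP i).minRisk_le hw)), ?_⟩
  calc saddle P ℓ W w q ≤ ∑ i, q i * 1 := Finset.sum_le_sum fun i _ =>
        mul_le_mul_of_nonneg_left
          (by linarith [(hP i).risk_le_one hw, (hP i).minRisk_nonneg]) (hq.1 i)
    _ = 1 := by simp [hq.2]

/-- Since the saddle function takes values in `[0, 1]`, its gap is bounded; this supplies
integrability of the optimization error. -/
theorem abs_optError_le [NeZero m] (hP : ∀ i, IsConvexRiskLoss W ℓ dℓ G (P i)) {w : E}
    {q : Fin m → ℝ} (hw : w ∈ W) (hq : q ∈ stdSimplex ℝ (Fin m)) :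
    |optError P ℓ W w q| ≤ 1 := by
  rw [abs_le]
  constructor
  · have h3 : sInf ((fun w' => saddle P ℓ W w' q) '' W) ≤ saddle P ℓ W w q :=
      csInf_le ⟨0, by rintro _ ⟨u, hu, rfl⟩; exact (saddle_mem_Icc hP hu hq).1⟩ ⟨w, hw, rfl⟩
    have h1 : 0 ≤ sSup ((fun q' => saddle P ℓ W w q') '' stdSimplex ℝ (Fin m)) :=
      Real.sSup_nonneg (by rintro _ ⟨q', hq', rfl⟩; exact (saddle_mem_Icc hP hw hq').1)
    unfold optError
    linarith [(saddle_mem_Icc hP hw hq).2]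
  · refine optError_le (Set.nonempty_of_mem hw) fun w' hw' q' hq' => ?_
    linarith [(saddle_mem_Icc hP hw hq').2, (saddle_mem_Icc hP hw' hq).1]

/-- Suprema and infima of a jointly continuous function over a compact set depend continuously on
the parameter; the points of `W` are treated as a subtype because the risk is continuous only there.
-/
theorem measurable_optError [BorelSpace E] (hP : ∀ i, IsConvexRiskLoss W ℓ dℓ G (P i))
    (hW : IsCompact W) [FiniteDimensional ℝ E] {Ω : Type*} {mΩ : MeasurableSpace Ω} {w : Ω → E}
    {q : Ω → Fin m → ℝ} (hw : Measurable w) (hwm : ∀ ω, w ω ∈ W) (hq : Measurable q) :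
    Measurable fun ω => optError P ℓ W (w ω) (q ω) := by
  have hWc : CompactSpace W := isCompact_iff_compactSpace.1 hW
  have hR : ∀ i, Continuous fun v : W => risk (P i) ℓ v := fun i =>
    continuousOn_iff_continuous_domRestrict.1 (hP i).continuousOn_risk
  have h1 : Continuous fun v : W =>
      sSup ((fun q' => saddle P ℓ W v q') '' stdSimplex ℝ (Fin m)) :=
    (isCompact_stdSimplex ℝ (Fin m)).continuous_sSup (f := fun (v : W) q' => saddle P ℓ W v q')
      (by
        change Continuous fun p : W × (Fin m → ℝ) => saddle P ℓ W p.1 p.2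
        unfold saddle
        refine continuous_finsetSum _ fun i _ => ?_
        exact Continuous.mul (by fun_prop)
          (((hR i).comp continuous_fst).sub continuous_const))
  have h2 : Continuous fun p : Fin m → ℝ =>
      sInf ((fun w' : W => saddle P ℓ W w' p) '' Set.univ) :=
    isCompact_univ.continuous_sInf (f := fun p (v : W) => saddle P ℓ W v p)
      (by
        change Continuous fun p : (Fin m → ℝ) × W => saddle P ℓ W p.2 p.1
        unfold saddle
        refine continuous_finsetSum _ fun i _ => ?_
        exact Continuous.mul (by fun_prop)
          (((hR i).comp continuous_snd).sub continuous_const))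
  have e : ∀ p : Fin m → ℝ, (fun w' : W => saddle P ℓ W w' p) '' Set.univ
      = (fun w' => saddle P ℓ W w' p) '' W := fun p => by
    ext r; simp
  simp only [e] at h2
  exact (h1.measurable.comp (hw.subtype_mk (h := hwm))).sub (h2.measurable.comp hq)

end OptError

/-! ### Step sizes and sums of `1 / √j`. -/

section StepSizes

/-- The weights `1 / √j`, to which all step sizes are proportional. -/
noncomputable def invSqrt (j : ℕ) : ℝ := 1 / √(j : ℝ)

theorem invSqrt_nonneg (j : ℕ) : 0 ≤ invSqrt j := by unfold invSqrt; positivity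

theorem invSqrt_pos {j : ℕ} (hj : 1 ≤ j) : 0 < invSqrt j := by
  have : (0 : ℝ) < j := by exact_mod_cast hj
  unfold invSqrt; positivity

theorem invSqrt_sq (j : ℕ) : invSqrt j ^ 2 = (j : ℝ)⁻¹ := by
  rw [invSqrt, div_pow, Real.sq_sqrt (Nat.cast_nonneg j), one_pow, one_div]

theorem sum_invSqrt_sq_le (t : ℕ) : ∑ j ∈ Finset.Icc 1 t, invSqrt j ^ 2 ≤ 1 + Real.log t := by
  have h := harmonic_le_one_add_log t
  rw [harmonic_eq_sum_Icc] at h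
  push_cast at h
  simpa only [invSqrt_sq] using h

theorem le_sum_invSqrt (t : ℕ) : 2 * (√((t : ℝ) + 1) - 1) ≤ ∑ j ∈ Finset.Icc 1 t, invSqrt j := by
  induction t with
  | zero => simp
  | succ n ih =>
    rw [Finset.sum_Icc_succ_top (by omega)]
    have h1 : (0 : ℝ) < √((n : ℝ) + 1) := Real.sqrt_pos.2 (by positivity)
    have h2 : √((n : ℝ) + 1) ^ 2 = n + 1 := Real.sq_sqrt (by positivity)
    have h3 : √((n : ℝ) + 1 + 1) ^ 2 = n + 1 + 1 := Real.sq_sqrt (by positivity)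
    have h4 : √((n : ℝ) + 1) ≤ √((n : ℝ) + 1 + 1) := Real.sqrt_le_sqrt (by linarith)
    -- With `a ≤ b` the two roots, `2 * (b - a) * a ≤ b ^ 2 - a ^ 2 = 1`.
    have : 2 * (√((n : ℝ) + 1 + 1) - √((n : ℝ) + 1)) ≤ invSqrt (n + 1) := by
      unfold invSqrt
      push_cast
      rw [le_div_iff₀ h1]
      nlinarith [sq_nonneg (√((n : ℝ) + 1 + 1) - √((n : ℝ) + 1))]
    push_cast
    linarith

theorem sqrt_le_sum_invSqrt (t : ℕ) : √(t : ℝ) ≤ ∑ j ∈ Finset.Icc 1 t, invSqrt j := by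
  have h : ∑ j ∈ Finset.Icc 1 t, invSqrt t ≤ ∑ j ∈ Finset.Icc 1 t, invSqrt j := by
    refine Finset.sum_le_sum fun j hj => ?_
    have hj := Finset.mem_Icc.1 hj
    have h0 : (0 : ℝ) < j := by exact_mod_cast hj.1
    unfold invSqrt
    exact one_div_le_one_div_of_le (Real.sqrt_pos.2 h0)
      (Real.sqrt_le_sqrt (by exact_mod_cast hj.2))
  refine le_trans (le_of_eq ?_) h
  rw [Finset.sum_const, Nat.card_Icc, Nat.add_sub_cancel, nsmul_eq_mul, invSqrt, mul_one_div,
    Real.div_sqrt]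

theorem sum_invSqrt_pos {t : ℕ} (ht : 1 ≤ t) : 0 < ∑ j ∈ Finset.Icc 1 t, invSqrt j :=
  lt_of_lt_of_le (Real.sqrt_pos.2 (by exact_mod_cast ht)) (sqrt_le_sum_invSqrt t)

theorem sqrt_add_one_sub_one_pos {t : ℕ} (ht : 1 ≤ t) : 0 < 2 * (√((t : ℝ) + 1) - 1) := by
  have h : (1 : ℝ) ≤ t := by exact_mod_cast ht
  have : 1 < √((t : ℝ) + 1) := by
    rw [Real.lt_sqrt (by norm_num)]; linarith
  linarith

/-- The scale `√(2 D² G² + 2 log m)` of the joint mirror descent. -/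
noncomputable def gapScale (D G : ℝ) (m : ℕ) : ℝ := √(2 * D ^ 2 * G ^ 2 + 2 * Real.log m)

theorem log_nat_pos {m : ℕ} (hm : 2 ≤ m) : 0 < Real.log m :=
  Real.log_pos (by exact_mod_cast hm)

theorem gapScale_sq {m : ℕ} (hm : 2 ≤ m) (D G : ℝ) :
    gapScale D G m ^ 2 = 2 * D ^ 2 * G ^ 2 + 2 * Real.log m :=
  Real.sq_sqrt (by have := log_nat_pos hm; positivity)

theorem gapScale_pos {m : ℕ} (hm : 2 ≤ m) (D G : ℝ) : 0 < gapScale D G m :=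
  Real.sqrt_pos.2 (by have := log_nat_pos hm; positivity)

theorem stepI_eq (D G : ℝ) (t : ℕ) : stepI D G t = D / G * invSqrt t := by
  rw [stepI, invSqrt, div_mul_div_comm, mul_one]

theorem stepW_eq {m : ℕ} (hm : 2 ≤ m) (D G : ℝ) (t : ℕ) :
    stepW D G m t = 2 * D ^ 2 / gapScale D G m * invSqrt t := by
  have := log_nat_pos hm
  rw [stepW, invSqrt, Real.sqrt_mul (by positivity), gapScale, div_mul_div_comm, mul_one]

theorem stepQ_eq {m : ℕ} (hm : 2 ≤ m) (D G : ℝ) (t : ℕ) :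
    stepQ D G m t = 2 * Real.log m / gapScale D G m * invSqrt t := by
  have := log_nat_pos hm
  rw [stepQ, invSqrt, Real.sqrt_mul (by positivity), gapScale, div_mul_div_comm, mul_one]

/-- Scaling cancels in the normalized weights. Hence all averages of the algorithm may be computed
with the weights `invSqrt`, and those of `w` and `q` share their weights. -/
theorem weightedAvg_const_mul {E : Type*} [AddCommGroup E] [Module ℝ E] {c : ℝ} (hc : c ≠ 0)
    {η η' : ℕ → ℝ} (h : ∀ j, η' j = c * η j) (x : ℕ → E) (t : ℕ) :
    weightedAvg η' x t = weightedAvg η x t := by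
  unfold weightedAvg
  refine Finset.sum_congr rfl fun j _ => ?_
  simp only [h, ← Finset.mul_sum]
  rw [mul_div_mul_left _ _ hc]

theorem weightedAvg_mem {E : Type*} [AddCommGroup E] [Module ℝ E] {W : Set E} (hW : Convex ℝ W)
    {x : ℕ → E} {t : ℕ} (ht : 1 ≤ t) (hx : ∀ j, 1 ≤ j → x j ∈ W) :
    weightedAvg invSqrt x t ∈ W := by
  refine hW.sum_mem (fun j _ => div_nonneg (invSqrt_nonneg j) (sum_invSqrt_pos ht).le) ?_
    fun j hj => hx j (Finset.mem_Icc.1 hj).1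
  rw [← Finset.sum_div, div_self (sum_invSqrt_pos ht).ne']

end StepSizes

/-! ### Pathwise bounds along a typical run. -/

/-- The data of the minimax problem, with the standing assumptions. -/
structure MinimaxProblem (E Z : Type*) [NormedAddCommGroup E] [NormedSpace ℝ E]
    [MeasurableSpace E] [MeasurableSpace Z] (m : ℕ) where
  W : Set E
  ν : E → ℝ
  ℓ : E → Z → ℝ
  dℓ : E → Z → (E →L[ℝ] ℝ)
  P : Fin m → Measure Z
  D : ℝ
  G : ℝ
  o : E
  two_le : 2 ≤ m
  isClosed : IsClosed W
  dgf : IsDistanceGenerating ν W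
  isProb : ∀ i, IsProbabilityMeasure (P i)
  loss : ∀ i, IsConvexRiskLoss W ℓ dℓ G (P i)
  D_pos : 0 < D
  G_pos : 0 < G
  isArgmin : IsArgmin ν W o
  bregman_le : ∀ w ∈ W, bregman ν W w o ≤ D ^ 2

/-- The samples and iterates of one run of the algorithm. -/
structure SampledRun (E Z : Type*) (m : ℕ) where
  z : ℕ → Fin m → Z
  u : ℕ → Fin m → E
  w : ℕ → E
  q : ℕ → Fin m → ℝ

namespace MinimaxProblem

attribute [instance] isProb

variable {E Z : Type*} [NormedAddCommGroup E] [NormedSpace ℝ E]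
  [MeasurableSpace E] [MeasurableSpace Z] {m : ℕ} (S : MinimaxProblem E Z m)

theorem neZero (S : MinimaxProblem E Z m) : NeZero m := ⟨by have := S.two_le; omega⟩

theorem convex : Convex ℝ S.W := S.dgf.strongConvexOn.1

theorem nonempty : S.W.Nonempty := ⟨S.o, S.isArgmin.1⟩

/-- `p` is a run of the algorithm for `S`. -/
def IsRun (p : SampledRun E Z m) : Prop :=
  IsAnytimeRun S.W S.ν S.ℓ S.dℓ (fun _ => stepI S.D S.G) (stepW S.D S.G m) (stepQ S.D S.G m)
    p.z p.u p.w p.q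

/-- The bounds on the loss and its gradient hold at all samples of the run. -/
def IsTypical (p : SampledRun E Z m) : Prop :=
  ∀ j i, ∀ v ∈ S.W, ‖S.dℓ v (p.z j i)‖ ≤ S.G ∧ 0 ≤ S.ℓ v (p.z j i) ∧ S.ℓ v (p.z j i) ≤ 1

/-- The averaged iterate of the auxiliary mirror descent. -/
noncomputable def avgU (p : SampledRun E Z m) (j : ℕ) (i : Fin m) : E :=
  weightedAvg invSqrt (fun s => p.u s i) j

/-- The estimated gradient in `q`. -/
noncomputable def lossDiff (p : SampledRun E Z m) (j : ℕ) (i : Fin m) : ℝ :=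
  S.ℓ (p.w j) (p.z j i) - S.ℓ (avgU p j i) (p.z j i)

/-- The stochastic gradient in `w`. -/
noncomputable def stochGrad (p : SampledRun E Z m) (j : ℕ) : E →L[ℝ] ℝ :=
  ∑ i, p.q j i • S.dℓ (p.w j) (p.z j i)

/-- The error of the stochastic gradient in `w`. -/
noncomputable def wNoise (p : SampledRun E Z m) (j : ℕ) : E →L[ℝ] ℝ :=
  ∑ i, p.q j i • (gradRisk (S.P i) S.dℓ (p.w j) - S.dℓ (p.w j) (p.z j i))

/-- The error of the stochastic gradient in `q`, apart from its bias. -/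
noncomputable def qNoise (p : SampledRun E Z m) (j : ℕ) (i : Fin m) : ℝ :=
  risk (S.P i) S.ℓ (p.w j) - risk (S.P i) S.ℓ (avgU p j i) - S.lossDiff p j i

/-- The ghost iterates in `W`: dual averaging on the gradient errors. -/
noncomputable def ghostW (p : SampledRun E Z m) (j : ℕ) : E :=
  dualArgmin (fun x => bregman S.ν S.W x S.o) S.W
    (∑ s ∈ Finset.Ico 1 j, stepW S.D S.G m s • S.wNoise p s)

/-- The ghost iterates in the simplex. -/
noncomputable def ghostQ (p : SampledRun E Z m) (j : ℕ) : Fin m → ℝ :=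
  softmax (∑ s ∈ Finset.Ico 1 j, stepQ S.D S.G m s • S.qNoise p s)

/-- The martingale differences that control the duality gap. -/
noncomputable def gapNoise (p : SampledRun E Z m) (j : ℕ) : ℝ :=
  invSqrt j / gapScale S.D S.G m *
    (S.wNoise p j (p.w j - S.ghostW p j) + ∑ i, (S.ghostQ p j i - p.q j i) * S.qNoise p j i)

/-- The martingale differences that control the `i`-th auxiliary mirror descent. -/
noncomputable def auxNoise (v : E) (i : Fin m) (p : SampledRun E Z m) (j : ℕ) : ℝ :=
  stepI S.D S.G j *
    (gradRisk (S.P i) S.dℓ (p.u j i) - S.dℓ (p.u j i) (p.z j i)) (p.u j i - v)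

variable {S} {p : SampledRun E Z m}

theorem half_sq_le_bregman {v : E} (hv : v ∈ S.W) :
    ‖v - S.o‖ ^ 2 / 2 ≤ bregman S.ν S.W v S.o :=
  S.dgf.half_sq_le_bregman S.isArgmin.1 (S.dgf.differentiableWithinAt_of_isArgmin S.isArgmin) hv

/-- Strong convexity at the center turns the Bregman radius `D ^ 2` into the norm radius `√2 * D`.
This yields the diameter `2 * √2 * D` and the compactness of `W`. -/
theorem norm_sub_center_le {v : E} (hv : v ∈ S.W) : ‖v - S.o‖ ≤ √2 * S.D := by
  have h1 := S.half_sq_le_bregman hv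
  have h2 := S.bregman_le v hv
  have hD := S.D_pos
  refine abs_le_of_sq_le_sq' ?_ (by positivity) |>.2
  rw [mul_pow, Real.sq_sqrt (by norm_num)]
  linarith

theorem norm_sub_le {v w : E} (hv : v ∈ S.W) (hw : w ∈ S.W) : ‖v - w‖ ≤ 2 * √2 * S.D := by
  have h : ‖v - w‖ ≤ ‖v - S.o‖ + ‖w - S.o‖ := by
    rw [show v - w = (v - S.o) - (w - S.o) by abel]; exact _root_.norm_sub_le _ _
  linarith [S.norm_sub_center_le hv, S.norm_sub_center_le hw]

theorem isCompact [FiniteDimensional ℝ E] : IsCompact S.W := by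
  have : ProperSpace E := FiniteDimensional.proper ℝ E
  refine Metric.isCompact_of_isClosed_isBounded S.isClosed ?_
  refine (Metric.isBounded_closedBall (x := S.o) (r := √2 * S.D)).subset fun v hv => ?_
  rw [Metric.mem_closedBall, dist_eq_norm]
  exact S.norm_sub_center_le hv

theorem IsRun.isArgmin_u (h : S.IsRun p) (i : Fin m) : IsArgmin S.ν S.W (p.u 1 i) := h.init_u i

theorem IsRun.step_u' (h : S.IsRun p) {t : ℕ} (ht : 1 ≤ t) (i : Fin m) :
    IsMirrorStep S.ν S.W (stepI S.D S.G t) (fun v => S.dℓ (p.u t i) (p.z t i) v) (p.u t i)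
      (p.u (t + 1) i) := h.step_u t ht i

theorem IsRun.step_w' (h : S.IsRun p) {t : ℕ} (ht : 1 ≤ t) :
    IsMirrorStep S.ν S.W (stepW S.D S.G m t) (fun v => S.stochGrad p t v) (p.w t)
      (p.w (t + 1)) := by
  have := h.step_w t ht
  simpa [stochGrad, sum_apply] using this

theorem IsRun.u_mem (h : S.IsRun p) {t : ℕ} (ht : 1 ≤ t) (i : Fin m) : p.u t i ∈ S.W :=
  isMirrorDescent_mem (x := fun t => p.u t i) (h.isArgmin_u i) (fun _ hs => h.step_u' hs i) ht

theorem IsRun.w_mem (h : S.IsRun p) {t : ℕ} (ht : 1 ≤ t) : p.w t ∈ S.W :=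
  isMirrorDescent_mem (x := p.w) h.init_w (fun _ hs => h.step_w' hs) ht

/-- Uniqueness from quadratic growth. It identifies the starting points of every run with the center
`o`, at which the Bregman bound is assumed. -/
theorem eq_of_isArgmin {x y : E} (hx : IsArgmin S.ν S.W x) (hy : IsArgmin S.ν S.W y) : x = y := by
  have h1 := S.dgf.strongConvexOn.add_half_sq_le_of_isArgmin hy hx.1
  have h2 := hx.2 y hy.1
  have h3 : ‖x - y‖ = 0 := pow_eq_zero_iff (two_ne_zero) |>.1
    (le_antisymm (by linarith) (sq_nonneg _))
  exact sub_eq_zero.1 (norm_eq_zero.1 h3)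

theorem differentiableWithinAt_of_mirrorDescent {η : ℕ → ℝ} {g : ℕ → E →L[ℝ] ℝ} {x : ℕ → E}
    (h1 : IsArgmin S.ν S.W (x 1))
    (hstep : ∀ t, 1 ≤ t → IsMirrorStep S.ν S.W (η t) (fun v => g t v) (x t) (x (t + 1)))
    {t : ℕ} (ht : 1 ≤ t) : DifferentiableWithinAt ℝ S.ν S.W (x t) := by
  induction t, ht using Nat.le_induction with
  | base => exact S.dgf.differentiableWithinAt_of_isArgmin h1
  | succ n hn _ => exact S.dgf.differentiableWithinAt_of_isMirrorStep (hstep n hn)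

theorem IsRun.avgU_mem (h : S.IsRun p) {t : ℕ} (ht : 1 ≤ t) (i : Fin m) : avgU p t i ∈ S.W :=
  weightedAvg_mem S.convex ht fun _ hj => h.u_mem hj i

theorem weightedAvg_stepI (x : ℕ → E) (t : ℕ) :
    weightedAvg (stepI S.D S.G) x t = weightedAvg invSqrt x t :=
  weightedAvg_const_mul (div_pos S.D_pos S.G_pos).ne' (stepI_eq S.D S.G) x t

/-- The weights `q` are the exponential weights of the accumulated loss differences. -/
theorem IsRun.q_eq (h : S.IsRun p) {t : ℕ} (ht : 1 ≤ t) :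
    p.q t = softmax (∑ s ∈ Finset.Ico 1 t, stepQ S.D S.G m s • S.lossDiff p s) := by
  have := S.neZero
  induction t, ht using Nat.le_induction with
  | base =>
    funext i
    rw [h.init_q i, Finset.Ico_self, Finset.sum_empty, softmax_zero]
  | succ n hn ih =>
    have hs := h.step_q n hn
    have hg : ∀ i, S.ℓ (p.w n) (p.z n i)
        - S.ℓ (weightedAvg (stepI S.D S.G) (fun j => p.u j i) n) (p.z n i)
        = S.lossDiff p n i := fun i => by rw [S.weightedAvg_stepI]; rfl
    simp only [hg] at hs
    rw [ih] at hs
    rw [eq_softmax_of_isMirrorStep hs, Finset.sum_Ico_succ_top hn]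
    rfl

theorem IsRun.q_mem (h : S.IsRun p) {t : ℕ} (ht : 1 ≤ t) : p.q t ∈ stdSimplex ℝ (Fin m) := by
  have := S.neZero
  rw [h.q_eq ht]
  exact softmax_mem _

theorem ghostQ_mem (p : SampledRun E Z m) (j : ℕ) : S.ghostQ p j ∈ stdSimplex ℝ (Fin m) := by
  have := S.neZero
  exact softmax_mem _

theorem ghostW_mem [FiniteDimensional ℝ E] (p : SampledRun E Z m) (j : ℕ) :
    S.ghostW p j ∈ S.W :=
  (isArgmin_dualArgmin S.isCompact S.nonempty (S.dgf.continuousOn_bregman _) _).1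

theorem abs_lossDiff_le (h : S.IsRun p) (hb : S.IsTypical p) {j : ℕ} (hj : 1 ≤ j) (i : Fin m) :
    |S.lossDiff p j i| ≤ 1 := by
  have h1 := hb j i _ (h.w_mem hj)
  have h2 := hb j i _ (h.avgU_mem hj i)
  unfold lossDiff
  rw [abs_le]
  constructor <;> linarith [h1.2.1, h1.2.2, h2.2.1, h2.2.2]

theorem abs_qNoise_le (h : S.IsRun p) (hb : S.IsTypical p) {j : ℕ} (hj : 1 ≤ j) (i : Fin m) :
    |S.qNoise p j i| ≤ 2 := by
  have h1 := abs_le.1 (abs_lossDiff_le h hb hj i)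
  have h2 := (S.loss i).risk_nonneg (h.w_mem hj)
  have h3 := (S.loss i).risk_le_one (h.w_mem hj)
  have h4 := (S.loss i).risk_nonneg (h.avgU_mem hj i)
  have h5 := (S.loss i).risk_le_one (h.avgU_mem hj i)
  unfold qNoise
  rw [abs_le]
  constructor <;> linarith [h1.1, h1.2]

theorem norm_sum_smul_le {q : Fin m → ℝ} (hq : q ∈ stdSimplex ℝ (Fin m)) {F : Type*}
    [NormedAddCommGroup F] [NormedSpace ℝ F] {g : Fin m → F} {C : ℝ} (hg : ∀ i, ‖g i‖ ≤ C) :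
    ‖∑ i, q i • g i‖ ≤ C := by
  calc ‖∑ i, q i • g i‖ ≤ ∑ i, q i * C := norm_sum_le_of_le _ fun i _ => by
        rw [norm_smul, Real.norm_of_nonneg (hq.1 i)]
        exact mul_le_mul_of_nonneg_left (hg i) (hq.1 i)
    _ = C := by rw [← Finset.sum_mul, hq.2, one_mul]

theorem norm_stochGrad_le (h : S.IsRun p) (hb : S.IsTypical p) {j : ℕ} (hj : 1 ≤ j) :
    ‖S.stochGrad p j‖ ≤ S.G :=
  norm_sum_smul_le (h.q_mem hj) fun i => (hb j i _ (h.w_mem hj)).1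

theorem norm_gradRisk_sub_le (hb : S.IsTypical p) (j : ℕ) (i : Fin m) {v : E} (hv : v ∈ S.W) :
    ‖gradRisk (S.P i) S.dℓ v - S.dℓ v (p.z j i)‖ ≤ 2 * S.G := by
  refine (_root_.norm_sub_le _ _).trans ?_
  linarith [(S.loss i).norm_gradRisk_le hv, (hb j i v hv).1]

theorem norm_wNoise_le (h : S.IsRun p) (hb : S.IsTypical p) {j : ℕ} (hj : 1 ≤ j) :
    ‖S.wNoise p j‖ ≤ 2 * S.G :=
  norm_sum_smul_le (h.q_mem hj) fun i => norm_gradRisk_sub_le hb j i (h.w_mem hj)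

theorem abs_apply_sub_le {g : E →L[ℝ] ℝ} {C : ℝ} (hg : ‖g‖ ≤ C) {v w : E} (hv : v ∈ S.W)
    (hw : w ∈ S.W) : |g (v - w)| ≤ C * (2 * √2 * S.D) :=
  (g.le_opNorm _).trans (mul_le_mul hg (S.norm_sub_le hv hw) (norm_nonneg _)
    ((norm_nonneg _).trans hg))

theorem abs_auxNoise_le (h : S.IsRun p) (hb : S.IsTypical p) {v : E} (hv : v ∈ S.W) (i : Fin m)
    {j : ℕ} (hj : 1 ≤ j) : |S.auxNoise v i p j| ≤ 4 * √2 * S.D ^ 2 * invSqrt j := by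
  have hD := S.D_pos
  have hG := S.G_pos
  have h0 := invSqrt_nonneg j
  rw [auxNoise, abs_mul, stepI_eq, abs_of_nonneg (by positivity)]
  calc _ ≤ S.D / S.G * invSqrt j * (2 * S.G * (2 * √2 * S.D)) :=
        mul_le_mul_of_nonneg_left (S.abs_apply_sub_le
          (norm_gradRisk_sub_le hb j i (h.u_mem hj i)) (h.u_mem hj i) hv) (by positivity)
    _ = _ := by field_simp; ring

/-- The point is the absence of `D`, `G` and `m`: dividing by `gapScale` normalizes the noise in
`w`, of size `D * G`, and in `q`, of size one, at once. -/
theorem abs_gapNoise_le [FiniteDimensional ℝ E] (h : S.IsRun p) (hb : S.IsTypical p) {j : ℕ}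
    (hj : 1 ≤ j) : |S.gapNoise p j| ≤ 4 * √2 * invSqrt j := by
  have hD := S.D_pos
  have hG := S.G_pos
  have h0 := invSqrt_nonneg j
  have hL := gapScale_pos S.two_le S.D S.G
  have h2 : 0 ≤ √2 := Real.sqrt_nonneg 2
  have hs2 : √2 ^ 2 = 2 := Real.sq_sqrt (by norm_num)
  have hw := S.abs_apply_sub_le (norm_wNoise_le h hb hj) (h.w_mem hj) (S.ghostW_mem p j)
  -- Two probability vectors are at `ℓ¹`-distance at most 2, and the noise in `q` is at most 2 in
  -- each coordinate.
  have hq : |∑ i, (S.ghostQ p j i - p.q j i) * S.qNoise p j i| ≤ 4 := by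
    have hle : ∀ i, |(S.ghostQ p j i - p.q j i) * S.qNoise p j i|
        ≤ (S.ghostQ p j i + p.q j i) * 2 := fun i => by
      have ha := (S.ghostQ_mem p j).1 i
      have hb' := (h.q_mem hj).1 i
      rw [abs_mul]
      refine mul_le_mul ?_ (abs_qNoise_le h hb hj i) (abs_nonneg _) (by positivity)
      rw [abs_le]; constructor <;> linarith
    calc _ ≤ ∑ i, |(S.ghostQ p j i - p.q j i) * S.qNoise p j i| := Finset.abs_sum_le_sum_abs _ _
      _ ≤ ∑ i, (S.ghostQ p j i + p.q j i) * 2 := Finset.sum_le_sum fun i _ => hle i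
      _ = 4 := by
        rw [← Finset.sum_mul, Finset.sum_add_distrib, (S.ghostQ_mem p j).2, (h.q_mem hj).2]
        norm_num
  have hlog : 1 ≤ 2 * Real.log m := by
    have h1 : Real.log 2 ≤ Real.log m :=
      Real.log_le_log (by norm_num) (by exact_mod_cast S.two_le)
    linarith [Real.log_two_gt_d9]
  -- For `a = √2 * D * G` one has `(a + 1) ^ 2 ≤ 2 * a ^ 2 + 2`, and `m ≥ 2` gives `4 * log m ≥ 2`.
  have hscale : √2 * (S.D * S.G) + 1 ≤ √2 * gapScale S.D S.G m := by
    refine abs_le_of_sq_le_sq' ?_ (by positivity) |>.2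
    rw [mul_pow, hs2, gapScale_sq S.two_le]
    nlinarith [sq_nonneg (√2 * (S.D * S.G) - 1)]
  rw [gapNoise, abs_mul, abs_of_nonneg (by positivity)]
  calc _ ≤ invSqrt j / gapScale S.D S.G m * (4 * (√2 * (S.D * S.G) + 1)) := by
        refine mul_le_mul_of_nonneg_left ((abs_add_le _ _).trans ?_) (by positivity)
        linarith
    _ ≤ invSqrt j / gapScale S.D S.G m * (4 * (√2 * gapScale S.D S.G m)) := by
        gcongr
    _ = _ := by field_simp

/-- The excess risk of the averaged iterates of the auxiliary mirror descents. -/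
theorem excessRisk_avgU_le [FiniteDimensional ℝ E] (h : S.IsRun p) (hb : S.IsTypical p)
    {i : Fin m} {v : E} (hv : IsArgmin (risk (S.P i) S.ℓ) S.W v) {t : ℕ} (ht : 1 ≤ t) :
    risk (S.P i) S.ℓ (avgU p t i) - minRisk (S.P i) S.ℓ S.W ≤ S.D * S.G * invSqrt t *
      ((3 + Real.log t) / 2 + (∑ j ∈ Finset.Icc 1 t, S.auxNoise v i p j) / S.D ^ 2) := by
  have hD := S.D_pos
  have hG := S.G_pos
  set R := risk (S.P i) S.ℓ with hR
  set N := ∑ j ∈ Finset.Icc 1 t, S.auxNoise v i p j with hN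
  set T := ∑ j ∈ Finset.Icc 1 t, invSqrt j with hT
  have hTpos : 0 < T := sum_invSqrt_pos ht
  have hex : 0 ≤ R (avgU p t i) - R v := sub_nonneg.2 (hv.2 _ (h.avgU_mem ht i))
  rw [minRisk_eq_of_isArgmin hv]
  have hreg := S.dgf.mirrorDescent_regret (x := fun s => p.u s i) (h.isArgmin_u i)
    (fun s hs => h.step_u' hs i) hv.1 t
  have hbr : bregman S.ν S.W v (p.u 1 i) ≤ S.D ^ 2 := by
    have : p.u 1 i = S.o := S.eq_of_isArgmin (h.isArgmin_u i) S.isArgmin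
    rw [this]
    exact S.bregman_le v hv.1
  have hsq : ∑ j ∈ Finset.Icc 1 t, stepI S.D S.G j ^ 2 * ‖S.dℓ (p.u j i) (p.z j i)‖ ^ 2 / 2
      ≤ S.D ^ 2 / 2 * (1 + Real.log t) := by
    calc _ ≤ ∑ j ∈ Finset.Icc 1 t, S.D ^ 2 / 2 * invSqrt j ^ 2 := by
          refine Finset.sum_le_sum fun j hj => ?_
          have hn := (hb j i _ (h.u_mem (Finset.mem_Icc.1 hj).1 i)).1
          calc _ ≤ stepI S.D S.G j ^ 2 * S.G ^ 2 / 2 := by gcongr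
            _ = _ := by rw [stepI_eq]; field_simp
      _ ≤ _ := by
          rw [← Finset.mul_sum]
          exact mul_le_mul_of_nonneg_left (sum_invSqrt_sq_le t) (by positivity)
  have hconv : T * (R (avgU p t i) - R v) ≤ ∑ j ∈ Finset.Icc 1 t, invSqrt j * (R (p.u j i) - R v) := by
    have := (S.loss i).convexOn.map_sum_le (t := Finset.Icc 1 t) (w := fun j => invSqrt j / T)
      (p := fun j => p.u j i) (fun j _ => div_nonneg (invSqrt_nonneg j) hTpos.le)
      (by rw [← Finset.sum_div, div_self hTpos.ne'])
      (fun j hj => h.u_mem (Finset.mem_Icc.1 hj).1 i)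
    have h2 : R (avgU p t i) ≤ ∑ j ∈ Finset.Icc 1 t, invSqrt j / T * R (p.u j i) := this
    have h3 : T * ∑ j ∈ Finset.Icc 1 t, invSqrt j / T * R (p.u j i)
        = ∑ j ∈ Finset.Icc 1 t, invSqrt j * R (p.u j i) := by
      rw [Finset.mul_sum]
      exact Finset.sum_congr rfl fun j _ => by field_simp
    simp only [mul_sub, Finset.sum_sub_distrib, ← Finset.sum_mul]
    rw [← h3]
    have := mul_le_mul_of_nonneg_left h2 hTpos.le
    linarith
  have hlin : S.D / S.G * ∑ j ∈ Finset.Icc 1 t, invSqrt j * (R (p.u j i) - R v)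
      ≤ ∑ j ∈ Finset.Icc 1 t, stepI S.D S.G j * S.dℓ (p.u j i) (p.z j i) (p.u j i - v) + N := by
    -- Termwise, convexity bounds the excess risk by the expected gradient in the direction `u_j -
    -- v`, which is the sampled gradient plus the noise.
    rw [hN, Finset.mul_sum, ← Finset.sum_add_distrib]
    refine Finset.sum_le_sum fun j hj => ?_
    have hs := (S.loss i).risk_subgradient (h.u_mem (Finset.mem_Icc.1 hj).1 i) hv.1
    have hneg : gradRisk (S.P i) S.dℓ (p.u j i) (v - p.u j i)
        = -gradRisk (S.P i) S.dℓ (p.u j i) (p.u j i - v) := by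
      rw [← map_neg, neg_sub]
    have h0 : 0 ≤ S.D / S.G * invSqrt j := mul_nonneg (by positivity) (invSqrt_nonneg j)
    rw [auxNoise, stepI_eq, sub_apply]
    have : S.D / S.G * invSqrt j * (R (p.u j i) - R v) ≤ S.D / S.G * invSqrt j *
        gradRisk (S.P i) S.dℓ (p.u j i) (p.u j i - v) :=
      mul_le_mul_of_nonneg_left (by linarith) h0
    linarith
  -- Since the excess risk is nonnegative, the total weight may be lowered to `√t`, which produces
  -- the factor `invSqrt t` in the result.
  have hfin : S.D / S.G * (√(t : ℝ) * (R (avgU p t i) - R v))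
      ≤ S.D ^ 2 * ((3 + Real.log t) / 2 + N / S.D ^ 2) := by
    have h1 : √(t : ℝ) * (R (avgU p t i) - R v) ≤ T * (R (avgU p t i) - R v) :=
      mul_le_mul_of_nonneg_right (sqrt_le_sum_invSqrt t) hex
    have h2 : S.D / S.G * (√(t : ℝ) * (R (avgU p t i) - R v)) ≤ S.D / S.G *
        ∑ j ∈ Finset.Icc 1 t, invSqrt j * (R (p.u j i) - R v) :=
      mul_le_mul_of_nonneg_left (h1.trans hconv) (by positivity)
    have e : S.D ^ 2 * ((3 + Real.log t) / 2 + N / S.D ^ 2)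
        = S.D ^ 2 + S.D ^ 2 / 2 * (1 + Real.log t) + N := by
      field_simp; ring
    rw [e]
    linarith
  have hst : 0 < √(t : ℝ) := Real.sqrt_pos.2 (by exact_mod_cast ht)
  have e2 : R (avgU p t i) - R v = S.G / S.D * invSqrt t *
      (S.D / S.G * (√(t : ℝ) * (R (avgU p t i) - R v))) := by
    rw [invSqrt]; field_simp
  rw [e2]
  calc _ ≤ S.G / S.D * invSqrt t * (S.D ^ 2 * ((3 + Real.log t) / 2 + N / S.D ^ 2)) :=
        mul_le_mul_of_nonneg_left hfin (mul_nonneg (by positivity) (invSqrt_nonneg t))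
    _ = _ := by field_simp

/-- The duality gap in one round. -/
theorem saddle_sub_le [FiniteDimensional ℝ E] (h : S.IsRun p) {j : ℕ} (hj : 1 ≤ j) {B : ℝ}
    (hB : ∀ i, risk (S.P i) S.ℓ (avgU p j i) - minRisk (S.P i) S.ℓ S.W ≤ B)
    {w' : E} (hw' : w' ∈ S.W) {q' : Fin m → ℝ} (hq' : q' ∈ stdSimplex ℝ (Fin m)) :
    saddle S.P S.ℓ S.W (p.w j) q' - saddle S.P S.ℓ S.W w' (p.q j)
      ≤ S.stochGrad p j (p.w j - w') + S.wNoise p j (p.w j - w')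
        + ∑ i, (q' i - p.q j i) * S.lossDiff p j i + ∑ i, (q' i - p.q j i) * S.qNoise p j i
        + B := by
  have hq := h.q_mem hj
  have e1 : S.stochGrad p j (p.w j - w') + S.wNoise p j (p.w j - w')
      = ∑ i, p.q j i * gradRisk (S.P i) S.dℓ (p.w j) (p.w j - w') := by
    rw [stochGrad, wNoise, sum_apply, sum_apply, ← Finset.sum_add_distrib]
    refine Finset.sum_congr rfl fun i _ => ?_
    simp only [smul_apply, sub_apply, smul_eq_mul]
    ring
  have e2 : ∑ i, q' i * B = B := by rw [← Finset.sum_mul, hq'.2, one_mul]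
  rw [e1, saddle, saddle, ← Finset.sum_sub_distrib, ← e2, ← Finset.sum_add_distrib,
    ← Finset.sum_add_distrib, ← Finset.sum_add_distrib]
  refine Finset.sum_le_sum fun i _ => ?_
  have hs := (S.loss i).risk_subgradient (h.w_mem hj) hw'
  have hneg : gradRisk (S.P i) S.dℓ (p.w j) (w' - p.w j)
      = -gradRisk (S.P i) S.dℓ (p.w j) (p.w j - w') := by
    rw [← map_neg, neg_sub]
  have h1 : p.q j i * (risk (S.P i) S.ℓ (p.w j) - risk (S.P i) S.ℓ w')
      ≤ p.q j i * gradRisk (S.P i) S.dℓ (p.w j) (p.w j - w') :=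
    mul_le_mul_of_nonneg_left (by linarith) (hq.1 i)
  have h2 := mul_le_mul_of_nonneg_left (hB i) (hq'.1 i)
  -- The bias appears with weight `q' - q_j`. Its `q_j` part has a favourable sign and is dropped,
  -- so only the `q'` part is charged to `B`.
  have h3 : 0 ≤ p.q j i * (risk (S.P i) S.ℓ (avgU p j i) - minRisk (S.P i) S.ℓ S.W) :=
    mul_nonneg (hq.1 i) (sub_nonneg.2 ((S.loss i).minRisk_le (h.avgU_mem hj i)))
  rw [qNoise]
  linarith

/-- The accumulated duality gap along a run. -/
theorem sum_saddle_sub_le [FiniteDimensional ℝ E] (h : S.IsRun p) (hb : S.IsTypical p) {t : ℕ}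
    {B : ℕ → ℝ} (hB : ∀ j ∈ Finset.Icc 1 t, ∀ i,
      risk (S.P i) S.ℓ (avgU p j i) - minRisk (S.P i) S.ℓ S.W ≤ B j)
    {w' : E} (hw' : w' ∈ S.W) {q' : Fin m → ℝ} (hq' : q' ∈ stdSimplex ℝ (Fin m)) :
    ∑ j ∈ Finset.Icc 1 t,
      invSqrt j * (saddle S.P S.ℓ S.W (p.w j) q' - saddle S.P S.ℓ S.W w' (p.q j))
      ≤ gapScale S.D S.G m * (2 + 5 / 2 * (1 + Real.log t)
          + ∑ j ∈ Finset.Icc 1 t, S.gapNoise p j) + ∑ j ∈ Finset.Icc 1 t, invSqrt j * B j := by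
  have := S.neZero
  have hD := S.D_pos
  have hG := S.G_pos
  have hm := log_nat_pos S.two_le
  set L := gapScale S.D S.G m with hLdef
  have hL : 0 < L := gapScale_pos S.two_le S.D S.G
  have hLsq : L ^ 2 = 2 * S.D ^ 2 * S.G ^ 2 + 2 * Real.log m := gapScale_sq S.two_le S.D S.G
  -- The common scale of the two step sizes, `2 * D ^ 2 * η` and `2 * log m * η`. Dividing each
  -- regret by its prefactor turns the initial distance, `D ^ 2` or `log m`, into `1 / 2`.
  set η : ℕ → ℝ := fun j => invSqrt j / L with hη
  have hη0 : ∀ j, 0 ≤ η j := fun j => div_nonneg (invSqrt_nonneg j) hL.le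
  have hsW : ∀ j, stepW S.D S.G m j = 2 * S.D ^ 2 * η j := fun j => by
    rw [stepW_eq S.two_le, hη]; ring
  have hsQ : ∀ j, stepQ S.D S.G m j = 2 * Real.log m * η j := fun j => by
    rw [stepQ_eq S.two_le, hη]; ring
  set Q := ∑ j ∈ Finset.Icc 1 t, η j ^ 2 with hQ
  have hQle : L ^ 2 * Q ≤ 1 + Real.log t := by
    refine le_trans (le_of_eq ?_) (sum_invSqrt_sq_le t)
    rw [hQ, Finset.mul_sum]
    refine Finset.sum_congr rfl fun j _ => ?_
    rw [hη]; field_simp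
  have hmem : ∀ {j}, j ∈ Finset.Icc 1 t → 1 ≤ j := fun hj => (Finset.mem_Icc.1 hj).1
  have hbr : bregman S.ν S.W w' (p.w 1) ≤ S.D ^ 2 := by
    have : p.w 1 = S.o := S.eq_of_isArgmin h.init_w S.isArgmin
    rw [this]
    exact S.bregman_le w' hw'
  -- the regret in `w`
  have r1 : ∑ j ∈ Finset.Icc 1 t, η j * S.stochGrad p j (p.w j - w')
      ≤ 1 / 2 + S.D ^ 2 * S.G ^ 2 * Q := by
    have hreg := S.dgf.mirrorDescent_regret (x := p.w) h.init_w (fun s hs => h.step_w' hs) hw' t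
    have hsq : ∑ j ∈ Finset.Icc 1 t, stepW S.D S.G m j ^ 2 * ‖S.stochGrad p j‖ ^ 2 / 2
        ≤ 2 * S.D ^ 2 * (S.D ^ 2 * S.G ^ 2 * Q) := by
      rw [hQ, Finset.mul_sum, Finset.mul_sum]
      refine Finset.sum_le_sum fun j hj => ?_
      have := norm_stochGrad_le h hb (hmem hj)
      calc _ ≤ stepW S.D S.G m j ^ 2 * S.G ^ 2 / 2 := by gcongr
        _ = _ := by rw [hsW]; ring
    have e : ∑ j ∈ Finset.Icc 1 t, stepW S.D S.G m j * S.stochGrad p j (p.w j - w')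
        = 2 * S.D ^ 2 * ∑ j ∈ Finset.Icc 1 t, η j * S.stochGrad p j (p.w j - w') := by
      rw [Finset.mul_sum]
      exact Finset.sum_congr rfl fun j _ => by rw [hsW]; ring
    rw [e] at hreg
    have : 0 < 2 * S.D ^ 2 := by positivity
    refine le_of_mul_le_mul_left ?_ this
    linarith
  -- the regret of the ghost iterates in `w`
  have r2 : ∑ j ∈ Finset.Icc 1 t, η j * S.wNoise p j (S.ghostW p j - w')
      ≤ 1 / 2 + 4 * (S.D ^ 2 * S.G ^ 2 * Q) := by
    have hreg := dualAveraging_regret (S.dgf.strongConvexOn_bregman S.o) S.isCompact S.nonempty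
      (S.dgf.continuousOn_bregman S.o)
      (fun x hx => le_trans (by positivity) (S.half_sq_le_bregman hx))
      (fun s => stepW S.D S.G m s • S.wNoise p s) hw' t
    have hsq : ∑ j ∈ Finset.Icc 1 t, ‖stepW S.D S.G m j • S.wNoise p j‖ ^ 2 / 2
        ≤ 2 * S.D ^ 2 * (4 * (S.D ^ 2 * S.G ^ 2 * Q)) := by
      rw [hQ, Finset.mul_sum, Finset.mul_sum, Finset.mul_sum]
      refine Finset.sum_le_sum fun j hj => ?_
      have := norm_wNoise_le h hb (hmem hj)
      rw [norm_smul, mul_pow, Real.norm_eq_abs, sq_abs]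
      calc _ ≤ stepW S.D S.G m j ^ 2 * (2 * S.G) ^ 2 / 2 := by gcongr
        _ = _ := by rw [hsW]; ring
    have e : ∑ j ∈ Finset.Icc 1 t, (stepW S.D S.G m j • S.wNoise p j) (S.ghostW p j - w')
        = 2 * S.D ^ 2 * ∑ j ∈ Finset.Icc 1 t, η j * S.wNoise p j (S.ghostW p j - w') := by
      rw [Finset.mul_sum]
      exact Finset.sum_congr rfl fun j _ => by rw [smul_apply, smul_eq_mul, hsW]; ring
    change ∑ j ∈ Finset.Icc 1 t, (stepW S.D S.G m j • S.wNoise p j) (S.ghostW p j - w') ≤ _ at hreg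
    rw [e] at hreg
    have hbw := S.bregman_le w' hw'
    have : 0 < 2 * S.D ^ 2 := by positivity
    refine le_of_mul_le_mul_left ?_ this
    linarith
  -- the regret in `q`
  have r3 : ∑ j ∈ Finset.Icc 1 t, η j * ∑ i, (q' i - p.q j i) * S.lossDiff p j i
      ≤ 1 / 2 + Real.log m * Q := by
    have hreg := softmax_regret (t := t) (a := fun s => stepQ S.D S.G m s • S.lossDiff p s)
      (c := fun s => stepQ S.D S.G m s)
      (fun j _ _ => by rw [hsQ]; exact mul_nonneg (by positivity) (hη0 j))
      (fun j hj _ i => by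
        have h0 : 0 ≤ stepQ S.D S.G m j := by
          rw [hsQ]; exact mul_nonneg (by positivity) (hη0 j)
        rw [Pi.smul_apply, smul_eq_mul, abs_mul, abs_of_nonneg h0]
        exact mul_le_of_le_one_right h0 (abs_lossDiff_le h hb hj i)) hq'
    have e : ∑ j ∈ Finset.Icc 1 t, ∑ i, (q' i - softmax
          (∑ s ∈ Finset.Ico 1 j, stepQ S.D S.G m s • S.lossDiff p s) i)
          * (stepQ S.D S.G m j • S.lossDiff p j) i
        = 2 * Real.log m * ∑ j ∈ Finset.Icc 1 t, η j * ∑ i, (q' i - p.q j i) * S.lossDiff p j i := by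
      rw [Finset.mul_sum]
      refine Finset.sum_congr rfl fun j hj => ?_
      rw [← h.q_eq (hmem hj), Finset.mul_sum, Finset.mul_sum]
      refine Finset.sum_congr rfl fun i _ => ?_
      rw [Pi.smul_apply, smul_eq_mul, hsQ]; ring
    have e2 : ∑ j ∈ Finset.Icc 1 t, stepQ S.D S.G m j ^ 2 / 2
        = 2 * Real.log m * (Real.log m * Q) := by
      rw [hQ, Finset.mul_sum, Finset.mul_sum]
      exact Finset.sum_congr rfl fun j _ => by rw [hsQ]; ring
    rw [e, e2] at hreg
    refine le_of_mul_le_mul_left ?_ (show 0 < 2 * Real.log m by positivity)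
    linarith
  -- the regret of the ghost iterates in `q`
  have r4 : ∑ j ∈ Finset.Icc 1 t, η j * ∑ i, (q' i - S.ghostQ p j i) * S.qNoise p j i
      ≤ 1 / 2 + 4 * (Real.log m * Q) := by
    have hreg := softmax_regret (t := t) (a := fun s => stepQ S.D S.G m s • S.qNoise p s)
      (c := fun s => stepQ S.D S.G m s * 2)
      (fun j _ _ => by rw [hsQ]; exact mul_nonneg (mul_nonneg (by positivity) (hη0 j)) (by norm_num))
      (fun j hj _ i => by
        have h0 : 0 ≤ stepQ S.D S.G m j := by
          rw [hsQ]; exact mul_nonneg (by positivity) (hη0 j)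
        rw [Pi.smul_apply, smul_eq_mul, abs_mul, abs_of_nonneg h0]
        exact mul_le_mul_of_nonneg_left (abs_qNoise_le h hb hj i) h0) hq'
    have e : ∑ j ∈ Finset.Icc 1 t, ∑ i, (q' i - softmax
          (∑ s ∈ Finset.Ico 1 j, stepQ S.D S.G m s • S.qNoise p s) i)
          * (stepQ S.D S.G m j • S.qNoise p j) i
        = 2 * Real.log m *
          ∑ j ∈ Finset.Icc 1 t, η j * ∑ i, (q' i - S.ghostQ p j i) * S.qNoise p j i := by
      rw [Finset.mul_sum]
      refine Finset.sum_congr rfl fun j hj => ?_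
      rw [Finset.mul_sum, Finset.mul_sum]
      refine Finset.sum_congr rfl fun i _ => ?_
      rw [Pi.smul_apply, smul_eq_mul, hsQ, ghostQ]; ring
    have e2 : ∑ j ∈ Finset.Icc 1 t, (stepQ S.D S.G m j * 2) ^ 2 / 2
        = 2 * Real.log m * (4 * (Real.log m * Q)) := by
      rw [hQ, Finset.mul_sum, Finset.mul_sum, Finset.mul_sum]
      exact Finset.sum_congr rfl fun j _ => by rw [hsQ]; ring
    rw [e, e2] at hreg
    refine le_of_mul_le_mul_left ?_ (show 0 < 2 * Real.log m by positivity)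
    linarith
  -- The ghost iterates are inserted here: each noise term splits into a martingale difference,
  -- collected in `gapNoise`, and a ghost regret against the comparator.
  have hround : ∀ j ∈ Finset.Icc 1 t,
      invSqrt j * (saddle S.P S.ℓ S.W (p.w j) q' - saddle S.P S.ℓ S.W w' (p.q j))
        ≤ L * (η j * S.stochGrad p j (p.w j - w') + η j * S.wNoise p j (S.ghostW p j - w')
          + η j * ∑ i, (q' i - p.q j i) * S.lossDiff p j i
          + η j * ∑ i, (q' i - S.ghostQ p j i) * S.qNoise p j i + S.gapNoise p j)
          + invSqrt j * B j := by
    intro j hj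
    refine (mul_le_mul_of_nonneg_left (saddle_sub_le h (hmem hj) (hB j hj) hw' hq')
      (invSqrt_nonneg j)).trans (le_of_eq ?_)
    have e1 : S.wNoise p j (p.w j - w')
        = S.wNoise p j (p.w j - S.ghostW p j) + S.wNoise p j (S.ghostW p j - w') := by
      rw [← map_add, sub_add_sub_cancel]
    have e2 : ∑ i, (q' i - p.q j i) * S.qNoise p j i
        = ∑ i, (S.ghostQ p j i - p.q j i) * S.qNoise p j i
          + ∑ i, (q' i - S.ghostQ p j i) * S.qNoise p j i := by
      rw [← Finset.sum_add_distrib]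
      exact Finset.sum_congr rfl fun i _ => by ring
    have e3 : invSqrt j = L * η j := by rw [hη]; field_simp
    have e4 : S.gapNoise p j = η j * (S.wNoise p j (p.w j - S.ghostW p j)
      + ∑ i, (S.ghostQ p j i - p.q j i) * S.qNoise p j i) := rfl
    rw [e1, e2, e4, e3]
    ring
  refine (Finset.sum_le_sum hround).trans ?_
  rw [Finset.sum_add_distrib, ← Finset.mul_sum]
  simp only [Finset.sum_add_distrib]
  refine add_le_add (mul_le_mul_of_nonneg_left (add_le_add ?_ le_rfl) hL.le) le_rfl
  -- The noise is bounded by twice the bound on the gradients, so each ghost regret has a quadratic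
  -- term four times as large: `1 + 4 = 5` in both variables. The four initial terms `1 / 2` make up
  -- the constant 2.
  have : 5 * (S.D ^ 2 * S.G ^ 2 * Q) + 5 * (Real.log m * Q) = 5 / 2 * (L ^ 2 * Q) := by
    rw [hLsq]; ring
  linarith

end MinimaxProblem

/-! ### Variables centered given the past. -/

/-- `X` is integrable and orthogonal to the bounded `𝓖`-measurable functions. -/
structure IsCentered {Ω : Type*} (𝓖 : MeasurableSpace Ω) {mΩ : MeasurableSpace Ω} (μ : Measure Ω)
    (X : Ω → ℝ) : Prop where
  integrable : Integrable X μ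
  orth : ∀ Z : Ω → ℝ, Measurable[𝓖] Z → ∀ K : ℝ, (∀ᵐ ω ∂μ, |Z ω| ≤ K) → ∫ ω, Z ω * X ω ∂μ = 0

namespace IsCentered

variable {Ω : Type*} {𝓖 mΩ : MeasurableSpace Ω} {μ : Measure Ω} {X Y : Ω → ℝ}

theorem integrable_mul (h𝓖 : 𝓖 ≤ mΩ) (hX : IsCentered 𝓖 μ X) {Z : Ω → ℝ} (hZ : Measurable[𝓖] Z)
    {K : ℝ} (hK : ∀ᵐ ω ∂μ, |Z ω| ≤ K) : Integrable (fun ω => Z ω * X ω) μ :=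
  hX.integrable.bdd_mul (hZ.mono h𝓖 le_rfl).aestronglyMeasurable hK

theorem add (h𝓖 : 𝓖 ≤ mΩ) (hX : IsCentered 𝓖 μ X) (hY : IsCentered 𝓖 μ Y) :
    IsCentered 𝓖 μ (fun ω => X ω + Y ω) :=
  ⟨hX.integrable.add hY.integrable, fun Z hZ K hK => by
    simp only [mul_add]
    rw [integral_add (hX.integrable_mul h𝓖 hZ hK) (hY.integrable_mul h𝓖 hZ hK),
      hX.orth Z hZ K hK, hY.orth Z hZ K hK, add_zero]⟩

theorem sum (h𝓖 : 𝓖 ≤ mΩ) {ι : Type*} {s : Finset ι} {X : ι → Ω → ℝ}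
    (hX : ∀ i ∈ s, IsCentered 𝓖 μ (X i)) : IsCentered 𝓖 μ (fun ω => ∑ i ∈ s, X i ω) :=
  ⟨integrable_finsetSum _ fun i hi => (hX i hi).integrable, fun Z hZ K hK => by
    simp only [Finset.mul_sum]
    rw [integral_finsetSum _ fun i hi => (hX i hi).integrable_mul h𝓖 hZ hK]
    exact Finset.sum_eq_zero fun i hi => (hX i hi).orth Z hZ K hK⟩

theorem mul_left (h𝓖 : 𝓖 ≤ mΩ) (hX : IsCentered 𝓖 μ X) {A : Ω → ℝ} (hA : Measurable[𝓖] A)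
    {C : ℝ} (hC : ∀ᵐ ω ∂μ, |A ω| ≤ C) : IsCentered 𝓖 μ (fun ω => A ω * X ω) :=
  ⟨hX.integrable_mul h𝓖 hA hC, fun Z hZ K hK => by
    have hb : ∀ᵐ ω ∂μ, |Z ω * A ω| ≤ K * C := by
      filter_upwards [hC, hK] with ω h1 h2
      rw [abs_mul]
      exact mul_le_mul h2 h1 (abs_nonneg _) ((abs_nonneg _).trans h2)
    simpa only [mul_assoc] using hX.orth (fun ω => Z ω * A ω) (hZ.mul hA) _ hb⟩

theorem const_mul (h𝓖 : 𝓖 ≤ mΩ) (hX : IsCentered 𝓖 μ X) (c : ℝ) :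
    IsCentered 𝓖 μ (fun ω => c * X ω) :=
  hX.mul_left h𝓖 measurable_const (C := |c|) (by simp)

/-- Here `𝓖` stands for the past, `Y` for points chosen from it and `ζ` for a fresh sample. The
order expected minus sampled matches the sign of the noise terms. -/
theorem freeze [IsProbabilityMeasure μ] {A B : Type*} [MeasurableSpace A] [MeasurableSpace B]
    (h𝓖 : 𝓖 ≤ mΩ) {Y : Ω → A} {ζ : Ω → B} (hY : Measurable[𝓖] Y) (hζ : Measurable ζ)
    (hind : Indep 𝓖 (MeasurableSpace.comap ζ inferInstance) μ) {P : Measure B}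
    (hP : μ.map ζ = P) {h : A → B → ℝ} (hh : Measurable (Function.uncurry h)) {C : ℝ}
    (hC : ∀ᵐ ω ∂μ, |h (Y ω) (ζ ω)| ≤ C) :
    IsCentered 𝓖 μ (fun ω => (∫ b, h (Y ω) b ∂P) - h (Y ω) (ζ ω)) := by
  have hYm := hY.mono h𝓖 le_rfl
  have hf := integral_freeze hYm hζ
    ((IndepFun_iff_Indep _ _ _).2 (indep_of_indep_of_le_left hind hY.comap_le)) hP hh hC
  refine ⟨hf.1.sub (integrable_of_abs_le (hh.comp (hYm.prodMk hζ)) hC), fun Z hZ K hK => ?_⟩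
  have := integral_mul_centered_eq_zero h𝓖 hY hζ hind hP hh hC hZ hK
  rw [← neg_eq_zero, ← integral_neg]
  simpa only [← mul_neg, neg_sub] using this

end IsCentered

/-! ### Adaptedness of the iterates and the martingale property of the noise. -/

namespace MinimaxProblem

section Past

variable {E Z Ω : Type*} [MeasurableSpace Z] {m : ℕ}

/-- The `σ`-algebra generated by the samples of the rounds before `t`. -/
abbrev past (p : Ω → SampledRun E Z m) (t : ℕ) : MeasurableSpace Ω :=
  ⨆ s ∈ Set.Iio t, MeasurableSpace.comap (fun ω => (p ω).z s) inferInstance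

variable {p : Ω → SampledRun E Z m}

theorem measurable_z_past {s t : ℕ} (hst : s < t) (i : Fin m) :
    Measurable[past p t] fun ω => (p ω).z s i :=
  (measurable_pi_apply i).comp ((comap_measurable fun ω => (p ω).z s).mono
    (le_iSup₂_of_le s hst le_rfl) le_rfl)

theorem past_mono : Monotone (past p) := fun _ _ h =>
  iSup₂_le fun s hs => le_iSup₂_of_le s (lt_of_lt_of_le hs h) le_rfl

end Past

variable {E Z : Type*} [NormedAddCommGroup E] [NormedSpace ℝ E] [MeasurableSpace E]
  [MeasurableSpace Z] {m : ℕ} {S : MinimaxProblem E Z m}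
  {Ω : Type*}

section Measurability

variable {mΩ : MeasurableSpace Ω} {X : Ω → E} {ζ : Ω → Z}

theorem measurable_loss_comp (hX : Measurable X) (hmem : ∀ ω, X ω ∈ S.W) (hζ : Measurable ζ) :
    Measurable fun ω => S.ℓ (X ω) (ζ ω) :=
  (S.loss ⟨0, by have := S.two_le; omega⟩).measurable.comp
    ((hX.subtype_mk (h := hmem)).prodMk hζ)

theorem measurable_grad_comp (hX : Measurable X) (hmem : ∀ ω, X ω ∈ S.W) (hζ : Measurable ζ) :
    Measurable fun ω => S.dℓ (X ω) (ζ ω) :=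
  (S.loss ⟨0, by have := S.two_le; omega⟩).measurable_grad.comp
    ((hX.subtype_mk (h := hmem)).prodMk hζ)

theorem measurable_risk_comp [BorelSpace E] (hX : Measurable X) (hmem : ∀ ω, X ω ∈ S.W) (i : Fin m) :
    Measurable fun ω => risk (S.P i) S.ℓ (X ω) :=
  (S.loss i).continuousOn_risk.measurable_comp_of_mem hX hmem

theorem measurable_gradRisk_comp [FiniteDimensional ℝ E] (hX : Measurable X) (hmem : ∀ ω, X ω ∈ S.W) (i : Fin m) :
    Measurable fun ω => gradRisk (S.P i) S.dℓ (X ω) :=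
  (S.loss i).measurable_gradRisk.comp (hX.subtype_mk (h := hmem))

end Measurability

/-- A random run of the algorithm for `S`, with independent rounds of samples. -/
structure IsRandomRun {mΩ : MeasurableSpace Ω} (S : MinimaxProblem E Z m) (μ : Measure Ω)
    (p : Ω → SampledRun E Z m) : Prop where
  isRun : ∀ ω, S.IsRun (p ω)
  measurable_z : ∀ t i, Measurable fun ω => (p ω).z t i
  map_z : ∀ t i, μ.map (fun ω => (p ω).z t i) = S.P i
  iIndepFun : iIndepFun (fun t ω => (p ω).z t) μ

namespace IsRandomRun

variable {mΩ : MeasurableSpace Ω} {μ : Measure Ω} {p : Ω → SampledRun E Z m}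

theorem measurable_z_pi (h : IsRandomRun S μ p) (t : ℕ) : Measurable fun ω => (p ω).z t :=
  measurable_pi_iff.2 fun i => h.measurable_z t i

theorem past_le (h : IsRandomRun S μ p) (t : ℕ) : past p t ≤ mΩ :=
  iSup₂_le fun s _ => (h.measurable_z_pi s).comap_le

/-- Independence is assumed across rounds only. Samples within a round may be dependent, so each
single sample is separated from the past and sums over `i` are centered term by term. -/
theorem indep_past (h : IsRandomRun S μ p) (t : ℕ) (i : Fin m) :
    Indep (past p t) (MeasurableSpace.comap (fun ω => (p ω).z t i) inferInstance) μ := by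
  have h1 := indep_iSup_of_disjoint (fun s => (h.measurable_z_pi s).comap_le) h.iIndepFun
    (S := Set.Iio t) (T := {t}) (by simp)
  refine indep_of_indep_of_le_right h1 ?_
  refine le_trans ?_ (le_iSup₂_of_le t (Set.mem_singleton t) le_rfl)
  exact ((measurable_pi_apply i).comp (comap_measurable fun ω => (p ω).z t)).comap_le

theorem ae_isTypical (h : IsRandomRun S μ p) : ∀ᵐ ω ∂μ, S.IsTypical (p ω) := by
  unfold IsTypical
  rw [ae_all_iff]; intro j
  rw [ae_all_iff]; intro i
  have h1 : ∀ᵐ z ∂(S.P i), ∀ v ∈ S.W, ‖S.dℓ v z‖ ≤ S.G ∧ 0 ≤ S.ℓ v z ∧ S.ℓ v z ≤ 1 := by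
    filter_upwards [(S.loss i).norm_grad_le, (S.loss i).mem_Icc] with z h1 h2 v hv
    exact ⟨h1 v hv, h2 v hv⟩
  rw [← h.map_z j i] at h1
  exact ae_of_ae_map (h.measurable_z j i).aemeasurable h1

/-- Errors of loss differences at points that are known from the past are centered. -/
theorem isCentered_loss [IsProbabilityMeasure μ] (h : IsRandomRun S μ p) {j : ℕ} {x y : Ω → E}
    (hx : Measurable[past p j] x) (hxW : ∀ ω, x ω ∈ S.W) (hy : Measurable[past p j] y)
    (hyW : ∀ ω, y ω ∈ S.W) (i : Fin m) :
    IsCentered (past p j) μ fun ω => risk (S.P i) S.ℓ (x ω) - risk (S.P i) S.ℓ (y ω)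
      - (S.ℓ (x ω) ((p ω).z j i) - S.ℓ (y ω) ((p ω).z j i)) := by
  have hY : Measurable[past p j] fun ω => ((⟨x ω, hxW ω⟩ : S.W), (⟨y ω, hyW ω⟩ : S.W)) :=
    (hx.subtype_mk (h := hxW)).prodMk (hy.subtype_mk (h := hyW))
  have hh : Measurable (Function.uncurry fun (a : S.W × S.W) (b : Z) => S.ℓ a.1 b - S.ℓ a.2 b) :=
    ((S.loss i).measurable.comp
        ((measurable_fst.comp measurable_fst).prodMk measurable_snd)).sub
      ((S.loss i).measurable.comp
        ((measurable_snd.comp measurable_fst).prodMk measurable_snd))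
  have hC : ∀ᵐ ω ∂μ, |S.ℓ (x ω) ((p ω).z j i) - S.ℓ (y ω) ((p ω).z j i)| ≤ 1 := by
    filter_upwards [h.ae_isTypical] with ω hω
    have h1 := (hω j i _ (hxW ω)).2
    have h2 := (hω j i _ (hyW ω)).2
    rw [abs_le]
    constructor <;> linarith [h1.1, h1.2, h2.1, h2.2]
  have key := IsCentered.freeze (h.past_le j) hY (h.measurable_z j i) (h.indep_past j i)
    (h.map_z j i) hh hC
  have e : (fun ω => risk (S.P i) S.ℓ (x ω) - risk (S.P i) S.ℓ (y ω)
      - (S.ℓ (x ω) ((p ω).z j i) - S.ℓ (y ω) ((p ω).z j i)))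
      = fun ω => (∫ b, (S.ℓ (x ω) b - S.ℓ (y ω) b) ∂(S.P i))
        - (S.ℓ (x ω) ((p ω).z j i) - S.ℓ (y ω) ((p ω).z j i)) := funext fun ω => by
    rw [integral_sub ((S.loss i).integrable_loss (hxW ω)) ((S.loss i).integrable_loss (hyW ω))]
    rfl
  rw [e]
  exact key

end IsRandomRun

variable [FiniteDimensional ℝ E] [BorelSpace E]

section Measurability

variable {mΩ : MeasurableSpace Ω} {p : Ω → SampledRun E Z m} {j t : ℕ}

theorem measurable_weightedAvg {F : Type*} [NormedAddCommGroup F] [NormedSpace ℝ F]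
    [MeasurableSpace F] [BorelSpace F] [SecondCountableTopology F] {x : ℕ → Ω → F} {η : ℕ → ℝ}
    (hx : ∀ s, 1 ≤ s → s ≤ t → Measurable (x s)) :
    Measurable fun ω => weightedAvg η (fun s => x s ω) t :=
  Finset.measurable_fun_sum _ fun s hs =>
    (hx s (Finset.mem_Icc.1 hs).1 (Finset.mem_Icc.1 hs).2).const_smul _

/-- The `σ`-algebra here and in the following lemmas is arbitrary, subject to measurability of the
samples involved. Taking `past p t` gives adaptedness; taking the ambient one gives the
measurability behind integrability. -/
theorem measurable_u (hp : ∀ ω, S.IsRun (p ω)) (ht : 1 ≤ t)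
    (hz : ∀ s < t, ∀ i, Measurable fun ω => (p ω).z s i) (i : Fin m) :
    Measurable fun ω => (p ω).u t i := by
  induction t, ht using Nat.le_induction with
  | base =>
    have : (fun ω => (p ω).u 1 i) = fun _ => S.o :=
      funext fun ω => S.eq_of_isArgmin ((hp ω).isArgmin_u i) S.isArgmin
    rw [this]
    exact measurable_const
  | succ n hn ih =>
    have hu := ih fun s hs => hz s (by omega)
    exact S.dgf.measurable_mirrorStep
      (S.measurable_grad_comp hu (fun ω => (hp ω).u_mem hn i) (hz n (by omega) i)) hu
      (fun ω => (hp ω).u_mem hn i)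
      (fun ω => S.differentiableWithinAt_of_mirrorDescent (x := fun t => (p ω).u t i)
        ((hp ω).isArgmin_u i) (fun s hs => (hp ω).step_u' hs i) hn)
      (fun ω => (hp ω).step_u' hn i)

theorem measurable_avgU (hp : ∀ ω, S.IsRun (p ω))
    (hz : ∀ s < t, ∀ i, Measurable fun ω => (p ω).z s i) (i : Fin m) :
    Measurable fun ω => avgU (p ω) t i :=
  measurable_weightedAvg fun s h1 h2 =>
    measurable_u hp h1 (fun r hr => hz r (by omega)) i

theorem measurable_lossDiff (hp : ∀ ω, S.IsRun (p ω)) (hj : 1 ≤ j)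
    (hz : ∀ s ≤ j, ∀ i, Measurable fun ω => (p ω).z s i)
    (hw : Measurable fun ω => (p ω).w j) : Measurable fun ω => S.lossDiff (p ω) j :=
  measurable_pi_iff.2 fun i =>
    (S.measurable_loss_comp hw (fun ω => (hp ω).w_mem hj) (hz j le_rfl i)).sub
      (S.measurable_loss_comp (measurable_avgU hp (fun s hs => hz s hs.le) i)
        (fun ω => (hp ω).avgU_mem hj i) (hz j le_rfl i))

/-- By the closed form, `q` at time `t` depends only on strictly earlier `w`. Isolating this
dependence breaks the mutual recursion of `w` and `q`. -/
theorem measurable_q_of_w (hp : ∀ ω, S.IsRun (p ω)) (ht : 1 ≤ t)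
    (hz : ∀ s < t, ∀ i, Measurable fun ω => (p ω).z s i)
    (hw : ∀ s, 1 ≤ s → s < t → Measurable fun ω => (p ω).w s) :
    Measurable fun ω => (p ω).q t := by
  have := S.neZero
  have e : (fun ω => (p ω).q t) = fun ω =>
      softmax (∑ s ∈ Finset.Ico 1 t, stepQ S.D S.G m s • S.lossDiff (p ω) s) :=
    funext fun ω => (hp ω).q_eq ht
  rw [e]
  refine continuous_softmax.measurable.comp (Finset.measurable_fun_sum _ fun s hs => ?_)
  have hs := Finset.mem_Ico.1 hs
  exact (measurable_lossDiff hp hs.1 (fun r hr => hz r (by omega))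
    (hw s hs.1 hs.2)).const_smul (stepQ S.D S.G m s)

theorem measurable_w (hp : ∀ ω, S.IsRun (p ω)) (ht : 1 ≤ t)
    (hz : ∀ s < t, ∀ i, Measurable fun ω => (p ω).z s i) : Measurable fun ω => (p ω).w t := by
  -- Strong induction, because `q n` in the step from `n` involves all `w s` with `s < n`.
  induction t using Nat.strong_induction_on with
  | _ t ih =>
  rcases Nat.lt_or_ge 1 t with h | h
  · obtain ⟨n, rfl⟩ : ∃ n, t = n + 1 := ⟨t - 1, by omega⟩
    have hn : 1 ≤ n := by omega
    have hw : ∀ s, 1 ≤ s → s ≤ n → Measurable fun ω => (p ω).w s := fun s h1 h2 =>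
      ih s (by omega) h1 fun r hr => hz r (by omega)
    have hq := measurable_q_of_w hp hn (fun s hs => hz s (by omega)) fun s h1 h2 => hw s h1 h2.le
    have hg : Measurable fun ω => S.stochGrad (p ω) n :=
      Finset.measurable_fun_sum _ fun i _ => (measurable_pi_iff.1 hq i).smul
        (S.measurable_grad_comp (hw n hn le_rfl) (fun ω => (hp ω).w_mem hn) (hz n (by omega) i))
    exact S.dgf.measurable_mirrorStep hg (hw n hn le_rfl) (fun ω => (hp ω).w_mem hn)
      (fun ω => S.differentiableWithinAt_of_mirrorDescent (hp ω).init_w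
        (fun s hs => (hp ω).step_w' hs) hn)
      (fun ω => (hp ω).step_w' hn)
  · obtain rfl : t = 1 := by omega
    have : (fun ω => (p ω).w 1) = fun _ => S.o :=
      funext fun ω => S.eq_of_isArgmin (hp ω).init_w S.isArgmin
    rw [this]
    exact measurable_const

theorem measurable_q (hp : ∀ ω, S.IsRun (p ω)) (ht : 1 ≤ t)
    (hz : ∀ s < t, ∀ i, Measurable fun ω => (p ω).z s i) : Measurable fun ω => (p ω).q t :=
  measurable_q_of_w hp ht hz fun _ h1 h2 => measurable_w hp h1 fun r hr => hz r (by omega)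

theorem measurable_wNoise (hp : ∀ ω, S.IsRun (p ω)) (hj : 1 ≤ j)
    (hz : ∀ s ≤ j, ∀ i, Measurable fun ω => (p ω).z s i) :
    Measurable fun ω => S.wNoise (p ω) j := by
  have hw := measurable_w hp hj fun s hs => hz s hs.le
  have hq := measurable_q hp hj fun s hs => hz s hs.le
  exact Finset.measurable_fun_sum _ fun i _ => (measurable_pi_iff.1 hq i).smul
    ((S.measurable_gradRisk_comp hw (fun ω => (hp ω).w_mem hj) i).sub
      (S.measurable_grad_comp hw (fun ω => (hp ω).w_mem hj) (hz j le_rfl i)))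

theorem measurable_qNoise (hp : ∀ ω, S.IsRun (p ω)) (hj : 1 ≤ j)
    (hz : ∀ s ≤ j, ∀ i, Measurable fun ω => (p ω).z s i) :
    Measurable fun ω => S.qNoise (p ω) j := by
  have hw := measurable_w hp hj fun s hs => hz s hs.le
  refine measurable_pi_iff.2 fun i => ?_
  exact ((S.measurable_risk_comp hw (fun ω => (hp ω).w_mem hj) i).sub
    (S.measurable_risk_comp (measurable_avgU hp (fun s hs => hz s hs.le) i)
      (fun ω => (hp ω).avgU_mem hj i) i)).sub
    (measurable_pi_iff.1 (measurable_lossDiff hp hj hz hw) i)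

theorem measurable_ghostW (hp : ∀ ω, S.IsRun (p ω))
    (hz : ∀ s < t, ∀ i, Measurable fun ω => (p ω).z s i) :
    Measurable fun ω => S.ghostW (p ω) t := by
  refine (continuous_dualArgmin (S.dgf.strongConvexOn_bregman S.o) S.isCompact S.nonempty
    (S.dgf.continuousOn_bregman S.o)).measurable.comp (Finset.measurable_fun_sum _ fun s hs => ?_)
  have hs := Finset.mem_Ico.1 hs
  exact (measurable_wNoise hp hs.1 fun r hr => hz r (by omega)).const_smul (stepW S.D S.G m s)

theorem measurable_ghostQ (hp : ∀ ω, S.IsRun (p ω))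
    (hz : ∀ s < t, ∀ i, Measurable fun ω => (p ω).z s i) :
    Measurable fun ω => S.ghostQ (p ω) t := by
  have := S.neZero
  refine continuous_softmax.measurable.comp (Finset.measurable_fun_sum _ fun s hs => ?_)
  have hs := Finset.mem_Ico.1 hs
  exact (measurable_qNoise hp hs.1 fun r hr => hz r (by omega)).const_smul (stepQ S.D S.G m s)

theorem measurable_gapNoise (hp : ∀ ω, S.IsRun (p ω)) (hj : 1 ≤ j)
    (hz : ∀ s ≤ j, ∀ i, Measurable fun ω => (p ω).z s i) :
    Measurable fun ω => S.gapNoise (p ω) j := by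
  have hz' : ∀ s < j, ∀ i, Measurable fun ω => (p ω).z s i := fun s hs => hz s hs.le
  have hv : Measurable fun ω => (p ω).w j - S.ghostW (p ω) j :=
    (measurable_w hp hj hz').sub (measurable_ghostW hp hz')
  have h1 : Measurable fun ω => S.wNoise (p ω) j ((p ω).w j - S.ghostW (p ω) j) :=
    isBoundedBilinearMap_apply.continuous.measurable2 (measurable_wNoise hp hj hz) hv
  refine (h1.add (Finset.measurable_fun_sum _ fun i _ => ?_)).const_mul _
  exact ((measurable_pi_iff.1 (measurable_ghostQ hp hz') i).sub
    (measurable_pi_iff.1 (measurable_q hp hj hz') i)).mul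
    (measurable_pi_iff.1 (measurable_qNoise hp hj hz) i)

theorem measurable_auxNoise (hp : ∀ ω, S.IsRun (p ω)) (hj : 1 ≤ j)
    (hz : ∀ s ≤ j, ∀ i, Measurable fun ω => (p ω).z s i) (v : E) (i : Fin m) :
    Measurable fun ω => S.auxNoise v i (p ω) j := by
  have hu := measurable_u hp hj (fun s hs => hz s hs.le) i
  have hmem : ∀ ω, (p ω).u j i ∈ S.W := fun ω => (hp ω).u_mem hj i
  have h1 : Measurable fun ω => (gradRisk (S.P i) S.dℓ ((p ω).u j i)
      - S.dℓ ((p ω).u j i) ((p ω).z j i)) ((p ω).u j i - v) :=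
    isBoundedBilinearMap_apply.continuous.measurable2
      ((S.measurable_gradRisk_comp hu hmem i).sub
        (S.measurable_grad_comp hu hmem (hz j le_rfl i))) (hu.sub measurable_const)
  exact h1.const_mul _

end Measurability

namespace IsRandomRun

variable {mΩ : MeasurableSpace Ω} {μ : Measure Ω} {p : Ω → SampledRun E Z m}

variable [IsProbabilityMeasure μ]

/-- Gradient errors in directions that are known from the past are centered. -/
theorem isCentered_grad (h : IsRandomRun S μ p) {j : ℕ} {x y : Ω → E}
    (hx : Measurable[past p j] x) (hxW : ∀ ω, x ω ∈ S.W) (hy : Measurable[past p j] y)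
    (hyW : ∀ ω, y ω ∈ S.W) (i : Fin m) :
    IsCentered (past p j) μ fun ω =>
      (gradRisk (S.P i) S.dℓ (x ω) - S.dℓ (x ω) ((p ω).z j i)) (x ω - y ω) := by
  have hY : Measurable[past p j] fun ω => ((⟨x ω, hxW ω⟩ : S.W), y ω) :=
    (hx.subtype_mk (h := hxW)).prodMk hy
  have hh : Measurable (Function.uncurry fun (a : S.W × E) (b : Z) => S.dℓ a.1 b (a.1 - a.2)) :=
    isBoundedBilinearMap_apply.continuous.measurable2
      ((S.loss i).measurable_grad.comp
        ((measurable_fst.comp measurable_fst).prodMk measurable_snd))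
      ((measurable_subtype_coe.comp (measurable_fst.comp measurable_fst)).sub
        (measurable_snd.comp measurable_fst))
  have hC : ∀ᵐ ω ∂μ, |S.dℓ (x ω) ((p ω).z j i) (x ω - y ω)| ≤ S.G * (2 * √2 * S.D) := by
    filter_upwards [h.ae_isTypical] with ω hω
    exact S.abs_apply_sub_le (hω j i _ (hxW ω)).1 (hxW ω) (hyW ω)
  have key := IsCentered.freeze (h.past_le j) hY (h.measurable_z j i) (h.indep_past j i)
    (h.map_z j i) hh hC
  have e : (fun ω => (gradRisk (S.P i) S.dℓ (x ω) - S.dℓ (x ω) ((p ω).z j i)) (x ω - y ω))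
      = fun ω => (∫ b, S.dℓ (x ω) b (x ω - y ω) ∂(S.P i))
        - S.dℓ (x ω) ((p ω).z j i) (x ω - y ω) := funext fun ω => by
    rw [sub_apply, (S.loss i).gradRisk_apply (hxW ω)]
  rw [e]
  exact key

/-- The comparator `v` is deterministic, so the direction `u_j - v` is already known from the past
without any ghost iterate. -/
theorem auxNoise_isBoundedMartingaleDiff (h : IsRandomRun S μ p) {v : E} (hv : v ∈ S.W)
    (i : Fin m) : IsBoundedMartingaleDiff μ (past p) (fun j ω => S.auxNoise v i (p ω) j)
      (fun j => 4 * √2 * S.D ^ 2 * invSqrt j) where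
  mono := past_mono
  le := h.past_le
  meas j hj := measurable_auxNoise h.isRun hj
    (fun s hs => measurable_z_past (Nat.lt_succ_of_le hs)) v i
  pos j hj := by
    have := S.D_pos
    have := invSqrt_pos hj
    positivity
  bound j hj := by
    filter_upwards [h.ae_isTypical] with ω hω
    exact abs_auxNoise_le (h.isRun ω) hω hv i hj
  orth j hj := by
    have hc := h.isCentered_grad (j := j)
      (measurable_u h.isRun hj (fun s hs => measurable_z_past hs) i)
      (fun ω => (h.isRun ω).u_mem hj i) (y := fun _ => v) measurable_const (fun _ => hv) i
    exact (hc.const_mul (h.past_le j) (stepI S.D S.G j)).orth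

theorem gapNoise_isBoundedMartingaleDiff (h : IsRandomRun S μ p) :
    IsBoundedMartingaleDiff μ (past p) (fun j ω => S.gapNoise (p ω) j)
      (fun j => 4 * √2 * invSqrt j) where
  mono := past_mono
  le := h.past_le
  meas j hj := measurable_gapNoise h.isRun hj
    (fun s hs => measurable_z_past (Nat.lt_succ_of_le hs))
  pos j hj := by
    have := invSqrt_pos hj
    positivity
  bound j hj := by
    filter_upwards [h.ae_isTypical] with ω hω
    exact abs_gapNoise_le (h.isRun ω) hω hj
  orth j hj := by
    have hz : ∀ s < j, ∀ i, Measurable[past p j] fun ω => (p ω).z s i :=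
      fun s hs => measurable_z_past hs
    have hle := h.past_le j
    have hw := measurable_w h.isRun hj hz
    have hq := measurable_q h.isRun hj hz
    have hwmem : ∀ ω, (p ω).w j ∈ S.W := fun ω => (h.isRun ω).w_mem hj
    have h01 : ∀ {q : Fin m → ℝ}, q ∈ stdSimplex ℝ (Fin m) → ∀ i, |q i| ≤ 1 := fun hq i => by
      rw [abs_of_nonneg (hq.1 i), ← hq.2]
      exact Finset.single_le_sum (fun k _ => hq.1 k) (Finset.mem_univ i)
    -- The weight `q_j`, the iterate and the ghost are all measurable with respect to the past of
    -- round `j`; the sample of that round enters through the gradient error alone.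
    have c1 : ∀ i ∈ Finset.univ, IsCentered (past p j) μ fun ω => (p ω).q j i *
        (gradRisk (S.P i) S.dℓ ((p ω).w j) - S.dℓ ((p ω).w j) ((p ω).z j i))
          ((p ω).w j - S.ghostW (p ω) j) := fun i _ =>
      (h.isCentered_grad hw hwmem (measurable_ghostW h.isRun hz)
        (fun ω => S.ghostW_mem (p ω) j) i).mul_left hle ((measurable_pi_apply i).comp hq) (C := 1)
        (Filter.Eventually.of_forall fun ω => h01 ((h.isRun ω).q_mem hj) i)
    have c2 : ∀ i ∈ Finset.univ, IsCentered (past p j) μ fun ω =>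
        (S.ghostQ (p ω) j i - (p ω).q j i) * S.qNoise (p ω) j i := fun i _ =>
      (h.isCentered_loss hw hwmem (measurable_avgU h.isRun hz i)
        (fun ω => (h.isRun ω).avgU_mem hj i) i).mul_left hle
        (((measurable_pi_apply i).comp (measurable_ghostQ h.isRun hz)).sub
          ((measurable_pi_apply i).comp hq)) (C := 1 + 1)
        (Filter.Eventually.of_forall fun ω => (abs_sub _ _).trans
          (add_le_add (h01 (S.ghostQ_mem (p ω) j) i) (h01 ((h.isRun ω).q_mem hj) i)))
    have key := ((IsCentered.sum hle c1).add hle (IsCentered.sum hle c2)).const_mul hle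
      (invSqrt j / gapScale S.D S.G m)
    have e : (fun ω => S.gapNoise (p ω) j) = fun ω => invSqrt j / gapScale S.D S.G m *
        (∑ i, (p ω).q j i * (gradRisk (S.P i) S.dℓ ((p ω).w j)
          - S.dℓ ((p ω).w j) ((p ω).z j i)) ((p ω).w j - S.ghostW (p ω) j)
        + ∑ i, (S.ghostQ (p ω) j i - (p ω).q j i) * S.qNoise (p ω) j i) := funext fun ω => by
      rw [gapNoise, wNoise, sum_apply]
      rfl
    have hkey : IsCentered (past p j) μ fun ω => S.gapNoise (p ω) j := by
      rw [e]; exact key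
    exact hkey.orth

end IsRandomRun

end MinimaxProblem

/-! ### Tail and maximal inequalities. -/

section Tail

/-- Applied with `κ = 1` to the gap martingale and `κ = D ^ 2` to the auxiliary ones. -/
theorem sum_sq_mul_invSqrt_le (κ : ℝ) (t : ℕ) :
    ∑ j ∈ Finset.Icc 1 t, (4 * √2 * κ * invSqrt j) ^ 2 ≤ 32 * κ ^ 2 * (1 + Real.log t) := by
  have e : ∑ j ∈ Finset.Icc 1 t, (4 * √2 * κ * invSqrt j) ^ 2
      = 32 * κ ^ 2 * ∑ j ∈ Finset.Icc 1 t, invSqrt j ^ 2 := by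
    rw [Finset.mul_sum]
    refine Finset.sum_congr rfl fun j _ => ?_
    rw [mul_pow, mul_pow, mul_pow, Real.sq_sqrt (by norm_num)]
    ring
  rw [e]
  exact mul_le_mul_of_nonneg_left (sum_invSqrt_sq_le t) (by positivity)

theorem tsum_one_div_sq_le : Summable (fun t : ℕ => 1 / ((t : ℝ) + 1) ^ 2) ∧
    ∑' t : ℕ, 1 / ((t : ℝ) + 1) ^ 2 ≤ 2 := by
  have h1 := (hasSum_nat_add_iff' (f := fun n : ℕ => 1 / (n : ℝ) ^ 2) 1).2 hasSum_zeta_two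
  simp only [Finset.range_one, Finset.sum_singleton, Nat.cast_zero, Nat.cast_add,
    Nat.cast_one] at h1
  refine ⟨h1.summable, ?_⟩
  rw [h1.tsum_eq]
  have h3 := Real.pi_lt_d2
  have h4 := Real.pi_pos
  norm_num
  nlinarith

variable {Ω : Type*} {mΩ : MeasurableSpace Ω} {μ : Measure Ω} [IsProbabilityMeasure μ]
  {𝓕 : ℕ → MeasurableSpace Ω}

/-- The Azuma-Hoeffding inequality for increments of order `1 / √j`. -/
theorem IsBoundedMartingaleDiff.measure_ge_sqrt_log_le {X : ℕ → Ω → ℝ} {c : ℕ → ℝ}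
    (h : IsBoundedMartingaleDiff μ 𝓕 X c) {κ : ℝ} (hκ : 0 < κ) {t : ℕ} (ht : 1 ≤ t)
    (hc : ∑ j ∈ Finset.Icc 1 t, c j ^ 2 ≤ 32 * κ ^ 2 * (1 + Real.log t)) {x : ℝ} (hx : 1 ≤ x) :
    μ.real {ω | 8 * κ * √((1 + Real.log t) * Real.log x) ≤ ∑ j ∈ Finset.Icc 1 t, X j ω}
      ≤ 1 / x := by
  have hl : 0 ≤ Real.log t := Real.log_nonneg (by exact_mod_cast ht)
  have hlx : 0 ≤ Real.log x := Real.log_nonneg hx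
  refine (h.measure_sum_ge_le hc (by positivity)).trans (le_of_eq ?_)
  have e : -(8 * κ * √((1 + Real.log t) * Real.log x)) ^ 2
      / (2 * (32 * κ ^ 2 * (1 + Real.log t))) = -Real.log x := by
    rw [mul_pow, Real.sq_sqrt (by positivity)]
    have : 1 + Real.log t ≠ 0 := by positivity
    field_simp
    ring
  rw [e, Real.exp_neg, Real.exp_log (by linarith), one_div]

/-- A maximal inequality in expectation for finitely many martingales. -/
theorem exists_integrable_dominating {m : ℕ} (hm : 2 ≤ m) {X : Fin m → ℕ → Ω → ℝ} {c : ℕ → ℝ}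
    (h : ∀ k, IsBoundedMartingaleDiff μ 𝓕 (X k) c) {t : ℕ} {V : ℝ} (hV : 0 < V)
    (hc : ∑ j ∈ Finset.Icc 1 t, c j ^ 2 ≤ V) :
    ∃ Y : Ω → ℝ, Integrable Y μ ∧ (∀ k ω, ∑ j ∈ Finset.Icc 1 t, X k j ω ≤ Y ω) ∧
      ∫ ω, Y ω ∂μ ≤ √(2 * V * Real.log m) := by
  have hlog : 0 < Real.log m := Real.log_pos (by exact_mod_cast hm)
  have hm0 : (0 : ℝ) < m := by positivity
  -- This value minimizes `log m / r + r * V / 2`; at it both summands agree, and `a` is `log m + r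
  -- ^ 2 * V / 2`.
  set r : ℝ := √(2 * Real.log m / V) with hr
  have hr0 : 0 < r := Real.sqrt_pos.2 (by positivity)
  have hrsq : r ^ 2 = 2 * Real.log m / V := Real.sq_sqrt (by positivity)
  set a : ℝ := 2 * Real.log m with ha
  have hint : ∀ k, Integrable (fun ω => Real.exp (r * ∑ j ∈ Finset.Icc 1 t, X k j ω)) μ :=
    fun k => (h k).integrable_exp r t
  have hint2 : Integrable (fun ω => Real.exp (-a)
      * ∑ k, Real.exp (r * ∑ j ∈ Finset.Icc 1 t, X k j ω)) μ :=
    (integrable_finsetSum _ fun k _ => hint k).const_mul _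
  -- In place of the maximum, or of log-sum-exp, its tangent bound `log x ≤ a - 1 + exp (-a) * x` is
  -- used. It dominates every martingale pointwise, and only exponential moments are needed for its
  -- mean.
  refine ⟨fun ω => (a - 1 + Real.exp (-a)
    * ∑ k, Real.exp (r * ∑ j ∈ Finset.Icc 1 t, X k j ω)) / r,
    ((integrable_const _).add hint2).div_const r, fun k ω => ?_, ?_⟩
  · rw [le_div_iff₀ hr0]
    set s := ∑ j ∈ Finset.Icc 1 t, X k j ω with hs
    have h1 : Real.exp (r * s) ≤ ∑ k, Real.exp (r * ∑ j ∈ Finset.Icc 1 t, X k j ω) :=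
      Finset.single_le_sum (f := fun k => Real.exp (r * ∑ j ∈ Finset.Icc 1 t, X k j ω))
        (fun _ _ => (Real.exp_pos _).le) (Finset.mem_univ k)
    have h2 := Real.add_one_le_exp (-a + r * s)
    rw [Real.exp_add] at h2
    have h3 := mul_le_mul_of_nonneg_left h1 (Real.exp_pos (-a)).le
    linarith
  · rw [integral_div, integral_add (integrable_const _) hint2, integral_const_mul,
      integral_finsetSum _ fun k _ => hint k, integral_const, probReal_univ, one_smul]
    have hsum : ∑ k, ∫ ω, Real.exp (r * ∑ j ∈ Finset.Icc 1 t, X k j ω) ∂μ ≤ Real.exp a := by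
      calc _ ≤ ∑ _k : Fin m, Real.exp (r ^ 2 * V / 2) :=
            Finset.sum_le_sum fun k _ => (h k).integral_exp_le' hc r
        _ = Real.exp a := by
            rw [Finset.sum_const, Finset.card_univ, Fintype.card_fin, nsmul_eq_mul, hrsq, ha,
              div_mul_cancel₀ _ hV.ne', mul_div_cancel_left₀ _ two_ne_zero, two_mul, Real.exp_add,
              Real.exp_log hm0]
    have h1 : Real.exp (-a) * ∑ k, ∫ ω, Real.exp (r * ∑ j ∈ Finset.Icc 1 t, X k j ω) ∂μ ≤ 1 := by
      calc _ ≤ Real.exp (-a) * Real.exp a :=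
            mul_le_mul_of_nonneg_left hsum (Real.exp_pos _).le
        _ = 1 := by rw [← Real.exp_add, neg_add_cancel, Real.exp_zero]
    calc _ ≤ a / r := div_le_div_of_nonneg_right (by linarith) hr0.le
      _ ≤ √(2 * V * Real.log m) := by
        refine Real.le_sqrt_of_sq_le (le_of_eq ?_)
        rw [div_pow, hrsq, ha]
        field_simp

end Tail

/-! ### The bounds with high probability and in expectation. -/

namespace MinimaxProblem

section Pathwise

variable {E Z : Type*} [NormedAddCommGroup E] [NormedSpace ℝ E]
  [MeasurableSpace E] [MeasurableSpace Z] {m : ℕ} {S : MinimaxProblem E Z m}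
  {p : SampledRun E Z m}

/-- The optimization error after `t` rounds. -/
noncomputable def runError (S : MinimaxProblem E Z m) (p : SampledRun E Z m) (t : ℕ) : ℝ :=
  optError S.P S.ℓ S.W (weightedAvg (stepW S.D S.G m) p.w t) (weightedAvg (stepQ S.D S.G m) p.q t)

theorem runError_eq (p : SampledRun E Z m) (t : ℕ) : S.runError p t
    = optError S.P S.ℓ S.W (weightedAvg invSqrt p.w t) (weightedAvg invSqrt p.q t) := by
  have hL := gapScale_pos S.two_le S.D S.G
  have hD := S.D_pos
  have hm := log_nat_pos S.two_le
  rw [runError, weightedAvg_const_mul (c := 2 * S.D ^ 2 / gapScale S.D S.G m) (by positivity)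
      (stepW_eq S.two_le S.D S.G),
    weightedAvg_const_mul (c := 2 * Real.log m / gapScale S.D S.G m) (by positivity)
      (stepQ_eq S.two_le S.D S.G)]

variable [FiniteDimensional ℝ E]

theorem runError_le (h : S.IsRun p) (hb : S.IsTypical p) {t : ℕ} (ht : 1 ≤ t) {B : ℕ → ℝ}
    (hB : ∀ j ∈ Finset.Icc 1 t, ∀ i,
      risk (S.P i) S.ℓ (avgU p j i) - minRisk (S.P i) S.ℓ S.W ≤ B j) :
    S.runError p t ≤ (gapScale S.D S.G m * (2 + 5 / 2 * (1 + Real.log t)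
          + ∑ j ∈ Finset.Icc 1 t, S.gapNoise p j) + ∑ j ∈ Finset.Icc 1 t, invSqrt j * B j)
      / ∑ j ∈ Finset.Icc 1 t, invSqrt j := by
  have := S.neZero
  rw [runError_eq]
  exact optError_weightedAvg_le S.loss S.nonempty (fun j _ => invSqrt_nonneg j)
    (sum_invSqrt_pos ht) (fun j hj => h.w_mem (Finset.mem_Icc.1 hj).1)
    fun w' hw' q' hq' => sum_saddle_sub_le h hb hB hw' hq'

theorem runError_le_highProbBound (h : S.IsRun p) (hb : S.IsTypical p) {v : Fin m → E}
    (hv : ∀ i, IsArgmin (risk (S.P i) S.ℓ) S.W (v i)) {δ : ℝ} (hδ0 : 0 < δ) (hδ1 : δ < 1)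
    {t : ℕ} (ht : 1 ≤ t)
    (hgap : ∑ j ∈ Finset.Icc 1 t, S.gapNoise p j
      ≤ 8 * √((1 + Real.log t) * Real.log (2 * (t : ℝ) ^ 2 / δ)))
    (haux : ∀ s, 1 ≤ s → ∀ i, ∑ j ∈ Finset.Icc 1 s, S.auxNoise (v i) i p j
      ≤ 8 * S.D ^ 2 * √((1 + Real.log s) * Real.log (2 * m * (s : ℝ) ^ 2 / δ))) :
    S.runError p t ≤ highProbBound S.D S.G δ m t := by
  have hD := S.D_pos
  have hG := S.G_pos
  have hL := gapScale_pos S.two_le S.D S.G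
  have ht1 : (1 : ℝ) ≤ t := by exact_mod_cast ht
  have hlt : 0 ≤ Real.log t := Real.log_nonneg ht1
  have hm2 : (2 : ℝ) ≤ m := by exact_mod_cast S.two_le
  set K : ℝ := 3 + Real.log t
    + 16 * √((1 + Real.log t) * Real.log (2 * m * (t : ℝ) ^ 2 / δ)) with hK
  have hK0 : 0 ≤ K := by positivity
  have hB : ∀ j ∈ Finset.Icc 1 t, ∀ i,
      risk (S.P i) S.ℓ (avgU p j i) - minRisk (S.P i) S.ℓ S.W
        ≤ S.D * S.G * invSqrt j * (K / 2) := by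
    intro j hj i
    obtain ⟨hj1, hjt⟩ := Finset.mem_Icc.1 hj
    have hj1' : (1 : ℝ) ≤ j := by exact_mod_cast hj1
    have hjt' : (j : ℝ) ≤ t := by exact_mod_cast hjt
    have hlj : 0 ≤ Real.log j := Real.log_nonneg hj1'
    have hljt : Real.log j ≤ Real.log t := Real.log_le_log (by linarith) hjt'
    have hx1 : 1 ≤ 2 * m * (j : ℝ) ^ 2 / δ := by
      rw [le_div_iff₀ hδ0]
      nlinarith [one_le_pow₀ hj1' (n := 2)]
    -- The thresholds increase with time, so the bias in every round `j ≤ t` is governed by the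
    -- single constant `K` of round `t`.
    have hmono : √((1 + Real.log j) * Real.log (2 * m * (j : ℝ) ^ 2 / δ))
        ≤ √((1 + Real.log t) * Real.log (2 * m * (t : ℝ) ^ 2 / δ)) := by
      refine Real.sqrt_le_sqrt (mul_le_mul (by linarith) ?_ (Real.log_nonneg hx1) (by linarith))
      exact Real.log_le_log (by linarith) (by gcongr)
    have hN := haux j hj1 i
    refine (excessRisk_avgU_le h hb (hv i) hj1).trans
      (mul_le_mul_of_nonneg_left ?_ (mul_nonneg (by positivity) (invSqrt_nonneg j)))
    have hdiv : (∑ s ∈ Finset.Icc 1 j, S.auxNoise (v i) i p s) / S.D ^ 2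
        ≤ 8 * √((1 + Real.log t) * Real.log (2 * m * (t : ℝ) ^ 2 / δ)) := by
      rw [div_le_iff₀ (by positivity)]
      have := mul_le_mul_of_nonneg_left hmono (show 0 ≤ 8 * S.D ^ 2 by positivity)
      linarith
    rw [hK]; linarith
  refine (runError_le h hb ht hB).trans ?_
  have hsumB : ∑ j ∈ Finset.Icc 1 t, invSqrt j * (S.D * S.G * invSqrt j * (K / 2))
      ≤ 2 * S.D * S.G * K * (1 + Real.log t) := by
    have e : ∑ j ∈ Finset.Icc 1 t, invSqrt j * (S.D * S.G * invSqrt j * (K / 2))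
        = S.D * S.G * K / 2 * ∑ j ∈ Finset.Icc 1 t, invSqrt j ^ 2 := by
      rw [Finset.mul_sum]
      exact Finset.sum_congr rfl fun j _ => by ring
    rw [e]
    have h1 := mul_le_mul_of_nonneg_left (sum_invSqrt_sq_le t)
      (show 0 ≤ S.D * S.G * K / 2 by positivity)
    have h2 : 0 ≤ S.D * S.G * K * (1 + Real.log t) := by positivity
    linarith
  have hnum : gapScale S.D S.G m * (2 + 5 / 2 * (1 + Real.log t)
        + ∑ j ∈ Finset.Icc 1 t, S.gapNoise p j)
        + ∑ j ∈ Finset.Icc 1 t, invSqrt j * (S.D * S.G * invSqrt j * (K / 2))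
      ≤ gapScale S.D S.G m * (5 + 3 * Real.log t
        + 8 * √((1 + Real.log t) * Real.log (2 * (t : ℝ) ^ 2 / δ)))
        + 2 * S.D * S.G * K * (1 + Real.log t) :=
    add_le_add (mul_le_mul_of_nonneg_left (by linarith) hL.le) hsumB
  have hden := le_sum_invSqrt t
  have hden0 := sqrt_add_one_sub_one_pos ht
  rw [highProbBound, one_div_mul_eq_div]
  refine (div_le_div_of_nonneg_right hnum (sum_invSqrt_pos ht).le).trans ?_
  exact div_le_div_of_nonneg_left (by positivity) hden0 hden

end Pathwise

namespace IsRandomRun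

variable {E Z Ω : Type*} [NormedAddCommGroup E] [NormedSpace ℝ E] [FiniteDimensional ℝ E]
  [MeasurableSpace E] [BorelSpace E] [MeasurableSpace Z] {m : ℕ} {S : MinimaxProblem E Z m}
  {mΩ : MeasurableSpace Ω} {μ : Measure Ω} {p : Ω → SampledRun E Z m}

theorem integrable_runError [IsProbabilityMeasure μ] (h : IsRandomRun S μ p) {t : ℕ}
    (ht : 1 ≤ t) : Integrable (fun ω => S.runError (p ω) t) μ := by
  have := S.neZero
  simp only [runError_eq]
  have hw : ∀ ω, weightedAvg invSqrt (p ω).w t ∈ S.W := fun ω =>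
    weightedAvg_mem S.convex ht fun j hj => (h.isRun ω).w_mem hj
  have hq : ∀ ω, weightedAvg invSqrt (p ω).q t ∈ stdSimplex ℝ (Fin m) := fun ω =>
    weightedAvg_mem (convex_stdSimplex ℝ _) ht fun j hj => (h.isRun ω).q_mem hj
  refine integrable_of_abs_le (measurable_optError S.loss S.isCompact ?_ hw ?_) (C := 1)
    (Filter.Eventually.of_forall fun ω => abs_optError_le S.loss (hw ω) (hq ω))
  · exact measurable_weightedAvg fun s h1 _ =>
      measurable_w h.isRun h1 fun r _ => h.measurable_z r
  · exact measurable_weightedAvg fun s h1 _ =>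
      measurable_q h.isRun h1 fun r _ => h.measurable_z r

theorem highProb [IsProbabilityMeasure μ] (h : IsRandomRun S μ p) {δ : ℝ} (hδ0 : 0 < δ)
    (hδ1 : δ < 1) : 1 - 2 * δ ≤ μ.real {ω | ∀ t : ℕ, 1 ≤ t →
      S.runError (p ω) t ≤ highProbBound S.D S.G δ m t} := by
  choose v hv using fun i => (S.loss i).exists_isArgmin S.isCompact S.nonempty
  have hD := S.D_pos
  have hm2 : (2 : ℝ) ≤ m := by exact_mod_cast S.two_le
  -- The thresholds are chosen so that the events at time `t` have probability at most `δ / (2 * t ^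
  -- 2)` for the gap and `δ / (2 * m * t ^ 2)` for each auxiliary martingale, together at most `δ /
  -- t ^ 2`.
  set A : ℕ → Set Ω := fun t => {ω | 8 * √((1 + Real.log t) * Real.log (2 * (t : ℝ) ^ 2 / δ))
    ≤ ∑ j ∈ Finset.Icc 1 t, S.gapNoise (p ω) j} with hA
  set A' : ℕ → Fin m → Set Ω := fun t i =>
    {ω | 8 * S.D ^ 2 * √((1 + Real.log t) * Real.log (2 * m * (t : ℝ) ^ 2 / δ))
      ≤ ∑ j ∈ Finset.Icc 1 t, S.auxNoise (v i) i (p ω) j} with hA'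
  have hAle : ∀ t, 1 ≤ t → μ.real (A t) ≤ δ / (2 * (t : ℝ) ^ 2) := by
    intro t ht
    have ht1 : (1 : ℝ) ≤ t := by exact_mod_cast ht
    have hx : 1 ≤ 2 * (t : ℝ) ^ 2 / δ := by
      rw [le_div_iff₀ hδ0]; nlinarith [one_le_pow₀ ht1 (n := 2)]
    have hs := sum_sq_mul_invSqrt_le 1 t
    simp only [mul_one] at hs
    have := h.gapNoise_isBoundedMartingaleDiff.measure_ge_sqrt_log_le one_pos ht
      (by simpa using hs) hx
    simpa only [mul_one, one_div_div] using this
  have hAle' : ∀ t, 1 ≤ t → ∀ i, μ.real (A' t i) ≤ δ / (2 * m * (t : ℝ) ^ 2) := by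
    intro t ht i
    have ht1 : (1 : ℝ) ≤ t := by exact_mod_cast ht
    have hx : 1 ≤ 2 * m * (t : ℝ) ^ 2 / δ := by
      rw [le_div_iff₀ hδ0]; nlinarith [one_le_pow₀ ht1 (n := 2)]
    have := (h.auxNoise_isBoundedMartingaleDiff (hv i).1 i).measure_ge_sqrt_log_le
      (κ := S.D ^ 2) (by positivity) ht (sum_sq_mul_invSqrt_le _ t) hx
    simpa only [one_div_div] using this
  -- Shifted by one, since rounds start at 1. The sum of `1 / (t + 1) ^ 2` is at most 2, which
  -- explains the failure probability `2 * δ`.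
  set B : ℕ → Set Ω := fun t => A (t + 1) ∪ ⋃ i, A' (t + 1) i with hB
  have hBle : ∀ t, μ (B t) ≤ ENNReal.ofReal (δ * (1 / ((t : ℝ) + 1) ^ 2)) := by
    intro t
    have h1 : μ.real (B t) ≤ δ * (1 / ((t : ℝ) + 1) ^ 2) := by
      calc μ.real (B t) ≤ μ.real (A (t + 1)) + ∑ i, μ.real (A' (t + 1) i) :=
            (measureReal_union_le _ _).trans
              (add_le_add le_rfl (measureReal_iUnion_fintype_le _))
        _ ≤ δ / (2 * ((t + 1 : ℕ) : ℝ) ^ 2)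
            + ∑ _i : Fin m, δ / (2 * m * ((t + 1 : ℕ) : ℝ) ^ 2) :=
            add_le_add (hAle _ (by omega)) (Finset.sum_le_sum fun i _ => hAle' _ (by omega) i)
        _ = _ := by
            rw [Finset.sum_const, Finset.card_univ, Fintype.card_fin, nsmul_eq_mul]
            push_cast
            field_simp
            norm_num
    rw [← ofReal_measureReal]
    exact ENNReal.ofReal_le_ofReal h1
  have hUnion : μ (⋃ t, B t) ≤ ENNReal.ofReal (2 * δ) := by
    obtain ⟨hsum, htsum⟩ := tsum_one_div_sq_le
    calc μ (⋃ t, B t) ≤ ∑' t, μ (B t) := measure_iUnion_le _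
      _ ≤ ∑' t : ℕ, ENNReal.ofReal (δ * (1 / ((t : ℝ) + 1) ^ 2)) := ENNReal.tsum_le_tsum hBle
      _ = ENNReal.ofReal (∑' t : ℕ, δ * (1 / ((t : ℝ) + 1) ^ 2)) :=
          (ENNReal.ofReal_tsum_of_nonneg (fun _ => by positivity) (hsum.mul_left δ)).symm
      _ ≤ ENNReal.ofReal (2 * δ) := by
          refine ENNReal.ofReal_le_ofReal ?_
          rw [tsum_mul_left]
          nlinarith
  set good := {ω | ∀ t : ℕ, 1 ≤ t → S.runError (p ω) t ≤ highProbBound S.D S.G δ m t} with hgood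
  -- Covering the whole space and using subadditivity avoids having to show that `good` is
  -- measurable.
  have hcover : Set.univ ⊆ good ∪ (⋃ t, B t) ∪ {ω | ¬ S.IsTypical (p ω)} := by
    intro ω _
    by_cases h1 : S.IsTypical (p ω)
    · by_cases h2 : ω ∈ ⋃ t, B t
      · exact Or.inl (Or.inr h2)
      · refine Or.inl (Or.inl fun t ht => ?_)
        have hnot : ∀ s, 1 ≤ s → ω ∉ A s ∧ ∀ i, ω ∉ A' s i := by
          intro s hs
          obtain ⟨r, rfl⟩ : ∃ r, s = r + 1 := ⟨s - 1, by omega⟩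
          simp only [hB, Set.mem_iUnion, Set.mem_union, not_exists, not_or] at h2
          exact h2 r
        refine runError_le_highProbBound (h.isRun ω) h1 hv hδ0 hδ1 ht ?_ fun s hs i => ?_
        · exact (not_le.1 (hnot t ht).1).le
        · exact (not_le.1 ((hnot s hs).2 i)).le
    · exact Or.inr h1
  have hnull : μ.real {ω | ¬ S.IsTypical (p ω)} = 0 := by
    rw [measureReal_def, ae_iff.1 h.ae_isTypical, ENNReal.toReal_zero]
  have hUreal : μ.real (⋃ t, B t) ≤ 2 * δ :=
    ENNReal.toReal_le_of_le_ofReal (by positivity) hUnion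
  have h1 : (1 : ℝ) ≤ μ.real good + μ.real (⋃ t, B t) + μ.real {ω | ¬ S.IsTypical (p ω)} := by
    rw [← probReal_univ (μ := μ)]
    exact (measureReal_mono hcover).trans ((measureReal_union_le _ _).trans
      (add_le_add (measureReal_union_le _ _) le_rfl))
  linarith

/-- The gap martingale integrates to zero. The bias must be bounded simultaneously for all `i`
before integrating, so one random variable dominating all `m` auxiliary martingales is used in each
round. -/
theorem integral_runError_le [IsProbabilityMeasure μ] (h : IsRandomRun S μ p) {t : ℕ}
    (ht : 1 ≤ t) : ∫ ω, S.runError (p ω) t ∂μ ≤ expBound S.D S.G m t := by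
  choose v hv using fun i => (S.loss i).exists_isArgmin S.isCompact S.nonempty
  have hD := S.D_pos
  have hG := S.G_pos
  have hL := gapScale_pos S.two_le S.D S.G
  have hlogm := log_nat_pos S.two_le
  have ht1 : (1 : ℝ) ≤ t := by exact_mod_cast ht
  have hlt : 0 ≤ Real.log t := Real.log_nonneg ht1
  have hY : ∀ j : ℕ, ∃ Y : Ω → ℝ, 1 ≤ j → Integrable Y μ ∧
      (∀ k ω, ∑ s ∈ Finset.Icc 1 j, S.auxNoise (v k) k (p ω) s ≤ Y ω) ∧
      ∫ ω, Y ω ∂μ ≤ √(2 * (32 * (S.D ^ 2) ^ 2 * (1 + Real.log j)) * Real.log m) := by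
    intro j
    by_cases hj : 1 ≤ j
    · have hlj : 0 ≤ Real.log j := Real.log_nonneg (by exact_mod_cast hj)
      obtain ⟨Y, hY⟩ := exists_integrable_dominating S.two_le
        (fun k => h.auxNoise_isBoundedMartingaleDiff (hv k).1 k)
        (V := 32 * (S.D ^ 2) ^ 2 * (1 + Real.log j)) (by positivity) (sum_sq_mul_invSqrt_le _ j)
      exact ⟨Y, fun _ => hY⟩
    · exact ⟨0, fun hj' => absurd hj' hj⟩
  choose Y hY using hY
  set T := ∑ j ∈ Finset.Icc 1 t, invSqrt j with hT
  have hT0 : 0 < T := sum_invSqrt_pos ht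
  set Bd : ℕ → Ω → ℝ := fun j ω =>
    S.D * S.G * invSqrt j * ((3 + Real.log j) / 2 + Y j ω / S.D ^ 2) with hBd
  have hpath : ∀ᵐ ω ∂μ, S.runError (p ω) t ≤ (gapScale S.D S.G m * (2 + 5 / 2 * (1 + Real.log t)
      + ∑ j ∈ Finset.Icc 1 t, S.gapNoise (p ω) j)
      + ∑ j ∈ Finset.Icc 1 t, invSqrt j * Bd j ω) / T := by
    filter_upwards [h.ae_isTypical] with ω hω
    refine runError_le (h.isRun ω) hω ht fun j hj i => ?_
    have hj1 := (Finset.mem_Icc.1 hj).1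
    refine (excessRisk_avgU_le (h.isRun ω) hω (hv i) hj1).trans
      (mul_le_mul_of_nonneg_left (add_le_add le_rfl ?_)
        (mul_nonneg (by positivity) (invSqrt_nonneg j)))
    exact div_le_div_of_nonneg_right ((hY j hj1).2.1 i ω) (by positivity)
  have hM := h.gapNoise_isBoundedMartingaleDiff.integrable_sum t
  have hM0 := h.gapNoise_isBoundedMartingaleDiff.integral_sum_eq_zero t
  have hYi : ∀ j ∈ Finset.Icc 1 t, Integrable (Bd j) μ := fun j hj =>
    ((integrable_const _).add ((hY j (Finset.mem_Icc.1 hj).1).1.div_const _)).const_mul _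
  have hi1 : Integrable (fun ω => gapScale S.D S.G m * (2 + 5 / 2 * (1 + Real.log t)
      + ∑ j ∈ Finset.Icc 1 t, S.gapNoise (p ω) j)) μ :=
    ((integrable_const _).add hM).const_mul _
  have hi2 : Integrable (fun ω => ∑ j ∈ Finset.Icc 1 t, invSqrt j * Bd j ω) μ :=
    integrable_finsetSum _ fun j hj => (hYi j hj).const_mul _
  have hBint : ∀ j ∈ Finset.Icc 1 t, ∫ ω, Bd j ω ∂μ ≤ S.D * S.G * invSqrt j *
      ((3 + Real.log t) / 2 + 8 * √(Real.log m) * √(1 + Real.log t)) := by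
    intro j hj
    obtain ⟨hj1, hjt⟩ := Finset.mem_Icc.1 hj
    have hlj : 0 ≤ Real.log j := Real.log_nonneg (by exact_mod_cast hj1)
    have hljt : Real.log j ≤ Real.log t :=
      Real.log_le_log (by exact_mod_cast hj1) (by exact_mod_cast hjt)
    simp only [hBd]
    rw [integral_const_mul, integral_add (integrable_const _) ((hY j hj1).1.div_const _),
      integral_div (S.D ^ 2) (Y j), integral_const, probReal_univ, one_smul]
    refine mul_le_mul_of_nonneg_left (add_le_add (by linarith) ?_)
      (mul_nonneg (by positivity) (invSqrt_nonneg j))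
    rw [div_le_iff₀ (by positivity)]
    refine (hY j hj1).2.2.trans (Real.sqrt_le_iff.2 ⟨by positivity, ?_⟩)
    rw [mul_pow, mul_pow, mul_pow, Real.sq_sqrt hlogm.le,
      Real.sq_sqrt (show 0 ≤ 1 + Real.log t by linarith)]
    have := mul_le_mul_of_nonneg_left (show 1 + Real.log j ≤ 1 + Real.log t by linarith)
      (show 0 ≤ 64 * Real.log m * (S.D ^ 2) ^ 2 by positivity)
    linarith
  set K : ℝ := (3 + Real.log t) / 2 + 8 * √(Real.log m) * √(1 + Real.log t) with hK
  have hK0 : 0 ≤ K := by positivity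
  have hsumB : ∑ j ∈ Finset.Icc 1 t, invSqrt j * ∫ ω, Bd j ω ∂μ
      ≤ S.D * S.G * K * (1 + Real.log t) := by
    calc _ ≤ ∑ j ∈ Finset.Icc 1 t, S.D * S.G * K * invSqrt j ^ 2 :=
          Finset.sum_le_sum fun j hj =>
            (mul_le_mul_of_nonneg_left (hBint j hj) (invSqrt_nonneg j)).trans (le_of_eq (by ring))
      _ ≤ _ := by
          rw [← Finset.mul_sum]
          exact mul_le_mul_of_nonneg_left (sum_invSqrt_sq_le t) (by positivity)
  -- A crude comparison: the stated bound leaves room here, so constants are not tracked sharply.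
  have hKle : K ≤ 2 * (3 + Real.log t
      + 16 * (1 + √(Real.log m)) * √(2 * (1 + Real.log t))) := by
    have h1 : √(1 + Real.log t) ≤ √(2 * (1 + Real.log t)) := Real.sqrt_le_sqrt (by linarith)
    have h2 : √(Real.log m) * √(1 + Real.log t)
        ≤ (1 + √(Real.log m)) * √(2 * (1 + Real.log t)) :=
      mul_le_mul (by linarith) h1 (Real.sqrt_nonneg _) (by positivity)
    have h3 : 0 ≤ (1 + √(Real.log m)) * √(2 * (1 + Real.log t)) := by positivity
    rw [hK]; linarith
  calc ∫ ω, S.runError (p ω) t ∂μ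
      ≤ ∫ ω, (gapScale S.D S.G m * (2 + 5 / 2 * (1 + Real.log t)
      + ∑ j ∈ Finset.Icc 1 t, S.gapNoise (p ω) j)
      + ∑ j ∈ Finset.Icc 1 t, invSqrt j * Bd j ω) / T ∂μ :=
        integral_mono_ae (h.integrable_runError ht) ((hi1.add hi2).div_const T) hpath
    _ = (gapScale S.D S.G m * (2 + 5 / 2 * (1 + Real.log t))
        + ∑ j ∈ Finset.Icc 1 t, invSqrt j * ∫ ω, Bd j ω ∂μ) / T := by
        rw [integral_div, integral_add hi1 hi2, integral_const_mul,
          integral_add (integrable_const _) hM, hM0, integral_const, probReal_univ, one_smul,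
          add_zero, integral_finsetSum _ fun j hj => (hYi j hj).const_mul _]
        simp only [integral_const_mul]
    _ ≤ ((5 + 3 * Real.log t) * gapScale S.D S.G m
        + 2 * S.D * S.G * (3 + Real.log t
          + 16 * (1 + √(Real.log m)) * √(2 * (1 + Real.log t))) * (1 + Real.log t)) / T := by
        refine div_le_div_of_nonneg_right (add_le_add ?_ (hsumB.trans ?_)) hT0.le
        · rw [mul_comm]
          exact mul_le_mul_of_nonneg_right (by linarith) hL.le
        · refine mul_le_mul_of_nonneg_right ?_ (by linarith)
          have := mul_le_mul_of_nonneg_left hKle (show 0 ≤ S.D * S.G by positivity)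
          linarith
    _ ≤ expBound S.D S.G m t :=
        div_le_div_of_nonneg_left (by positivity) (sqrt_add_one_sub_one_pos ht) (le_sum_invSqrt t)

end IsRandomRun

end MinimaxProblem

/-! ### Order of the explicit bounds. -/

section Rates

theorem half_sqrt_le_denom {t : ℕ} (ht : 1 ≤ t) :
    √(t : ℝ) / 2 ≤ 2 * (√((t : ℝ) + 1) - 1) := by
  have h1 : (1 : ℝ) ≤ t := by exact_mod_cast ht
  have h2 : 1 ≤ √(t : ℝ) := Real.one_le_sqrt.2 h1
  have h3 : √(t : ℝ) ^ 2 = t := Real.sq_sqrt (by positivity)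
  have h4 : 1 + √(t : ℝ) / 4 ≤ √((t : ℝ) + 1) := by
    refine Real.le_sqrt_of_sq_le ?_
    nlinarith
  linarith

theorem half_le_log {n : ℕ} (hn : 2 ≤ n) : 1 / 2 ≤ Real.log n := by
  have h1 : Real.log 2 ≤ Real.log n := Real.log_le_log (by norm_num) (by exact_mod_cast hn)
  linarith [Real.log_two_gt_d9]

theorem one_le_two_mul_sqrt {x : ℝ} (hx : 1 / 2 ≤ x) : 1 ≤ 2 * √x := by
  have : 1 / 2 ≤ √x := Real.le_sqrt_of_sq_le (by linarith)
  linarith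

/-- In terms of `√(log t)` and `√(log n)` the numerator of the rate is a polynomial, so the
comparisons reduce to monomial inequalities. -/
theorem anytimeRate_eq (n t : ℕ) (ht : 1 ≤ t) : anytimeRate n t
    = (√(Real.log t) ^ 4 + √(Real.log n) * √(Real.log t) ^ 3) / √(t : ℝ) := by
  have hx : 0 ≤ Real.log t := Real.log_nonneg (by exact_mod_cast ht)
  have h1 : √(Real.log t) ^ 4 = Real.log t ^ 2 := by
    rw [show √(Real.log t) ^ 4 = (√(Real.log t) ^ 2) ^ 2 by ring, Real.sq_sqrt hx]
  have h2 : √(Real.log t) ^ 3 = Real.log t ^ (3 / 2 : ℝ) := by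
    rw [Real.sqrt_eq_rpow, ← Real.rpow_natCast, ← Real.rpow_mul hx]
    norm_num
  rw [anytimeRate, h1, h2, Real.sqrt_eq_rpow (Real.log n)]

/-- For `n ≥ 2` the logarithm is at least `1 / 2`, so a constant can be absorbed into a multiple of
`√(log n)`; this keeps the final constant independent of `n`. -/
theorem scale_le {a : ℝ} (ha : 0 ≤ a) {n : ℕ} (hn : 2 ≤ n) :
    √(2 * a ^ 2 + 2 * Real.log n) ≤ (4 * a + 2) * √(Real.log n) := by
  have hl := half_le_log hn
  have h1 := one_le_two_mul_sqrt hl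
  have h2 : √(Real.log n) ^ 2 = Real.log n := Real.sq_sqrt (by linarith)
  refine Real.sqrt_le_iff.2 ⟨by positivity, ?_⟩
  rw [mul_pow, h2]
  nlinarith [mul_nonneg ha (by linarith : 0 ≤ Real.log n),
    mul_nonneg (mul_nonneg ha ha) (by linarith : 0 ≤ Real.log n - 1 / 2)]

/-- A bound with numerator `N` of the order of the rate is of the order of the rate. -/
theorem div_denom_le_mul_anytimeRate {N C : ℝ} {n t : ℕ} (ht : 2 ≤ t) (hC : 0 ≤ C)
    (hN : N ≤ C * (√(Real.log t) ^ 4 + √(Real.log n) * √(Real.log t) ^ 3)) :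
    N / (2 * (√((t : ℝ) + 1) - 1)) ≤ 2 * C * anytimeRate n t := by
  have hst : 0 < √(t : ℝ) := Real.sqrt_pos.2 (by positivity)
  have hden := half_sqrt_le_denom (t := t) (by omega)
  rw [anytimeRate_eq n t (by omega)]
  calc N / (2 * (√((t : ℝ) + 1) - 1))
      ≤ C * (√(Real.log t) ^ 4 + √(Real.log n) * √(Real.log t) ^ 3)
        / (2 * (√((t : ℝ) + 1) - 1)) := div_le_div_of_nonneg_right hN (by linarith)
    _ ≤ C * (√(Real.log t) ^ 4 + √(Real.log n) * √(Real.log t) ^ 3) / (√(t : ℝ) / 2) :=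
        div_le_div_of_nonneg_left (by positivity) (by positivity) hden
    _ = _ := by field_simp

theorem expBound_le_mul_anytimeRate {D G : ℝ} (hD : 0 < D) (hG : 0 < G) :
    ∃ C : ℝ, ∀ n t : ℕ, 2 ≤ n → 2 ≤ t → expBound D G n t ≤ C * anytimeRate n t := by
  refine ⟨2 * (26 * (4 * (D * G) + 2) + 618 * (D * G)), fun n t hn ht => ?_⟩
  refine div_denom_le_mul_anytimeRate ht (by positivity) ?_
  have ha : 0 < D * G := by positivity
  have hL := scale_le ha.le hn
  rw [show 2 * (D * G) ^ 2 + 2 * Real.log n = 2 * D ^ 2 * G ^ 2 + 2 * Real.log n by ring] at hL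
  have hx := half_le_log ht
  have hs1 := one_le_two_mul_sqrt hx
  have hs2 : √(Real.log t) ^ 2 = Real.log t := Real.sq_sqrt (by linarith)
  have hy1 := one_le_two_mul_sqrt (half_le_log hn)
  have hs0 : 0 ≤ √(Real.log t) := Real.sqrt_nonneg _
  have hy0 : 0 ≤ √(Real.log n) := Real.sqrt_nonneg _
  have hr : √(2 * (1 + Real.log t)) ≤ 3 * √(Real.log t) := by
    refine Real.sqrt_le_iff.2 ⟨by positivity, ?_⟩
    rw [mul_pow, hs2]; linarith
  set s := √(Real.log t)
  set y := √(Real.log n)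
  rw [← hs2] at hx ⊢
  -- From `s ^ 2 ≥ 1 / 2` every constant is at most twice as many copies of `s ^ 2`: hence 13, 7 and
  -- 3 here and below. Missing powers of `s` are supplied by `1 ≤ 2 * s`.
  have e1 : (5 + 3 * s ^ 2) * √(2 * D ^ 2 * G ^ 2 + 2 * Real.log n)
      ≤ 13 * s ^ 2 * ((4 * (D * G) + 2) * y) :=
    mul_le_mul (by linarith) hL (Real.sqrt_nonneg _) (by positivity)
  have e2 : 13 * s ^ 2 * ((4 * (D * G) + 2) * y) ≤ 26 * (4 * (D * G) + 2) * (y * s ^ 3) := by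
    have : 0 ≤ 13 * (4 * (D * G) + 2) * y * s ^ 2 * (2 * s - 1) :=
      mul_nonneg (by positivity) (by linarith)
    linarith
  have e3 : 3 + s ^ 2 + 16 * (1 + y) * √(2 * (1 + s ^ 2)) ≤ 7 * s ^ 2 + 48 * (1 + y) * s := by
    rw [← hs2] at hr
    have := mul_le_mul_of_nonneg_left hr (by positivity : 0 ≤ 16 * (1 + y))
    linarith
  have e4 : 2 * D * G * (3 + s ^ 2 + 16 * (1 + y) * √(2 * (1 + s ^ 2))) * (1 + s ^ 2)
      ≤ 2 * D * G * (7 * s ^ 2 + 48 * (1 + y) * s) * (3 * s ^ 2) :=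
    mul_le_mul (mul_le_mul_of_nonneg_left e3 (by positivity)) (by linarith) (by positivity)
      (by positivity)
  have e5 : 2 * D * G * (7 * s ^ 2 + 48 * (1 + y) * s) * (3 * s ^ 2)
      ≤ 618 * (D * G) * (s ^ 4 + y * s ^ 3) := by
    have h1 : 0 ≤ 288 * (D * G) * s ^ 3 * (2 * s - 1) :=
      mul_nonneg (by positivity) (by linarith)
    have h2 : 0 ≤ (D * G) * (y * s ^ 3) := by positivity
    linarith
  have e6 : 0 ≤ 26 * (4 * (D * G) + 2) * s ^ 4 := by positivity
  linarith

theorem highProbBound_le_mul_anytimeRate {D G : ℝ} (hD : 0 < D) (hG : 0 < G) {δ : ℝ}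
    (hδ0 : 0 < δ) (hδ1 : δ < 1) :
    ∃ C : ℝ, ∀ n t : ℕ, 2 ≤ n → 2 ≤ t → highProbBound D G δ n t ≤ C * anytimeRate n t := by
  -- This `k` satisfies `log (2 * t ^ 2 / δ) ≤ k ^ 2 * log t` for `t ≥ 2`, since `log t ≥ 1 / 2`;
  -- all dependence on `δ` passes through it.
  obtain ⟨k, hk0, hk⟩ : ∃ k : ℝ, 0 ≤ k ∧ k ^ 2 = 4 + 2 * Real.log (1 / δ) := by
    have : 0 ≤ Real.log (1 / δ) := Real.log_nonneg (by rw [le_div_iff₀ hδ0]; linarith)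
    exact ⟨√(4 + 2 * Real.log (1 / δ)), Real.sqrt_nonneg _, Real.sq_sqrt (by linarith)⟩
  refine ⟨2 * ((4 * (D * G) + 2) * (13 + 16 * k) * 2 + 6 * (D * G) * (39 + 32 * k)),
    fun n t hn ht => ?_⟩
  rw [highProbBound, one_div_mul_eq_div]
  refine div_denom_le_mul_anytimeRate ht (by positivity) ?_
  have ha : 0 < D * G := by positivity
  have hL := scale_le ha.le hn
  rw [show 2 * (D * G) ^ 2 + 2 * Real.log n = 2 * D ^ 2 * G ^ 2 + 2 * Real.log n by ring] at hL
  have hx := half_le_log ht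
  have hn0 : (0 : ℝ) < n := by positivity
  have ht0 : (0 : ℝ) < t := by positivity
  have hlδ : 0 ≤ Real.log (1 / δ) := Real.log_nonneg (by rw [le_div_iff₀ hδ0]; linarith)
  have hlog : Real.log (2 * (t : ℝ) ^ 2 / δ) ≤ k ^ 2 * Real.log t := by
    have e : 2 * (t : ℝ) ^ 2 / δ = 2 * (t : ℝ) ^ 2 * (1 / δ) := by ring
    rw [e, Real.log_mul (by positivity) (by positivity), Real.log_mul (by norm_num) (by positivity),
      Real.log_pow, hk]
    push_cast
    nlinarith [Real.log_two_lt_d9]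
  have hlogm : Real.log (2 * n * (t : ℝ) ^ 2 / δ)
      = Real.log n + Real.log (2 * (t : ℝ) ^ 2 / δ) := by
    rw [← Real.log_mul (by positivity) (by positivity)]
    congr 1; ring
  have hs1 := one_le_two_mul_sqrt hx
  have hs2 : √(Real.log t) ^ 2 = Real.log t := Real.sq_sqrt (by linarith)
  have hy2 : √(Real.log n) ^ 2 = Real.log n := Real.sq_sqrt (by linarith [half_le_log hn])
  have hs0 : 0 ≤ √(Real.log t) := Real.sqrt_nonneg _
  have hy0 : 0 ≤ √(Real.log n) := Real.sqrt_nonneg _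
  have hr1 : √((1 + Real.log t) * Real.log (2 * (t : ℝ) ^ 2 / δ)) ≤ 2 * k * √(Real.log t) ^ 2 := by
    refine Real.sqrt_le_iff.2 ⟨by positivity, ?_⟩
    calc _ ≤ (4 * Real.log t) * (k ^ 2 * Real.log t) :=
          (mul_le_mul_of_nonneg_left hlog (by linarith)).trans
            (mul_le_mul_of_nonneg_right (by linarith) (by positivity))
      _ = _ := by rw [hs2]; ring
  have hr2 : √((1 + Real.log t) * Real.log (2 * n * (t : ℝ) ^ 2 / δ))
      ≤ 2 * √(Real.log t) * (√(Real.log n) + k * √(Real.log t)) := by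
    refine Real.sqrt_le_iff.2 ⟨by positivity, ?_⟩
    have hle : Real.log (2 * n * (t : ℝ) ^ 2 / δ) ≤ (√(Real.log n) + k * √(Real.log t)) ^ 2 := by
      rw [hlogm, add_sq, mul_pow, hs2, hy2]
      have : 0 ≤ 2 * √(Real.log n) * (k * √(Real.log t)) := by positivity
      linarith
    calc _ ≤ (4 * Real.log t) * (√(Real.log n) + k * √(Real.log t)) ^ 2 :=
          (mul_le_mul_of_nonneg_left hle (by linarith)).trans
            (mul_le_mul_of_nonneg_right (by linarith) (by positivity))
      _ = _ := by rw [mul_pow, mul_pow, hs2]; ring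
  set s := √(Real.log t)
  set y := √(Real.log n)
  set r1 := √((1 + Real.log t) * Real.log (2 * (t : ℝ) ^ 2 / δ))
  set r2 := √((1 + Real.log t) * Real.log (2 * n * (t : ℝ) ^ 2 / δ))
  rw [← hs2] at hx ⊢
  have hr20 : 0 ≤ r2 := Real.sqrt_nonneg _
  have hr10 : 0 ≤ r1 := Real.sqrt_nonneg _
  have e1 : √(2 * D ^ 2 * G ^ 2 + 2 * Real.log n) * (5 + 3 * s ^ 2 + 8 * r1)
      ≤ ((4 * (D * G) + 2) * y) * ((13 + 16 * k) * s ^ 2) :=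
    mul_le_mul hL (by linarith) (by positivity) (by positivity)
  have e2 : ((4 * (D * G) + 2) * y) * ((13 + 16 * k) * s ^ 2)
      ≤ (4 * (D * G) + 2) * (13 + 16 * k) * 2 * (y * s ^ 3) := by
    have : 0 ≤ (4 * (D * G) + 2) * (13 + 16 * k) * y * s ^ 2 * (2 * s - 1) :=
      mul_nonneg (by positivity) (by linarith)
    linarith
  have e4 : 2 * D * G * (3 + s ^ 2 + 16 * r2) * (1 + s ^ 2)
      ≤ 2 * D * G * (7 * s ^ 2 + 32 * s * (y + k * s)) * (3 * s ^ 2) :=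
    mul_le_mul (mul_le_mul_of_nonneg_left (by linarith) (by positivity)) (by linarith)
      (by positivity) (by positivity)
  have e5 : 2 * D * G * (7 * s ^ 2 + 32 * s * (y + k * s)) * (3 * s ^ 2)
      ≤ 6 * (D * G) * (39 + 32 * k) * (s ^ 4 + y * s ^ 3) := by
    have h1 : 0 ≤ (D * G) * s ^ 4 := by positivity
    have h2 : 0 ≤ (D * G) * (7 + 32 * k) * (y * s ^ 3) := by positivity
    linarith
  have e6 : 0 ≤ (4 * (D * G) + 2) * (13 + 16 * k) * 2 * s ^ 4 := by positivity
  linarith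

end Rates

/-! ### The theorem. -/

theorem theorem2
    {E : Type*} [NormedAddCommGroup E] [NormedSpace ℝ E] [FiniteDimensional ℝ E]
    [MeasurableSpace E] [BorelSpace E]
    {Z : Type*} [MeasurableSpace Z]
    {Ω : Type*} [MeasurableSpace Ω] (μ : Measure Ω) [IsProbabilityMeasure μ]
    (m : ℕ) (hm : 2 ≤ m)
    (P : Fin m → Measure Z) [∀ i, IsProbabilityMeasure (P i)]
    -- the domain and its distance-generating function
    (W : Set E) (hWne : W.Nonempty) (hWclosed : IsClosed W)
    (ν : E → ℝ) (hν : IsDistanceGenerating ν W)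
    -- the loss and its gradient
    (ℓ : E → Z → ℝ) (dℓ : E → Z → (E →L[ℝ] ℝ))
    (hdℓ : ∀ z, ∀ w ∈ W, HasFDerivWithinAt (fun w' => ℓ w' z) (dℓ w z) W w)
    (hℓ_meas : Measurable (fun p : W × Z => ℓ p.1 p.2))
    (hdℓ_meas : Measurable (fun p : W × Z => dℓ p.1 p.2))
    -- the domain and the risks are convex
    (hWconv : Convex ℝ W) (hRconv : ∀ i, ConvexOn ℝ W (risk (P i) ℓ))
    -- the domain is bounded
    (D : ℝ) (hD : 0 < D) (o : E) (ho : IsArgmin ν W o)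
    (hbdd : ∀ w ∈ W, bregman ν W w o ≤ D ^ 2)
    -- the gradients are bounded in the dual norm
    (G : ℝ) (hG : 0 < G) (hgrad : ∀ i, ∀ᵐ z ∂(P i), ∀ w ∈ W, ‖dℓ w z‖ ≤ G)
    -- the losses lie in [0, 1]
    (hloss : ∀ i, ∀ᵐ z ∂(P i), ∀ w ∈ W, 0 ≤ ℓ w z ∧ ℓ w z ≤ 1)
    -- the samples: independent rounds, the i-th sample of each round has law P i
    (z : ℕ → Fin m → Ω → Z) (hz_meas : ∀ t i, Measurable (z t i))
    (hz_law : ∀ t i, μ.map (z t i) = P i)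
    (hz_indep : iIndepFun (fun (t : ℕ) (ω : Ω) (i : Fin m) => z t i ω) μ)
    -- the iterates of the algorithm
    (u : ℕ → Fin m → Ω → E) (w : ℕ → Ω → E) (q : ℕ → Ω → Fin m → ℝ)
    (hrun : ∀ ω, IsAnytimeRun W ν ℓ dℓ (fun _ => stepI D G) (stepW D G m) (stepQ D G m)
      (fun t i => z t i ω) (fun t i => u t i ω) (fun t => w t ω) (fun t => q t ω)) :
    -- the bound in expectation
    (∀ t : ℕ, 1 ≤ t →
      Integrable (fun ω => optError P ℓ W
        (weightedAvg (stepW D G m) (fun j => w j ω) t)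
        (weightedAvg (stepQ D G m) (fun j => q j ω) t)) μ ∧
      ∫ ω, optError P ℓ W
        (weightedAvg (stepW D G m) (fun j => w j ω) t)
        (weightedAvg (stepQ D G m) (fun j => q j ω) t) ∂μ ≤ expBound D G m t) ∧
    -- the bound with high probability, simultaneously for all t
    (∀ δ : ℝ, 0 < δ → δ < 1 →
      1 - 2 * δ ≤ μ.real {ω | ∀ t : ℕ, 1 ≤ t →
        optError P ℓ W
          (weightedAvg (stepW D G m) (fun j => w j ω) t)
          (weightedAvg (stepQ D G m) (fun j => q j ω) t) ≤ highProbBound D G δ m t}) ∧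
    -- both bounds are of the stated order, uniformly in the number of distributions
    (∃ C : ℝ, ∀ n t : ℕ, 2 ≤ n → 2 ≤ t → expBound D G n t ≤ C * anytimeRate n t) ∧
    (∀ δ : ℝ, 0 < δ → δ < 1 →
      ∃ C : ℝ, ∀ n t : ℕ, 2 ≤ n → 2 ≤ t → highProbBound D G δ n t ≤ C * anytimeRate n t) := by
  let S : MinimaxProblem E Z m :=
    { W := W, ν := ν, ℓ := ℓ, dℓ := dℓ, P := P, D := D, G := G, o := o
      two_le := hm
      isClosed := hWclosed
      dgf := hν
      isProb := inferInstance
      loss := fun i => ⟨hdℓ, hℓ_meas, hdℓ_meas, hRconv i, hgrad i, hloss i⟩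
      D_pos := hD
      G_pos := hG
      isArgmin := ho
      bregman_le := hbdd }
  let p : Ω → SampledRun E Z m := fun ω =>
    { z := fun t i => z t i ω, u := fun t i => u t i ω, w := fun t => w t ω, q := fun t => q t ω }
  have h : MinimaxProblem.IsRandomRun S μ p :=
    { isRun := hrun, measurable_z := hz_meas, map_z := hz_law, iIndepFun := hz_indep }
  exact ⟨fun t ht => ⟨h.integrable_runError ht, h.integral_runError_le ht⟩,
    fun δ hδ0 hδ1 => h.highProb hδ0 hδ1, expBound_le_mul_anytimeRate hD hG,
    fun δ hδ0 hδ1 => highProbBound_le_mul_anytimeRate hD hG hδ0 hδ1⟩
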